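/- Let $\mathbb K$ be $\mathbb R$ or $\mathbb C$ and $n\in\mathbb N$, $n\ge 1$. An s-tensor norm $\beta$ of order $n$ assigns to each Banach space $E$ a norm on the symmetric tensor product $\otimes^{n,s}E$ with $\varepsilon_s\le\beta\le\pi_s$ and $\|\otimes^{n,s}T\|\le\|T\|^n$ for every bounded operator $T$; it is finitely generated if $\beta(z,\otimes^{n,s}E)=\inf\{\beta(z,\otimes^{n,s}M): M\subset E,\ \dim M<\infty,\ z\in\otimes^{n,s}M\}$. Its dual $\beta'$ is the finitely generated s-tensor norm with $(\otimes^{n,s}M,\beta')=[(\otimes^{n,s}M',\beta)]'$ isometrically for finite dimensional $M$. A finitely generated $\beta$ is associated with an ideal $\mathcal Q$ of $n$-homogeneous polynomials if $(\otimes^{n,s}M',\beta)=\mathcal Q(M)$ isometrically, by $\otimes^n\varphi\mapsto\varphi^n$, for every finite dimensional $M$. A finitely generated $\beta$ has the symmetric Radon-Nikodým property (sRN property) if the canonical map $$J:\widetilde\otimes^{n,s}_{\beta}\ell_1\longrightarrow\big(\widetilde\otimes^{n,s}_{\beta'}c_0\big)',\qquad \langle J(\otimes^n a),\otimes^n x\rangle=\Big(\sum_i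 a_ix_i\Big)^n,$$ is an isometric isomorphism (tildes denote completions). (a) Let $2\le n\le r\le\infty$. Let $\mathcal L_r^n(E)$ be the space of $r$-factorable polynomials, i.e. those of the form $P=Q\circ T$ with $T\in\mathcal L(E,L_r(\mu))$ for some measure $\mu$ and $Q$ a continuous $n$-homogeneous polynomial on $L_r(\mu)$, with $\|P\|_{\mathcal L_r^n}=\inf\|Q\|\|T\|^n$ over all such factorizations. Then there is a finitely generated s-tensor norm $\rho_n^r$ associated with $\mathcal L_r^n$, and it has the sRN property. (b) Let $2\le n\le r<\infty$. Let $\mathcal J_r^n(E)$ be the space of positively $r$-factorable polynomials, defined in the same way but with $Q$ required to be positive (its symmetric $n$-linear form is $\ge0$ on tuples of nonnegative functions), with the norm given by the infimum over such factorizations. Then there is a finitely generated s-tensor norm $\delta_n^r$ associated with $\mathcal J_r^n$, and it has the sRN property. (c) Let $1\le n\le r<\infty$. For $x_1,\dots,x_m\in E$ put $w_r((x_i))=\sup_{\varphi\in B_{E'}}\big(\sum_i|\varphi(x_i)|^r\big)^{1/r}$. Let $\mathcal D_r^n(E)$ be the space of $r$-dominated polynomials, i.e. the continuous $n$-homogeneous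 polynomials $P$ on $E$ for which there is $C>0$ with $\big(\sum_{i=1}^m|P(x_i)|^{r/n}\big)^{n/r}\le C\,w_r((x_i)_{i=1}^m)^n$ for all finite sequences in $E$, normed by the infimum of such $C$. With $s\in[1,\infty]$ given by $\frac1s+\frac nr=1$, put $$\alpha_{r'}^n(z,\otimes^{n,s}E)=\inf\Big\{\|(\lambda_i)\|_{\ell_s}\,w_r((x_i))^n:\ z=\sum_{i=1}^m\lambda_i\otimes^n x_i\Big\}.$$ Then $\alpha_{r'}^n$ is a finitely generated s-tensor norm, its dual $(\alpha_{r'}^n)'$ is the s-tensor norm associated with $\mathcal D_r^n$, and $(\alpha_{r'}^n)'$ has the sRN property. -/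

import Mathlib

open scoped TensorProduct ENNReal ZeroAtInfty

noncomputable section

namespace SymRN

/-! ### Symmetric tensor products -/

/-- The `n`-fold symmetric tensor product `⊗^{n,s} E`: the span of the powers `x ⊗ ⋯ ⊗ x`
inside the full `n`-fold algebraic tensor product of `E`. -/
def SymTensor (𝕜 : Type) [RCLike 𝕜] (n : ℕ) (E : Type) [NormedAddCommGroup E] [NormedSpace 𝕜 E] :
    Submodule 𝕜 (⨂[𝕜] _ : Fin n, E) :=
  Submodule.span 𝕜 (Set.range fun x : E => PiTensorProduct.tprod 𝕜 fun _ : Fin n => x)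

section Basic

variable {𝕜 : Type} [RCLike 𝕜] {n : ℕ}
variable {E : Type} [NormedAddCommGroup E] [NormedSpace 𝕜 E]
variable {F : Type} [NormedAddCommGroup F] [NormedSpace 𝕜 F]
variable {G : Type} [NormedAddCommGroup G] [NormedSpace 𝕜 G]

/-- The elementary symmetric tensor `⊗^n x = x ⊗ ⋯ ⊗ x`. -/
def tpow (𝕜 : Type) [RCLike 𝕜] (n : ℕ) {E : Type} [NormedAddCommGroup E] [NormedSpace 𝕜 E]
    (x : E) : SymTensor 𝕜 n E :=
  ⟨PiTensorProduct.tprod 𝕜 fun _ : Fin n => x, Submodule.subset_span ⟨x, rfl⟩⟩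

theorem map_mem_symTensor (T : E →L[𝕜] F) :
    ∀ z ∈ SymTensor 𝕜 n E,
      PiTensorProduct.map (fun _ : Fin n => (T : E →ₗ[𝕜] F)) z ∈ SymTensor 𝕜 n F := by
  intro z hz
  induction hz using Submodule.span_induction with
  | mem z h =>
    obtain ⟨x, rfl⟩ := h
    rw [PiTensorProduct.map_tprod]
    exact Submodule.subset_span ⟨T x, rfl⟩
  | zero => simp
  | add a b _ _ ha hb => rw [map_add]; exact Submodule.add_mem _ ha hb
  | smul c a _ ha => rw [map_smul]; exact Submodule.smul_mem _ _ ha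

/-- The operator `⊗^{n,s} T` induced by `T`. -/
def symMap (T : E →L[𝕜] F) : SymTensor 𝕜 n E →ₗ[𝕜] SymTensor 𝕜 n F :=
  (PiTensorProduct.map fun _ : Fin n => (T : E →ₗ[𝕜] F)).restrict (map_mem_symTensor T)

/-- The duality pairing of `⊗^{n,s} E'` with `⊗^{n,s} E`; it is bilinear and satisfies
`⟨φ ⊗ ⋯ ⊗ φ, x ⊗ ⋯ ⊗ x⟩ = φ(x)^n`. -/
def symPair (𝕜 : Type) [RCLike 𝕜] (n : ℕ) (E : Type) [NormedAddCommGroup E] [NormedSpace 𝕜 E] :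
    SymTensor 𝕜 n (StrongDual 𝕜 E) →ₗ[𝕜] SymTensor 𝕜 n E →ₗ[𝕜] 𝕜 :=
  (PiTensorProduct.dualDistrib ∘ₗ
    PiTensorProduct.map fun _ : Fin n =>
      (ContinuousLinearMap.coeLM 𝕜 : StrongDual 𝕜 E →ₗ[𝕜] Module.Dual 𝕜 E)).domRestrict₁₂
    (SymTensor 𝕜 n (StrongDual 𝕜 E)) (SymTensor 𝕜 n E)

theorem symTensor_induction {p : SymTensor 𝕜 n E → Prop} (hpow : ∀ x, p (tpow 𝕜 n x))
    (hzero : p 0) (hadd : ∀ a b, p a → p b → p (a + b)) (hsmul : ∀ (c : 𝕜) a, p a → p (c • a))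
    (z : SymTensor 𝕜 n E) : p z := by
  obtain ⟨z, hz⟩ := z
  induction hz using Submodule.span_induction with
  | mem z h => obtain ⟨x, rfl⟩ := h; exact hpow x
  | zero => exact hzero
  | add a b ha hb iha ihb => exact hadd _ _ iha ihb
  | smul c a _ ha => exact hsmul c _ ha

@[simp] theorem symMap_tpow (T : E →L[𝕜] F) (x : E) :
    symMap T (tpow 𝕜 n x) = tpow 𝕜 n (T x) := by
  apply Subtype.ext
  simp [symMap, tpow, LinearMap.restrict_apply]

@[simp] theorem symPair_tpow (φ : StrongDual 𝕜 E) (x : E) :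
    symPair 𝕜 n E (tpow 𝕜 n φ) (tpow 𝕜 n x) = φ x ^ n := by
  change PiTensorProduct.dualDistrib (PiTensorProduct.map (fun _ : Fin n =>
    (ContinuousLinearMap.coeLM 𝕜 : StrongDual 𝕜 E →ₗ[𝕜] Module.Dual 𝕜 E))
      (PiTensorProduct.tprod 𝕜 fun _ : Fin n => φ)) (PiTensorProduct.tprod 𝕜 fun _ : Fin n => x) = _
  rw [PiTensorProduct.map_tprod, PiTensorProduct.dualDistrib_apply]
  simp

theorem symMap_comp (S : F →L[𝕜] G) (T : E →L[𝕜] F) (z : SymTensor 𝕜 n E) :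
    symMap (S.comp T) z = symMap S (symMap T z) := by
  induction z using symTensor_induction with
  | hpow x => simp
  | hzero => simp
  | hadd a b ha hb => simp [ha, hb]
  | hsmul c a ha => simp [ha]

/-- The transpose `T' : F' → E'` of a bounded operator. -/
def transpose (T : E →L[𝕜] F) : StrongDual 𝕜 F →L[𝕜] StrongDual 𝕜 E :=
  (ContinuousLinearMap.compL 𝕜 E F 𝕜).flip T

theorem transpose_apply (T : E →L[𝕜] F) (φ : StrongDual 𝕜 F) (x : E) :
    transpose T φ x = φ (T x) := rfl

theorem norm_transpose_le (T : E →L[𝕜] F) : ‖transpose T‖ ≤ ‖T‖ := by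
  refine ContinuousLinearMap.opNorm_le_bound _ (norm_nonneg _) fun φ => ?_
  rw [mul_comm]
  exact ContinuousLinearMap.opNorm_comp_le φ T

theorem symPair_map (T : E →L[𝕜] F) (w : SymTensor 𝕜 n (StrongDual 𝕜 F))
    (z : SymTensor 𝕜 n E) :
    symPair 𝕜 n F w (symMap T z) = symPair 𝕜 n E (symMap (transpose T) w) z := by
  induction z using symTensor_induction with
  | hpow x =>
    induction w using symTensor_induction with
    | hpow φ => simp [transpose_apply]
    | hzero => simp
    | hadd a b ha hb => simp only [map_add, LinearMap.add_apply, ha, hb]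
    | hsmul c a ha => simp only [map_smul, LinearMap.smul_apply, ha]
  | hzero => simp
  | hadd a b ha hb => simp [ha, hb]
  | hsmul c a ha => simp [ha]

/-- Every symmetric tensor is a finite sum `∑ λ_i • ⊗^n x_i`. -/
theorem exists_rep (z : SymTensor 𝕜 n E) :
    ∃ (m : ℕ) (c : Fin m → 𝕜) (x : Fin m → E), z = ∑ i, c i • tpow 𝕜 n (x i) := by
  induction z using symTensor_induction with
  | hpow x => exact ⟨1, fun _ => 1, fun _ => x, by simp⟩
  | hzero => exact ⟨0, fun _ => 0, fun _ => 0, by simp⟩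
  | hadd a b ha hb =>
    obtain ⟨m, c, x, rfl⟩ := ha
    obtain ⟨k, d, y, rfl⟩ := hb
    exact ⟨m + k, Fin.append c d, Fin.append x y, by simp [Fin.sum_univ_add]⟩
  | hsmul t a ha =>
    obtain ⟨m, c, x, rfl⟩ := ha
    exact ⟨m, fun i => t * c i, x, by simp [Finset.smul_sum, mul_smul]⟩

/-- The injective s-tensor norm `ε_s(z) = sup { |⟨⊗^n φ, z⟩| : φ ∈ B_{E'} }`. -/
def epsS (z : SymTensor 𝕜 n E) : ℝ :=
  ⨆ φ : Metric.closedBall (0 : StrongDual 𝕜 E) 1, ‖symPair 𝕜 n E (tpow 𝕜 n (φ : StrongDual 𝕜 E)) z‖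

/-- The projective s-tensor norm
`π_s(z) = inf { ∑ |λ_i| ‖x_i‖^n : z = ∑ λ_i ⊗^n x_i }`. -/
def piS (z : SymTensor 𝕜 n E) : ℝ :=
  sInf {t : ℝ | ∃ (m : ℕ) (c : Fin m → 𝕜) (x : Fin m → E),
    z = ∑ i, c i • tpow 𝕜 n (x i) ∧ t = ∑ i, ‖c i‖ * ‖x i‖ ^ n}

theorem piS_tpow_le (x : E) : piS (tpow 𝕜 n x) ≤ ‖x‖ ^ n := by
  refine csInf_le ⟨0, ?_⟩ ⟨1, fun _ => 1, fun _ => x, by simp, by simp⟩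
  rintro t ⟨m, c, y, -, rfl⟩
  positivity

theorem bddAbove_eps (z : SymTensor 𝕜 n E) :
    BddAbove (Set.range fun φ : Metric.closedBall (0 : StrongDual 𝕜 E) 1 =>
      ‖symPair 𝕜 n E (tpow 𝕜 n (φ : StrongDual 𝕜 E)) z‖) := by
  obtain ⟨m, c, x, rfl⟩ := exists_rep z
  refine ⟨∑ i, ‖c i‖ * ‖x i‖ ^ n, ?_⟩
  rintro _ ⟨⟨φ, hφ⟩, rfl⟩
  have h1 : ‖φ‖ ≤ 1 := by simpa using hφ
  simp only [map_sum, map_smul, symPair_tpow]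
  refine (norm_sum_le _ _).trans (Finset.sum_le_sum fun i _ => ?_)
  rw [norm_smul, norm_pow]
  gcongr
  exact (φ.le_opNorm (x i)).trans (mul_le_of_le_one_left (norm_nonneg _) h1)

theorem norm_symPair_le_epsS (φ : StrongDual 𝕜 E) (hφ : ‖φ‖ ≤ 1) (z : SymTensor 𝕜 n E) :
    ‖symPair 𝕜 n E (tpow 𝕜 n φ) z‖ ≤ epsS z :=
  le_ciSup (bddAbove_eps z) ⟨φ, by simpa using hφ⟩

theorem symPair_bidual (x : E) (w : SymTensor 𝕜 n (StrongDual 𝕜 E)) :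
    symPair 𝕜 n (StrongDual 𝕜 E) (tpow 𝕜 n (NormedSpace.inclusionInDoubleDual 𝕜 E x)) w
      = symPair 𝕜 n E w (tpow 𝕜 n x) := by
  induction w using symTensor_induction with
  | hpow φ => simp
  | hzero => simp
  | hadd a b ha hb => simp [ha, hb]
  | hsmul c a ha => simp [ha]

theorem norm_symPair_tpow_le (w : SymTensor 𝕜 n (StrongDual 𝕜 E)) (x : E) :
    ‖symPair 𝕜 n E w (tpow 𝕜 n x)‖ ≤ ‖x‖ ^ n * epsS w := by
  have hone : ∀ y : E, ‖y‖ ≤ 1 → ‖symPair 𝕜 n E w (tpow 𝕜 n y)‖ ≤ epsS w := fun y hy => by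
    rw [← symPair_bidual]
    exact norm_symPair_le_epsS _ ((NormedSpace.double_dual_bound 𝕜 E y).trans hy) w
  have hsm : ∀ (c : 𝕜) (y : E), tpow 𝕜 n (c • y) = c ^ n • tpow 𝕜 n y := fun c y => by
    apply Subtype.ext
    simpa [tpow] using
      (PiTensorProduct.tprod 𝕜).map_smul_univ (fun _ : Fin n => c) (fun _ : Fin n => y)
  by_cases hx : x = 0
  · subst hx
    rcases Nat.eq_zero_or_pos n with rfl | hn
    · simpa using hone 0 (by simp)
    · have h0 : tpow 𝕜 n (0 : E) = 0 := by
        have := hsm 0 (0 : E)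
        rwa [zero_pow hn.ne', zero_smul, zero_smul] at this
      rw [h0]
      simp [hn.ne']
  · have hx' : 0 < ‖x‖ := norm_pos_iff.2 hx
    have hy := hone (((‖x‖⁻¹ : ℝ) : 𝕜) • x) (by
      rw [norm_smul, RCLike.norm_ofReal, abs_of_pos (inv_pos.2 hx'), inv_mul_cancel₀ hx'.ne'])
    rw [hsm, map_smul, norm_smul, norm_pow, RCLike.norm_ofReal, abs_of_pos (inv_pos.2 hx'),
      inv_pow, inv_mul_le_iff₀ (by positivity)] at hy
    exact hy

end Basic

/-! ### s-tensor norms -/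

instance completeSpace_of_finiteDimensional {𝕜 : Type} [RCLike 𝕜] {E : Type}
    [NormedAddCommGroup E] [NormedSpace 𝕜 E] (M : Submodule 𝕜 E) [FiniteDimensional 𝕜 M] :
    CompleteSpace M :=
  FiniteDimensional.complete 𝕜 M

/-- An s-tensor norm of order `n` on the class of all Banach spaces over `𝕜`.
(Each `toSeminorm E` is a norm, because it dominates the norm `ε_s`.) -/
structure STensorNorm (𝕜 : Type) [RCLike 𝕜] (n : ℕ) where
  toSeminorm : ∀ (E : Type) [NormedAddCommGroup E] [NormedSpace 𝕜 E] [CompleteSpace E],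
    Seminorm 𝕜 (SymTensor 𝕜 n E)
  epsS_le : ∀ (E : Type) [NormedAddCommGroup E] [NormedSpace 𝕜 E] [CompleteSpace E]
    (z : SymTensor 𝕜 n E), epsS z ≤ toSeminorm E z
  le_piS : ∀ (E : Type) [NormedAddCommGroup E] [NormedSpace 𝕜 E] [CompleteSpace E]
    (z : SymTensor 𝕜 n E), toSeminorm E z ≤ piS z
  map_le : ∀ (E F : Type) [NormedAddCommGroup E] [NormedSpace 𝕜 E] [CompleteSpace E]
    [NormedAddCommGroup F] [NormedSpace 𝕜 F] [CompleteSpace F] (T : E →L[𝕜] F)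
    (z : SymTensor 𝕜 n E), toSeminorm F (symMap T z) ≤ ‖T‖ ^ n * toSeminorm E z

namespace STensorNorm

variable {𝕜 : Type} [RCLike 𝕜] {n : ℕ} (β : STensorNorm 𝕜 n)
variable {E : Type} [NormedAddCommGroup E] [NormedSpace 𝕜 E] [CompleteSpace E]
variable {F : Type} [NormedAddCommGroup F] [NormedSpace 𝕜 F] [CompleteSpace F]

/-- `β(z, ⊗^{n,s} E)` is the infimum of `β(z, ⊗^{n,s} M)` over the finite dimensional subspaces
`M` of `E` with `z ∈ ⊗^{n,s} M`. -/
def FinitelyGenerated (β : STensorNorm 𝕜 n) : Prop :=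
  ∀ (E : Type) [NormedAddCommGroup E] [NormedSpace 𝕜 E] [CompleteSpace E] (z : SymTensor 𝕜 n E),
    IsGLB {t : ℝ | ∃ (M : Submodule 𝕜 E) (_ : FiniteDimensional 𝕜 M) (w : SymTensor 𝕜 n M),
      symMap M.subtypeL w = z ∧ t = β.toSeminorm M w} (β.toSeminorm E z)

/-- The norm on `⊗^{n,s} M` (for finite dimensional `M`) coming from the identification of this
space with the dual of `(⊗^{n,s} M', β)`. -/
def dualFin (M : Type) [NormedAddCommGroup M] [NormedSpace 𝕜 M] [CompleteSpace M]
    (z : SymTensor 𝕜 n M) : ℝ :=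
  sSup {t : ℝ | ∃ w : SymTensor 𝕜 n (StrongDual 𝕜 M),
    β.toSeminorm (StrongDual 𝕜 M) w ≤ 1 ∧ t = ‖symPair 𝕜 n M w z‖}

/-- The values of the dual tensor norm `β'` on an arbitrary Banach space. -/
def dualFun (E : Type) [NormedAddCommGroup E] [NormedSpace 𝕜 E] [CompleteSpace E]
    (z : SymTensor 𝕜 n E) : ℝ :=
  sInf {t : ℝ | ∃ (M : Submodule 𝕜 E) (_ : FiniteDimensional 𝕜 M) (w : SymTensor 𝕜 n M),
    symMap M.subtypeL w = z ∧ t = β.dualFin M w}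

set_option linter.unusedSectionVars false in
theorem bddAbove_dualFin (z : SymTensor 𝕜 n E) :
    BddAbove {t : ℝ | ∃ w : SymTensor 𝕜 n (StrongDual 𝕜 E),
      β.toSeminorm (StrongDual 𝕜 E) w ≤ 1 ∧ t = ‖symPair 𝕜 n E w z‖} := by
  obtain ⟨m, c, x, rfl⟩ := exists_rep z
  refine ⟨∑ i, ‖c i‖ * ‖x i‖ ^ n, ?_⟩
  rintro _ ⟨w, hw, rfl⟩
  simp only [map_sum, map_smul]
  refine (norm_sum_le _ _).trans (Finset.sum_le_sum fun i _ => ?_)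
  rw [norm_smul]
  gcongr
  refine (norm_symPair_tpow_le w (x i)).trans (mul_le_of_le_one_right (by positivity) ?_)
  exact (β.epsS_le _ w).trans hw

theorem dualFin_nonneg (z : SymTensor 𝕜 n E) : 0 ≤ β.dualFin E z := by
  apply Real.sSup_nonneg
  rintro _ ⟨w, -, rfl⟩
  positivity

theorem le_dualFin (z : SymTensor 𝕜 n E) (w : SymTensor 𝕜 n (StrongDual 𝕜 E))
    (hw : β.toSeminorm (StrongDual 𝕜 E) w ≤ 1) : ‖symPair 𝕜 n E w z‖ ≤ β.dualFin E z :=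
  le_csSup (β.bddAbove_dualFin z) ⟨w, hw, rfl⟩

theorem dualFin_le (z : SymTensor 𝕜 n E) {C : ℝ} (hC : 0 ≤ C)
    (h : ∀ w : SymTensor 𝕜 n (StrongDual 𝕜 E), β.toSeminorm (StrongDual 𝕜 E) w ≤ 1 →
      ‖symPair 𝕜 n E w z‖ ≤ C) : β.dualFin E z ≤ C := by
  refine Real.sSup_le ?_ hC
  rintro _ ⟨w, hw, rfl⟩
  exact h w hw

theorem dualFin_smul_le (c : 𝕜) (z : SymTensor 𝕜 n E) :
    β.dualFin E (c • z) ≤ ‖c‖ * β.dualFin E z := by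
  refine β.dualFin_le _ (mul_nonneg (norm_nonneg _) (β.dualFin_nonneg z)) fun w hw => ?_
  rw [map_smul, norm_smul]
  exact mul_le_mul_of_nonneg_left (β.le_dualFin z w hw) (norm_nonneg _)

theorem dualFin_add_le (y z : SymTensor 𝕜 n E) :
    β.dualFin E (y + z) ≤ β.dualFin E y + β.dualFin E z := by
  refine β.dualFin_le _ (add_nonneg (β.dualFin_nonneg y) (β.dualFin_nonneg z)) fun w hw => ?_
  rw [map_add]
  exact (norm_add_le _ _).trans (add_le_add (β.le_dualFin y w hw) (β.le_dualFin z w hw))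

theorem norm_symPair_le (z : SymTensor 𝕜 n E) (w : SymTensor 𝕜 n (StrongDual 𝕜 E)) {C : ℝ}
    (hC : 0 ≤ C) (hw : β.toSeminorm (StrongDual 𝕜 E) w ≤ C) :
    ‖symPair 𝕜 n E w z‖ ≤ C * β.dualFin E z := by
  refine le_of_forall_pos_le_add fun e he => ?_
  have hd := β.dualFin_nonneg z
  obtain ⟨d, hd0, hd1⟩ : ∃ d : ℝ, 0 < d ∧ d * β.dualFin E z ≤ e := by
    refine ⟨e / (β.dualFin E z + 1), by positivity, ?_⟩
    rw [div_mul_eq_mul_div, div_le_iff₀ (by positivity)]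
    nlinarith
  have hCd : 0 < C + d := by positivity
  have hn : ‖((C + d : ℝ) : 𝕜)⁻¹‖ = (C + d)⁻¹ := by
    rw [norm_inv, RCLike.norm_ofReal, abs_of_pos hCd]
  have h := β.le_dualFin z (((C + d : ℝ) : 𝕜)⁻¹ • w) (by
    rw [map_smul_eq_mul, hn, inv_mul_le_iff₀ hCd]
    linarith)
  rw [map_smul, LinearMap.smul_apply, norm_smul, hn, inv_mul_le_iff₀ hCd] at h
  linarith

theorem dualFin_map_le (T : E →L[𝕜] F) (z : SymTensor 𝕜 n E) :
    β.dualFin F (symMap T z) ≤ ‖T‖ ^ n * β.dualFin E z := by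
  refine β.dualFin_le _ (mul_nonneg (by positivity) (β.dualFin_nonneg z)) fun w hw => ?_
  rw [symPair_map]
  refine β.norm_symPair_le z _ (by positivity) ?_
  calc β.toSeminorm _ (symMap (transpose T) w)
      ≤ ‖transpose T‖ ^ n * β.toSeminorm _ w := β.map_le _ _ _ _
    _ ≤ ‖T‖ ^ n * 1 := by
        gcongr
        exact norm_transpose_le T
    _ = ‖T‖ ^ n := mul_one _

theorem dualFin_map_le_of_le_one (T : E →L[𝕜] F) (hT : ‖T‖ ≤ 1) (z : SymTensor 𝕜 n E) :
    β.dualFin F (symMap T z) ≤ β.dualFin E z :=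
  (β.dualFin_map_le T z).trans
    (mul_le_of_le_one_left (β.dualFin_nonneg z) (pow_le_one₀ (norm_nonneg _) hT))

set_option linter.unusedSectionVars false in
theorem exists_finiteDimensional (z : SymTensor 𝕜 n E) :
    ∃ (M : Submodule 𝕜 E) (_ : FiniteDimensional 𝕜 M) (w : SymTensor 𝕜 n M),
      symMap M.subtypeL w = z := by
  obtain ⟨m, c, x, rfl⟩ := exists_rep z
  refine ⟨Submodule.span 𝕜 (Set.range x), FiniteDimensional.span_of_finite 𝕜 (Set.finite_range x),
    ∑ i, c i • tpow 𝕜 n ⟨x i, Submodule.subset_span ⟨i, rfl⟩⟩, ?_⟩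
  simp

theorem dualFun_nonneg (z : SymTensor 𝕜 n E) : 0 ≤ β.dualFun E z := by
  apply Real.sInf_nonneg
  rintro _ ⟨M, hM, w, -, rfl⟩
  exact β.dualFin_nonneg w

theorem dualFun_le (M : Submodule 𝕜 E) [hM : FiniteDimensional 𝕜 M] (w : SymTensor 𝕜 n M) :
    β.dualFun E (symMap M.subtypeL w) ≤ β.dualFin M w := by
  refine csInf_le ⟨0, ?_⟩ ⟨M, hM, w, rfl, rfl⟩
  rintro _ ⟨M, hM, w, -, rfl⟩
  exact β.dualFin_nonneg w

theorem le_dualFun (z : SymTensor 𝕜 n E) {C : ℝ}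
    (h : ∀ (M : Submodule 𝕜 E) [FiniteDimensional 𝕜 M] (w : SymTensor 𝕜 n M),
      symMap M.subtypeL w = z → C ≤ β.dualFin M w) : C ≤ β.dualFun E z := by
  refine le_csInf ?_ ?_
  · obtain ⟨M, hM, w, hw⟩ := exists_finiteDimensional z
    exact ⟨_, M, hM, w, hw, rfl⟩
  · rintro _ ⟨M, hM, w, hw, rfl⟩
    exact h M w hw

theorem dualFun_map_le (T : E →L[𝕜] F) (z : SymTensor 𝕜 n E) :
    β.dualFun F (symMap T z) ≤ ‖T‖ ^ n * β.dualFun E z := by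
  refine le_of_forall_pos_le_add fun e he => ?_
  obtain ⟨d, hd0, hd1⟩ : ∃ d : ℝ, 0 < d ∧ ‖T‖ ^ n * d ≤ e := by
    refine ⟨e / (‖T‖ ^ n + 1), by positivity, ?_⟩
    rw [mul_div_assoc', div_le_iff₀ (by positivity)]
    nlinarith [pow_nonneg (norm_nonneg T) n]
  obtain ⟨_, ⟨M, hM, w, hw, rfl⟩, hlt⟩ := Real.lt_sInf_add_pos
    (s := {t : ℝ | ∃ (M : Submodule 𝕜 E) (_ : FiniteDimensional 𝕜 M) (w : SymTensor 𝕜 n M),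
      symMap M.subtypeL w = z ∧ t = β.dualFin M w})
    (by obtain ⟨M, hM, w, hw⟩ := exists_finiteDimensional z; exact ⟨_, M, hM, w, hw, rfl⟩) hd0
  have hlt' : β.dualFin M w < β.dualFun E z + d := hlt
  let N : Submodule 𝕜 F := M.map (T : E →ₗ[𝕜] F)
  have hN : FiniteDimensional 𝕜 N := inferInstance
  let S : M →L[𝕜] N := (T.comp M.subtypeL).codRestrict N fun x => ⟨x, x.2, rfl⟩
  have hS : ‖S‖ ≤ ‖T‖ := ContinuousLinearMap.opNorm_le_bound _ (norm_nonneg _) fun x =>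
    T.le_opNorm (x : E)
  have hcomp : N.subtypeL.comp S = T.comp M.subtypeL := by ext x; rfl
  have hz : symMap T z = symMap N.subtypeL (symMap S w) := by
    rw [← symMap_comp, hcomp, symMap_comp, hw]
  calc β.dualFun F (symMap T z) ≤ β.dualFin N (symMap S w) := by rw [hz]; exact β.dualFun_le N _
    _ ≤ ‖S‖ ^ n * β.dualFin M w := β.dualFin_map_le S w
    _ ≤ ‖T‖ ^ n * (β.dualFun E z + d) := by
        gcongr
        exact β.dualFin_nonneg w
    _ ≤ ‖T‖ ^ n * β.dualFun E z + e := by rw [mul_add]; linarith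

theorem dualFun_add_le (y z : SymTensor 𝕜 n E) :
    β.dualFun E (y + z) ≤ β.dualFun E y + β.dualFun E z := by
  rw [← sub_le_iff_le_add']
  refine β.le_dualFun z fun N _ v hv => ?_
  rw [sub_le_comm]
  refine β.le_dualFun y fun M _ w hw => ?_
  rw [sub_le_iff_le_add]
  let iM : M →L[𝕜] ↥(M ⊔ N) :=
    M.subtypeL.codRestrict (M ⊔ N) fun x => le_sup_left (a := M) (b := N) x.2
  let iN : N →L[𝕜] ↥(M ⊔ N) :=
    N.subtypeL.codRestrict (M ⊔ N) fun x => le_sup_right (a := M) (b := N) x.2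
  have hiM : ‖iM‖ ≤ 1 := ContinuousLinearMap.opNorm_le_bound _ zero_le_one fun x => by
    rw [one_mul]; rfl
  have hiN : ‖iN‖ ≤ 1 := ContinuousLinearMap.opNorm_le_bound _ zero_le_one fun x => by
    rw [one_mul]; rfl
  have h : y + z = symMap (M ⊔ N).subtypeL (symMap iM w + symMap iN v) := by
    rw [map_add, ← symMap_comp, ← symMap_comp, ← hw, ← hv]
    rfl
  rw [h]
  exact (β.dualFun_le (M ⊔ N) _).trans ((β.dualFin_add_le _ _).trans
    (add_le_add (β.dualFin_map_le_of_le_one iM hiM w) (β.dualFin_map_le_of_le_one iN hiN v)))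

theorem dualFun_zero : β.dualFun E (0 : SymTensor 𝕜 n E) = 0 := by
  refine le_antisymm ?_ (β.dualFun_nonneg _)
  have h := β.dualFun_le (⊥ : Submodule 𝕜 E) (0 : SymTensor 𝕜 n (⊥ : Submodule 𝕜 E))
  rw [map_zero] at h
  exact h.trans (β.dualFin_le _ le_rfl fun w _ => by simp)

theorem dualFun_smul_le (c : 𝕜) (z : SymTensor 𝕜 n E) :
    β.dualFun E (c • z) ≤ ‖c‖ * β.dualFun E z := by
  by_cases hc : c = 0
  · subst hc
    simp [β.dualFun_zero]
  · have hc' : 0 < ‖c‖ := norm_pos_iff.2 hc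
    rw [mul_comm, ← div_le_iff₀ hc']
    refine β.le_dualFun z fun M _ w hw => ?_
    rw [div_le_iff₀ hc', mul_comm]
    have h := β.dualFun_le M (c • w)
    rw [map_smul, hw] at h
    exact h.trans (β.dualFin_smul_le c w)

theorem epsS_le_dualFun (z : SymTensor 𝕜 n E) : epsS z ≤ β.dualFun E z := by
  refine β.le_dualFun z fun M _ w hw => ?_
  refine Real.iSup_le ?_ (β.dualFin_nonneg w)
  rintro ⟨φ, hφ⟩
  have h1 : ‖φ‖ ≤ 1 := by simpa using hφ
  rw [← hw, symPair_map, symMap_tpow]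
  refine β.le_dualFin w _ ((β.le_piS _ _).trans ((piS_tpow_le _).trans ?_))
  refine pow_le_one₀ (norm_nonneg _) ?_
  refine ContinuousLinearMap.opNorm_le_bound _ zero_le_one fun x => ?_
  exact (φ.le_opNorm _).trans (mul_le_mul_of_nonneg_right h1 (norm_nonneg _))

theorem dualFun_tpow_le (x : E) : β.dualFun E (tpow 𝕜 n x) ≤ ‖x‖ ^ n := by
  have h := β.dualFun_le (Submodule.span 𝕜 {x})
    (tpow 𝕜 n ⟨x, Submodule.mem_span_singleton_self x⟩)
  rw [symMap_tpow] at h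
  refine h.trans (β.dualFin_le _ (by positivity) fun w hw => ?_)
  refine (norm_symPair_tpow_le w _).trans (mul_le_of_le_one_right (by positivity) ?_)
  exact (β.epsS_le _ w).trans hw

/-- The dual tensor norm `β'`: on a finite dimensional space `M` it is the norm of the dual of
`(⊗^{n,s} M', β)`, and it is extended to all Banach spaces by taking the infimum over the finite
dimensional subspaces. -/
def dual : STensorNorm 𝕜 n where
  toSeminorm E _ _ _ :=
    Seminorm.ofSMulLE (β.dualFun E) β.dualFun_zero β.dualFun_add_le β.dualFun_smul_le
  epsS_le _ _ _ _ z := β.epsS_le_dualFun z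
  le_piS E _ _ _ z := by
    change β.dualFun E z ≤ piS z
    refine le_csInf ?_ ?_
    · obtain ⟨m, c, x, h⟩ := exists_rep z
      exact ⟨_, m, c, x, h, rfl⟩
    · rintro _ ⟨m, c, x, rfl, rfl⟩
      let p : Seminorm 𝕜 (SymTensor 𝕜 n E) :=
        Seminorm.ofSMulLE (β.dualFun E) β.dualFun_zero β.dualFun_add_le β.dualFun_smul_le
      change p _ ≤ _
      refine (Finset.le_sum_of_subadditive p (map_zero p).le (map_add_le_add p) _ _).trans (Finset.sum_le_sum fun i _ => ?_)
      rw [map_smul_eq_mul]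
      exact mul_le_mul_of_nonneg_left (β.dualFun_tpow_le (x i)) (norm_nonneg _)
  map_le _ _ _ _ _ _ _ _ T z := β.dualFun_map_le T z

/-- The space `⊗^{n,s}_β E`, i.e. `⊗^{n,s} E` with the norm `β`. -/
def Space (_β : STensorNorm 𝕜 n) (E : Type) [NormedAddCommGroup E] [NormedSpace 𝕜 E]
    [CompleteSpace E] : Type :=
  SymTensor 𝕜 n E

instance (E : Type) [NormedAddCommGroup E] [NormedSpace 𝕜 E] [CompleteSpace E] :
    SeminormedAddCommGroup (β.Space E) :=
  AddGroupSeminorm.toSeminormedAddCommGroup (E := SymTensor 𝕜 n E)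
    (β.toSeminorm E).toAddGroupSeminorm

instance (E : Type) [NormedAddCommGroup E] [NormedSpace 𝕜 E] [CompleteSpace E] :
    Module 𝕜 (β.Space E) :=
  (inferInstance : Module 𝕜 (SymTensor 𝕜 n E))

instance (E : Type) [NormedAddCommGroup E] [NormedSpace 𝕜 E] [CompleteSpace E] :
    NormedSpace 𝕜 (β.Space E) where
  norm_smul_le c z := (map_smul_eq_mul (β.toSeminorm E) c z).le

/-- The identity map from `⊗^{n,s} E` to `⊗^{n,s}_β E`. -/
def toSpace (E : Type) [NormedAddCommGroup E] [NormedSpace 𝕜 E] [CompleteSpace E] :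
    SymTensor 𝕜 n E ≃ₗ[𝕜] β.Space E where
  toFun z := z
  invFun z := z
  map_add' _ _ := rfl
  map_smul' _ _ := rfl
  left_inv _ := rfl
  right_inv _ := rfl

theorem norm_toSpace (z : SymTensor 𝕜 n E) : ‖β.toSpace E z‖ = β.toSeminorm E z := rfl

/-- The completed symmetric tensor product `⊗̃^{n,s}_β E`. -/
abbrev CSpace (β : STensorNorm 𝕜 n) (E : Type) [NormedAddCommGroup E] [NormedSpace 𝕜 E]
    [CompleteSpace E] : Type :=
  UniformSpace.Completion (β.Space E)

/-- The canonical map `⊗^{n,s} E → ⊗̃^{n,s}_β E`. -/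
def toCSpace (z : SymTensor 𝕜 n E) : β.CSpace E :=
  (β.toSpace E z : UniformSpace.Completion (β.Space E))

end STensorNorm

/-! ### The symmetric Radon-Nikodym property -/

/-- The Banach space `ℓ_1`. -/
abbrev EllOne (𝕜 : Type) [RCLike 𝕜] : Type := lp (fun _ : ℕ => 𝕜) 1

/-- The Banach space `c_0`. -/
abbrev CZero (𝕜 : Type) [RCLike 𝕜] : Type := C₀(ℕ, 𝕜)

section Duality

variable {𝕜 : Type} [RCLike 𝕜]

theorem norm_apply_le (x : CZero 𝕜) (i : ℕ) : ‖x i‖ ≤ ‖x‖ :=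
  x.toBCF.norm_coe_le_norm i

theorem summable_norm_ellOne (a : EllOne 𝕜) : Summable fun i => ‖a i‖ := by
  simpa using (lp.memℓp a).summable (by simp)

theorem norm_ellOne (a : EllOne 𝕜) : ‖a‖ = ∑' i, ‖a i‖ := by
  simpa using lp.norm_eq_tsum_rpow (by simp) a

theorem summable_norm_pairing (a : EllOne 𝕜) (x : CZero 𝕜) : Summable fun i => ‖a i * x i‖ := by
  refine Summable.of_nonneg_of_le (fun _ => norm_nonneg _) (fun i => ?_)
    ((summable_norm_ellOne a).mul_right ‖x‖)
  rw [norm_mul]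
  exact mul_le_mul_of_nonneg_left (norm_apply_le x i) (norm_nonneg _)

/-- The canonical identification of `ℓ_1` with `c_0'`: `⟨a, x⟩ = ∑ a_i x_i`. -/
def ellOneToDual (𝕜 : Type) [RCLike 𝕜] : EllOne 𝕜 →L[𝕜] StrongDual 𝕜 (CZero 𝕜) :=
  LinearMap.mkContinuous₂
    (LinearMap.mk₂ 𝕜 (fun (a : EllOne 𝕜) (x : CZero 𝕜) => ∑' i, a i * x i)
      (fun a b x => by
        rw [← ((summable_norm_pairing a x).of_norm).tsum_add (summable_norm_pairing b x).of_norm]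
        exact tsum_congr fun i => by simp [add_mul])
      (fun c a x => by
        rw [smul_eq_mul, ← tsum_mul_left]
        exact tsum_congr fun i => by simp [mul_assoc])
      (fun a x y => by
        rw [← ((summable_norm_pairing a x).of_norm).tsum_add (summable_norm_pairing a y).of_norm]
        exact tsum_congr fun i => by simp [mul_add])
      (fun c a x => by
        rw [smul_eq_mul, ← tsum_mul_left]
        exact tsum_congr fun i => by simp [mul_left_comm]))
    1 (fun a x => by
      rw [one_mul, norm_ellOne, ← tsum_mul_right]
      refine (norm_tsum_le_tsum_norm (summable_norm_pairing a x)).trans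
        ((summable_norm_pairing a x).tsum_le_tsum (fun i => ?_)
          ((summable_norm_ellOne a).mul_right ‖x‖))
      rw [norm_mul]
      exact mul_le_mul_of_nonneg_left (norm_apply_le x i) (norm_nonneg _))

theorem ellOneToDual_apply (a : EllOne 𝕜) (x : CZero 𝕜) :
    ellOneToDual 𝕜 a x = ∑' i, a i * x i := rfl

end Duality

/-- The symmetric Radon-Nikodym property of `β`: the canonical arrow
`J : ⊗̃^{n,s}_β ℓ_1 → (⊗̃^{n,s}_{β'} c_0)'`, which is determined by
`⟨J (⊗^n a), ⊗^n x⟩ = ⟨a, x⟩^n`, is an isometric isomorphism. -/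
def STensorNorm.HasSRN {𝕜 : Type} [RCLike 𝕜] {n : ℕ} (β : STensorNorm 𝕜 n) : Prop :=
  ∃ J : β.CSpace (EllOne 𝕜) ≃ₗᵢ[𝕜] StrongDual 𝕜 (β.dual.CSpace (CZero 𝕜)),
    ∀ (z : SymTensor 𝕜 n (EllOne 𝕜)) (u : SymTensor 𝕜 n (CZero 𝕜)),
      J (β.toCSpace z) (β.dual.toCSpace u) =
        symPair 𝕜 n (CZero 𝕜) (symMap (ellOneToDual 𝕜) z) u

/-! ### Homogeneous polynomials -/

section Polynomials

variable {𝕜 : Type} [RCLike 𝕜]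
variable {E : Type} [NormedAddCommGroup E] [NormedSpace 𝕜 E]

/-- `P : E → 𝕜` is a continuous `n`-homogeneous polynomial. -/
def IsHomPoly (n : ℕ) (P : E → 𝕜) : Prop :=
  ∃ Φ : ContinuousMultilinearMap 𝕜 (fun _ : Fin n => E) 𝕜, ∀ x, P x = Φ fun _ => x

/-- The sup norm of a polynomial on the unit ball. -/
def polyNorm (P : E → 𝕜) : ℝ := ⨆ x : Metric.closedBall (0 : E) 1, ‖P x‖

/-- The polynomial `x ↦ ⟨z, ⊗^n x⟩` on `E` represented by `z ∈ ⊗^{n,s} E'`. -/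
def polyOf {n : ℕ} (z : SymTensor 𝕜 n (StrongDual 𝕜 E)) : E → 𝕜 :=
  fun x => symPair 𝕜 n E z (tpow 𝕜 n x)

/-- A continuous `n`-homogeneous polynomial on `L_r(μ)` is positive if its associated symmetric
`n`-linear form takes values `≥ 0` on tuples of functions that are `≥ 0` almost everywhere. -/
def IsPositivePoly (n : ℕ) {r : ℝ≥0∞} [Fact (1 ≤ r)] {Ω : Type} [MeasurableSpace Ω]
    {μ : MeasureTheory.Measure Ω} (Q : MeasureTheory.Lp 𝕜 r μ → 𝕜) : Prop :=
  ∃ Φ : ContinuousMultilinearMap 𝕜 (fun _ : Fin n => MeasureTheory.Lp 𝕜 r μ) 𝕜,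
    (∀ f, Q f = Φ fun _ => f) ∧
    (∀ (σ : Equiv.Perm (Fin n)) (f : Fin n → MeasureTheory.Lp 𝕜 r μ),
      Φ (fun i => f (σ i)) = Φ f) ∧
    ∀ f : Fin n → MeasureTheory.Lp 𝕜 r μ,
      (∀ i, ∀ᵐ ω ∂μ, 0 ≤ RCLike.re (f i ω) ∧ RCLike.im (f i ω) = 0) →
        0 ≤ RCLike.re (Φ f) ∧ RCLike.im (Φ f) = 0

end Polynomials

/-- The data of a class of polynomials: for each normed space `E`, the polynomials on `E` that
belong to the class, and their norms in the class. -/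
structure PolyClass (𝕜 : Type) [RCLike 𝕜] where
  Mem : ∀ (E : Type) [NormedAddCommGroup E] [NormedSpace 𝕜 E], (E → 𝕜) → Prop
  norm : ∀ (E : Type) [NormedAddCommGroup E] [NormedSpace 𝕜 E], (E → 𝕜) → ℝ

/-- The ideal `𝓛_r^n` of `r`-factorable `n`-homogeneous polynomials. -/
def factorable (𝕜 : Type) [RCLike 𝕜] (n : ℕ) (r : ℝ≥0∞) [Fact (1 ≤ r)] : PolyClass 𝕜 where
  Mem E _ _ P :=
    ∃ (Ω : Type) (_ : MeasurableSpace Ω) (μ : MeasureTheory.Measure Ω)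
      (T : E →L[𝕜] MeasureTheory.Lp 𝕜 r μ) (Q : MeasureTheory.Lp 𝕜 r μ → 𝕜),
      IsHomPoly n Q ∧ P = Q ∘ T
  norm E _ _ P :=
    sInf {t : ℝ | ∃ (Ω : Type) (_ : MeasurableSpace Ω) (μ : MeasureTheory.Measure Ω)
      (T : E →L[𝕜] MeasureTheory.Lp 𝕜 r μ) (Q : MeasureTheory.Lp 𝕜 r μ → 𝕜),
      IsHomPoly n Q ∧ P = Q ∘ T ∧ t = polyNorm Q * ‖T‖ ^ n}

/-- The ideal `𝓙_r^n` of positively `r`-factorable `n`-homogeneous polynomials. -/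
def posFactorable (𝕜 : Type) [RCLike 𝕜] (n : ℕ) (r : ℝ≥0∞) [Fact (1 ≤ r)] : PolyClass 𝕜 where
  Mem E _ _ P :=
    ∃ (Ω : Type) (_ : MeasurableSpace Ω) (μ : MeasureTheory.Measure Ω)
      (T : E →L[𝕜] MeasureTheory.Lp 𝕜 r μ) (Q : MeasureTheory.Lp 𝕜 r μ → 𝕜),
      IsPositivePoly n Q ∧ P = Q ∘ T
  norm E _ _ P :=
    sInf {t : ℝ | ∃ (Ω : Type) (_ : MeasurableSpace Ω) (μ : MeasureTheory.Measure Ω)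
      (T : E →L[𝕜] MeasureTheory.Lp 𝕜 r μ) (Q : MeasureTheory.Lp 𝕜 r μ → 𝕜),
      IsPositivePoly n Q ∧ P = Q ∘ T ∧ t = polyNorm Q * ‖T‖ ^ n}

/-- The weak `ℓ_r`-norm `w_r(x_1, …, x_m) = sup_{φ ∈ B_{E'}} (∑ |φ(x_i)|^r)^{1/r}`. -/
def weakNorm (𝕜 : Type) [RCLike 𝕜] (r : ℝ) {E : Type} [NormedAddCommGroup E] [NormedSpace 𝕜 E]
    {m : ℕ} (x : Fin m → E) : ℝ :=
  ⨆ φ : Metric.closedBall (0 : StrongDual 𝕜 E) 1,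
    (∑ i, ‖(φ : StrongDual 𝕜 E) (x i)‖ ^ r) ^ (1 / r)

/-- `C` is a constant in the inequality defining `r`-dominated polynomials. -/
def DominatedWith {𝕜 : Type} [RCLike 𝕜] (n : ℕ) (r : ℝ) {E : Type} [NormedAddCommGroup E]
    [NormedSpace 𝕜 E] (P : E → 𝕜) (C : ℝ) : Prop :=
  0 < C ∧ ∀ (m : ℕ) (x : Fin m → E),
    (∑ i, ‖P (x i)‖ ^ (r / n)) ^ (n / r) ≤ C * weakNorm 𝕜 r x ^ n

/-- The ideal `𝓓_r^n` of `r`-dominated `n`-homogeneous polynomials. -/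
def dominated (𝕜 : Type) [RCLike 𝕜] (n : ℕ) (r : ℝ) : PolyClass 𝕜 where
  Mem _ _ _ P := IsHomPoly n P ∧ ∃ C, DominatedWith n r P C
  norm _ _ _ P := sInf {C : ℝ | DominatedWith n r P C}

/-- `β` is the (finitely generated) s-tensor norm associated with the class `𝓠` of
`n`-homogeneous polynomials: `⊗^{n,s}_β M' = 𝓠(M)` isometrically, through the canonical map
`z ↦ (x ↦ ⟨z, ⊗^n x⟩)`, for every finite dimensional normed space `M`. -/
def STensorNorm.IsAssociated {𝕜 : Type} [RCLike 𝕜] {n : ℕ} (β : STensorNorm 𝕜 n)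
    (𝓠 : PolyClass 𝕜) : Prop :=
  β.FinitelyGenerated ∧
  ∀ (M : Type) [NormedAddCommGroup M] [NormedSpace 𝕜 M] [FiniteDimensional 𝕜 M],
    (∀ z : SymTensor 𝕜 n (StrongDual 𝕜 M),
      𝓠.Mem M (polyOf z) ∧ 𝓠.norm M (polyOf z) = β.toSeminorm (StrongDual 𝕜 M) z) ∧
    ∀ P : M → 𝕜, 𝓠.Mem M P → ∃ z : SymTensor 𝕜 n (StrongDual 𝕜 M), polyOf z = P

/-- The value at `z` of the s-tensor norm `α_{r'}^n`:
`inf { ‖(λ_i)‖_s · w_r(x_1, …, x_m)^n : z = ∑ λ_i ⊗^n x_i }`, where `s ∈ [1, ∞]` is the conjugate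
exponent of `r / n`, i.e. `1 / s + n / r = 1`. -/
def alphaNorm {𝕜 : Type} [RCLike 𝕜] {n : ℕ} (r : ℝ) {E : Type} [NormedAddCommGroup E]
    [NormedSpace 𝕜 E] (z : SymTensor 𝕜 n E) : ℝ :=
  sInf {t : ℝ | ∃ (m : ℕ) (c : Fin m → 𝕜) (x : Fin m → E),
    z = ∑ i, c i • tpow 𝕜 n (x i) ∧
    t = ‖(WithLp.toLp (ENNReal.conjExponent (ENNReal.ofReal (r / n))) c : PiLp _ fun _ => 𝕜)‖ *
      weakNorm 𝕜 r x ^ n}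

/-- `α` is the s-tensor norm `α_{r'}^n`. -/
def STensorNorm.IsAlpha {𝕜 : Type} [RCLike 𝕜] {n : ℕ} (α : STensorNorm 𝕜 n) (r : ℝ) : Prop :=
  ∀ (E : Type) [NormedAddCommGroup E] [NormedSpace 𝕜 E] [CompleteSpace E] (z : SymTensor 𝕜 n E),
    α.toSeminorm E z = alphaNorm r z

end SymRN

end

set_option maxSynthPendingDepth 3
set_option linter.unusedSectionVars false

noncomputable section

namespace SymRN

/-! ### Polarization -/

/-! Existence and the sRN property are both reduced to statements about classes of polynomials on
finite dimensional spaces.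

Existence. For parts (a) and (b), a normed ideal of polynomials induces a norm on each `⊗^{n,s} E`
by testing against the unit ball of the ideal; the dual of that s-tensor norm is associated with the
ideal, by the bipolar theorem in finite dimensions (`PolyClass.IsIdeal.exists_isAssociated`). That
the factorable classes are normed ideals is `LpStable.isIdeal`: two factorizations are placed side
by side in `L_r(μ ⊕ ν)`, and `n ≤ r` enters through convexity. For positive polynomials,
multiplication by a unimodular scalar destroys positivity. The scalar is therefore moved into one
variable of the form, and a Hölder inequality for positive forms (`norm_positive_form_le`) shows
that this costs nothing. For part (c), Hölder duality between `ℓ_s` and `ℓ_{r/n}` identifies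
domination with boundedness for `α` (`dominatedWith_iff`).

The sRN property. A functional on `⊗̃_{β'} c_0` is a polynomial `P` on `c_0` whose restrictions to
`ℓ_∞^N` have class norms bounded by the norm of the functional. Each restriction is represented by a
tensor over `(ℓ_∞^N)'`, which sits contractively in `ℓ_1`. These tensors converge to a preimage
under `J` as soon as they are Cauchy, which means that `P` minus its truncation is small in the
class norm, uniformly over `ℓ_∞^{N'}`. This is `PolyClass.CauchyProperty`, and
`STensorNorm.IsAssociated.hasSRN` shows that it suffices.

The Cauchy property. Were it to fail, there would be infinitely many disjoint blocks of coordinates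
on which the difference stays large. Past `m` such blocks, `P` is represented at once by a single
object of bounded size, and that object must be small on one block. For finite `r` the object is an
operator into `L_r`; since `r ≥ 2`, Clarkson's inequality gives the smallness
(`exists_small_block`). For dominated polynomials it is a Pietsch measure, and the pigeonhole
principle gives it (`exists_block_sum_le`). A rescaling on that block then gives the difference norm
`O(δ)` (`LpStable.norm_diff_le`, `dominatedWith_block`). For `r = ∞` the class norm on `ℓ_∞^N` is at
most the sup norm, and the claim becomes the fact that polynomials on `c_0` are uniformly
approximated on the ball by their truncations (`IsHomPoly.exists_norm_sub_czTrunc_le`), proved by a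
gliding hump argument. -/

theorem sum_neg_one_pow_card_superset {α : Type*} [Fintype α] [DecidableEq α] (t : Finset α) :
    ∑ S : Finset α, (if t ⊆ S then (-1 : ℤ) ^ (Fintype.card α + S.card) else 0) =
      if t = Finset.univ then 1 else 0 := by
  split_ifs with ht
  · subst ht
    rw [Finset.sum_eq_single Finset.univ]
    · simp [← two_mul]
    · intro S _ hS
      rw [if_neg]
      exact fun h => hS (Finset.univ_subset_iff.1 h)
    · simp
  · obtain ⟨a, ha⟩ : ∃ a, a ∉ t := by
      by_contra! h
      exact ht (Finset.eq_univ_iff_forall.2 h)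
    -- Toggling a point `a` outside `t` keeps `t ⊆ S` and reverses the sign, so the terms cancel in
    -- pairs.
    refine Finset.sum_involution (fun S _ => symmDiff S {a}) ?_ ?_ ?_ ?_
    · intro S _
      have hsub : t ⊆ symmDiff S {a} ↔ t ⊆ S := by
        refine forall₂_congr fun x hx => ?_
        have : x ≠ a := fun h => ha (h ▸ hx)
        simp [Finset.mem_symmDiff, this]
      simp only [hsub]
      split_ifs with h
      · by_cases haS : a ∈ S
        · have : symmDiff S {a} = S.erase a := by
            ext x; simp only [Finset.mem_symmDiff, Finset.mem_singleton, Finset.mem_erase]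
            by_cases hx : x = a <;> simp [hx, haS]
          rw [this, ← Finset.card_erase_add_one haS]
          ring
        · have : symmDiff S {a} = insert a S := by
            ext x; simp only [Finset.mem_symmDiff, Finset.mem_singleton, Finset.mem_insert]
            by_cases hx : x = a <;> simp [hx, haS]
          rw [this, Finset.card_insert_of_notMem haS]
          ring
      · simp
    · intro S _ _ h
      have : ({a} : Finset α) = ⊥ := symmDiff_eq_left.1 h
      simp at this
    · simp
    · intro S _
      simp

/-- The polarization formula. -/
theorem polarization {R E W : Type*} [CommSemiring R] [AddCommMonoid E] [Module R E]
    [AddCommGroup W] [Module R W] {n : ℕ} (Φ : MultilinearMap R (fun _ : Fin n => E) W)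
    (x : Fin n → E) :
    ∑ S : Finset (Fin n), (-1 : ℤ) ^ (n + S.card) • Φ (fun _ => ∑ j ∈ S, x j) =
      ∑ σ : Equiv.Perm (Fin n), Φ fun i => x (σ i) := by
  classical
  have h1 : ∀ S : Finset (Fin n), Φ (fun _ => ∑ j ∈ S, x j) =
      ∑ f : Fin n → Fin n, if Finset.univ.image f ⊆ S then Φ (fun i => x (f i)) else 0 := by
    intro S
    rw [Φ.map_sum_finset (fun _ j => x j) (fun _ => S), ← Finset.sum_filter]
    refine Finset.sum_congr ?_ fun _ _ => rfl
    ext f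
    simp [Finset.image_subset_iff]
  simp only [h1, Finset.smul_sum]
  rw [Finset.sum_comm]
  -- After exchanging the sums, the coefficient of an index map `f` is the alternating sum over the
  -- supersets of its image, so only the surjective maps survive.
  have h2 : ∀ f : Fin n → Fin n,
      (∑ S : Finset (Fin n), (-1 : ℤ) ^ (n + S.card) •
        (if Finset.univ.image f ⊆ S then Φ (fun i => x (f i)) else 0)) =
      if Function.Bijective f then Φ (fun i => x (f i)) else 0 := by
    intro f
    have h3 := sum_neg_one_pow_card_superset (Finset.univ.image f)
    rw [Fintype.card_fin] at h3
    have h4 : Finset.univ.image f = Finset.univ ↔ Function.Bijective f := by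
      rw [← Finite.surjective_iff_bijective, Finset.eq_univ_iff_forall]
      simp [Function.Surjective]
    simp only [h4] at h3
    have h5 := congrArg (fun k : ℤ => k • Φ (fun i => x (f i))) h3
    simp only [Finset.sum_smul, ite_smul, zero_smul, one_smul] at h5
    rw [← h5]
    refine Finset.sum_congr rfl fun S _ => ?_
    split_ifs <;> simp
  simp only [h2]
  rw [← Finset.sum_filter]
  symm
  refine Finset.sum_bij (fun σ _ => (σ : Fin n → Fin n)) ?_ ?_ ?_ ?_
  · intro σ _; exact Finset.mem_filter.2 ⟨Finset.mem_univ _, σ.bijective⟩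
  · intro σ _ τ _ h; exact DFunLike.coe_injective h
  · intro f hf
    exact ⟨Equiv.ofBijective f (Finset.mem_filter.1 hf).2, Finset.mem_univ _, rfl⟩
  · intros; rfl

/-! ### Symmetrized tensors, polynomials as linear functionals, finite dimensional duality -/

section Sym

variable {𝕜 : Type} [RCLike 𝕜] {n : ℕ}
variable {E : Type} [NormedAddCommGroup E] [NormedSpace 𝕜 E]
variable {F : Type} [NormedAddCommGroup F] [NormedSpace 𝕜 F]

/-- Polarization writes the symmetrization as a combination of powers, which lie in the span by
definition. -/
theorem sum_tprod_perm_mem (x : Fin n → E) :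
    ((n.factorial : 𝕜)⁻¹ • ∑ σ : Equiv.Perm (Fin n),
      (PiTensorProduct.tprod 𝕜).domDomCongr σ) x ∈ SymTensor 𝕜 n E := by
  rw [_root_.smul_apply, _root_.sum_apply]
  simp only [MultilinearMap.domDomCongr_apply]
  rw [← polarization (PiTensorProduct.tprod 𝕜) x]
  refine Submodule.smul_mem _ _ (Submodule.sum_mem _ fun S _ => ?_)
  rw [← Int.cast_smul_eq_zsmul 𝕜]
  exact Submodule.smul_mem _ _ (tpow 𝕜 n (∑ j ∈ S, x j)).2

/-- The symmetrized tensor `1/n! ∑_σ x_{σ 1} ⊗ ⋯ ⊗ x_{σ n}`. -/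
def tsym (𝕜 : Type) [RCLike 𝕜] (n : ℕ) (E : Type) [NormedAddCommGroup E] [NormedSpace 𝕜 E] :
    MultilinearMap 𝕜 (fun _ : Fin n => E) (SymTensor 𝕜 n E) :=
  ((n.factorial : 𝕜)⁻¹ • ∑ σ : Equiv.Perm (Fin n),
      (PiTensorProduct.tprod 𝕜).domDomCongr σ).codRestrict (SymTensor 𝕜 n E) sum_tprod_perm_mem

theorem coe_tsym (x : Fin n → E) : (tsym 𝕜 n E x : ⨂[𝕜] _ : Fin n, E) =
    (n.factorial : 𝕜)⁻¹ • ∑ σ : Equiv.Perm (Fin n), PiTensorProduct.tprod 𝕜 fun i => x (σ i) := by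
  simp [tsym]

theorem tsym_const (x : E) : tsym 𝕜 n E (fun _ => x) = tpow 𝕜 n x := by
  apply Subtype.ext
  rw [coe_tsym]
  simp only [Finset.sum_const, Finset.card_univ, Fintype.card_perm, Fintype.card_fin]
  rw [← Nat.cast_smul_eq_nsmul 𝕜, smul_smul, inv_mul_cancel₀, one_smul]
  · rfl
  · exact_mod_cast n.factorial_ne_zero

theorem tsym_eq_sum (x : Fin n → E) : tsym 𝕜 n E x =
    (n.factorial : 𝕜)⁻¹ • ∑ S : Finset (Fin n), (-1 : ℤ) ^ (n + S.card) •
      tpow 𝕜 n (∑ j ∈ S, x j) := by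
  apply Subtype.ext
  rw [coe_tsym, ← polarization (PiTensorProduct.tprod 𝕜) x]
  simp [tpow]

theorem tpow_smul (c : 𝕜) (x : E) : tpow 𝕜 n (c • x) = c ^ n • tpow 𝕜 n x := by
  rw [← tsym_const, ← tsym_const]
  have := (tsym 𝕜 n E).map_smul_univ (fun _ => c) (fun _ => x)
  simpa using this

theorem symTensor_hom_ext {W : Type*} [AddCommMonoid W] [Module 𝕜 W]
    {f g : SymTensor 𝕜 n E →ₗ[𝕜] W} (h : ∀ x, f (tpow 𝕜 n x) = g (tpow 𝕜 n x)) : f = g := by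
  ext z
  induction z using symTensor_induction with
  | hpow x => exact h x
  | hzero => simp
  | hadd a b ha hb => simp [ha, hb]
  | hsmul c a ha => simp [ha]

theorem symMap_id (z : SymTensor 𝕜 n E) : symMap (ContinuousLinearMap.id 𝕜 E) z = z := by
  have : (symMap (ContinuousLinearMap.id 𝕜 E) : SymTensor 𝕜 n E →ₗ[𝕜] _) = LinearMap.id :=
    symTensor_hom_ext fun x => by simp
  rw [this]; rfl

/-- The constant in the polarization estimates. -/
def polConst (n : ℕ) : ℝ := 2 ^ n * n ^ n

theorem polConst_nonneg (n : ℕ) : 0 ≤ polConst n := by unfold polConst; positivity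

/-- Control on powers alone gives control on mixed tensors: polarization has `2^n` terms, each the
power of a sum of at most `n` vectors, and the factor `1/n!` is discarded. -/
theorem seminorm_tsym_le_of_le_one (q : Seminorm 𝕜 (SymTensor 𝕜 n E)) (p : Seminorm 𝕜 E) {C : ℝ}
    (hC : 0 ≤ C) (h : ∀ x, q (tpow 𝕜 n x) ≤ C * p x ^ n) (x : Fin n → E) (hx : ∀ i, p (x i) ≤ 1) :
    q (tsym 𝕜 n E x) ≤ polConst n * C := by
  rw [tsym_eq_sum, map_smul_eq_mul]
  have h1 : q (∑ S : Finset (Fin n), (-1 : ℤ) ^ (n + S.card) • tpow 𝕜 n (∑ j ∈ S, x j)) ≤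
      ∑ S : Finset (Fin n), C * (n : ℝ) ^ n := by
    refine (Finset.le_sum_of_subadditive q (map_zero q).le (map_add_le_add q) _ _).trans
      (Finset.sum_le_sum fun S _ => ?_)
    have h2 : q ((-1 : ℤ) ^ (n + S.card) • tpow 𝕜 n (∑ j ∈ S, x j)) =
        q (tpow 𝕜 n (∑ j ∈ S, x j)) := by
      rcases neg_one_pow_eq_or ℤ (n + S.card) with h | h <;> rw [h] <;> simp
    rw [h2]
    refine (h _).trans ?_
    gcongr
    refine (Finset.le_sum_of_subadditive p (map_zero p).le (map_add_le_add p) _ _).trans ?_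
    refine (Finset.sum_le_sum fun i _ => hx i).trans ?_
    simpa using S.card_le_univ
  have h3 : ‖(n.factorial : 𝕜)⁻¹‖ ≤ 1 := by
    rw [norm_inv, RCLike.norm_natCast]
    exact inv_le_one_of_one_le₀ (by exact_mod_cast n.factorial_pos)
  refine (mul_le_mul h3 h1 (apply_nonneg _ _) zero_le_one).trans (le_of_eq ?_)
  simp [polConst]
  ring

/-- Homogeneity in each variable. The bounds `t i` are kept separate from `p (x i)` because the
seminorm may vanish and cannot be divided by. -/
theorem seminorm_tsym_le (q : Seminorm 𝕜 (SymTensor 𝕜 n E)) (p : Seminorm 𝕜 E) {C : ℝ}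
    (hC : 0 ≤ C) (h : ∀ x, q (tpow 𝕜 n x) ≤ C * p x ^ n) (x : Fin n → E) (t : Fin n → ℝ)
    (ht : ∀ i, 0 < t i) (hx : ∀ i, p (x i) ≤ t i) :
    q (tsym 𝕜 n E x) ≤ polConst n * C * ∏ i, t i := by
  have h1 : x = fun i => (t i : 𝕜) • (((t i)⁻¹ : ℝ) : 𝕜) • x i := by
    funext i
    rw [smul_smul, ← RCLike.ofReal_mul, mul_inv_cancel₀ (ht i).ne']
    simp
  rw [h1, MultilinearMap.map_smul_univ, map_smul_eq_mul, mul_comm]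
  have h2 : ‖∏ i, (t i : 𝕜)‖ = ∏ i, t i := by
    rw [norm_prod]
    exact Finset.prod_congr rfl fun i _ => by rw [RCLike.norm_ofReal, abs_of_pos (ht i)]
  rw [h2]
  refine mul_le_mul_of_nonneg_right ?_ (Finset.prod_nonneg fun i _ => (ht i).le)
  refine seminorm_tsym_le_of_le_one q p hC h _ fun i => ?_
  rw [map_smul_eq_mul, RCLike.norm_ofReal, abs_of_pos (inv_pos.2 (ht i)), inv_mul_le_iff₀ (ht i)]
  simpa using hx i

/-- A quantitative continuity estimate for homogeneous polynomials. -/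
theorem seminorm_tpow_add_sub_le (q : Seminorm 𝕜 (SymTensor 𝕜 n E)) (p : Seminorm 𝕜 E) {C : ℝ}
    (hC : 0 ≤ C) (h : ∀ x, q (tpow 𝕜 n x) ≤ C * p x ^ n) {A δ : ℝ} (hA : 0 < A) (hδ : 0 < δ)
    (hδ1 : δ ≤ 1) (a d : E) (ha : p a ≤ A) (hd : p d ≤ δ * A) :
    q (tpow 𝕜 n (a + d) - tpow 𝕜 n a) ≤ 2 ^ n * polConst n * C * δ * A ^ n := by
  classical
  -- Multilinear expansion of the power of `a + d`: the term with `a` in every slot cancels, and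
  -- every other term has some slot holding `d`, which supplies one factor `δ`.
  have h1 : tpow 𝕜 n (a + d) - tpow 𝕜 n a =
      ∑ S ∈ Finset.univ.erase (Finset.univ : Finset (Fin n)),
        tsym 𝕜 n E (S.piecewise (fun _ => a) (fun _ => d)) := by
    rw [← tsym_const, ← tsym_const]
    have := (tsym 𝕜 n E).map_add_univ (fun _ => a) (fun _ => d)
    have h2 : ((fun _ => a) + fun _ => d : Fin n → E) = fun _ => a + d := rfl
    rw [h2] at this
    rw [this, ← Finset.add_sum_erase _ _ (Finset.mem_univ Finset.univ)]
    simp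
  rw [h1]
  refine (Finset.le_sum_of_subadditive q (map_zero q).le (map_add_le_add q) _ _).trans ?_
  have h2 : ∀ S ∈ Finset.univ.erase (Finset.univ : Finset (Fin n)),
      q (tsym 𝕜 n E (S.piecewise (fun _ => a) (fun _ => d))) ≤ polConst n * C * (δ * A ^ n) := by
    intro S hS
    have hS' : S ≠ Finset.univ := (Finset.mem_erase.1 hS).1
    obtain ⟨j, hj⟩ : ∃ j, j ∉ S := by
      by_contra! h
      exact hS' (Finset.eq_univ_iff_forall.2 h)
    refine (seminorm_tsym_le q p hC h _ (fun i => if i ∈ S then A else δ * A) ?_ ?_).trans ?_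
    · intro i; split_ifs <;> positivity
    · intro i
      by_cases hi : i ∈ S <;> simp [hi, ha, hd]
    · refine mul_le_mul_of_nonneg_left ?_ (mul_nonneg (polConst_nonneg n) hC)
      have : ∏ i, (if i ∈ S then A else δ * A) = (∏ i, if i ∈ S then 1 else δ) * A ^ n := by
        have h3 : A ^ n = ∏ _i : Fin n, A := by simp
        rw [h3, ← Finset.prod_mul_distrib]
        exact Finset.prod_congr rfl fun i _ => by split_ifs <;> simp
      rw [this]
      refine mul_le_mul_of_nonneg_right ?_ (by positivity)
      rw [← Finset.mul_prod_erase _ _ (Finset.mem_univ j), if_neg hj]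
      refine mul_le_of_le_one_right hδ.le (Finset.prod_le_one ?_ ?_)
      · intro i _; split_ifs <;> positivity
      · intro i _; split_ifs <;> simp [hδ1]
  refine (Finset.sum_le_sum h2).trans ?_
  rw [Finset.sum_const, nsmul_eq_mul]
  have h3 : ((Finset.univ.erase (Finset.univ : Finset (Fin n))).card : ℝ) ≤ 2 ^ n := by
    have : (Finset.univ.erase (Finset.univ : Finset (Fin n))).card ≤ 2 ^ n :=
      (Finset.card_le_univ _).trans (by simp)
    exact_mod_cast this
  have h4 : 0 ≤ polConst n * C * (δ * A ^ n) :=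
    mul_nonneg (mul_nonneg (polConst_nonneg n) hC) (by positivity)
  refine (mul_le_mul_of_nonneg_right h3 h4).trans (le_of_eq ?_)
  ring

/-- Homogeneous polynomials as linear functionals on the symmetric tensor product. -/
theorem IsHomPoly.exists_linear {P : E → 𝕜} (hP : IsHomPoly n P) :
    ∃ l : SymTensor 𝕜 n E →ₗ[𝕜] 𝕜, ∀ x, l (tpow 𝕜 n x) = P x := by
  obtain ⟨Φ, hΦ⟩ := hP
  refine ⟨(PiTensorProduct.lift Φ.toMultilinearMap).domRestrict (SymTensor 𝕜 n E), fun x => ?_⟩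
  rw [hΦ]
  simp [tpow]

theorem IsHomPoly.exists_bound {P : E → 𝕜} (hP : IsHomPoly n P) :
    ∃ C, 0 ≤ C ∧ ∀ x, ‖P x‖ ≤ C * ‖x‖ ^ n := by
  obtain ⟨Φ, hΦ⟩ := hP
  refine ⟨‖Φ‖, norm_nonneg _, fun x => ?_⟩
  rw [hΦ]
  simpa using Φ.le_opNorm fun _ => x

/-- The seminorm `z ↦ |l z|` of a linear functional. -/
def absSeminorm {V : Type*} [AddCommGroup V] [Module 𝕜 V] (l : V →ₗ[𝕜] 𝕜) : Seminorm 𝕜 V :=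
  (normSeminorm 𝕜 𝕜).comp l

@[simp] theorem absSeminorm_apply {V : Type*} [AddCommGroup V] [Module 𝕜 V] (l : V →ₗ[𝕜] 𝕜)
    (v : V) : absSeminorm l v = ‖l v‖ := rfl

/-- The continuous symmetric multilinear form of a bounded polynomial. -/
def polarForm (l : SymTensor 𝕜 n E →ₗ[𝕜] 𝕜) (C : ℝ) (hC : 0 ≤ C)
    (h : ∀ x, ‖l (tpow 𝕜 n x)‖ ≤ C * ‖x‖ ^ n) :
    ContinuousMultilinearMap 𝕜 (fun _ : Fin n => E) 𝕜 :=
  (l.compMultilinearMap (tsym 𝕜 n E)).mkContinuous (polConst n * C) fun x => by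
    by_cases hx : ∀ i, 0 < ‖x i‖
    · exact seminorm_tsym_le (absSeminorm l) (normSeminorm 𝕜 E) hC (by simpa using h) x
        (fun i => ‖x i‖) hx fun i => le_rfl
    · push Not at hx
      obtain ⟨i, hi⟩ := hx
      rw [(l.compMultilinearMap (tsym 𝕜 n E)).map_coord_zero i (norm_le_zero_iff.1 hi), norm_zero]
      exact mul_nonneg (mul_nonneg (polConst_nonneg n) hC)
        (Finset.prod_nonneg fun _ _ => norm_nonneg _)

theorem polarForm_apply (l : SymTensor 𝕜 n E →ₗ[𝕜] 𝕜) (C : ℝ) (hC : 0 ≤ C)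
    (h : ∀ x, ‖l (tpow 𝕜 n x)‖ ≤ C * ‖x‖ ^ n) (x : Fin n → E) :
    polarForm l C hC h x = l (tsym 𝕜 n E x) := rfl

theorem isHomPoly_of_linear (l : SymTensor 𝕜 n E →ₗ[𝕜] 𝕜) {C : ℝ} (hC : 0 ≤ C)
    (h : ∀ x, ‖l (tpow 𝕜 n x)‖ ≤ C * ‖x‖ ^ n) : IsHomPoly n fun x => l (tpow 𝕜 n x) :=
  ⟨polarForm l C hC h, fun x => by rw [polarForm_apply, tsym_const]⟩

/-- Stated for an arbitrary seminorm because it serves twice: with the norm of `L_r` for factorable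
polynomials, and with a weighted `ℓ_r` seminorm for dominated ones. -/
theorem IsHomPoly.norm_add_sub_le {P : E → 𝕜} (hP : IsHomPoly n P) (p : Seminorm 𝕜 E) {C : ℝ}
    (hC : 0 ≤ C) (h : ∀ x, ‖P x‖ ≤ C * p x ^ n) {A δ : ℝ} (hA : 0 < A) (hδ : 0 < δ)
    (hδ1 : δ ≤ 1) (a d : E) (ha : p a ≤ A) (hd : p d ≤ δ * A) :
    ‖P (a + d) - P a‖ ≤ 2 ^ n * polConst n * C * δ * A ^ n := by
  obtain ⟨l, hl⟩ := hP.exists_linear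
  have := seminorm_tpow_add_sub_le (absSeminorm l) p hC (by simpa [hl] using h) hA hδ hδ1 a d ha hd
  simpa [hl] using this

/-! ### Duality of symmetric tensor products of finite dimensional spaces -/

theorem symPair_tsym (φ : Fin n → StrongDual 𝕜 E) (x : E) :
    symPair 𝕜 n E (tsym 𝕜 n _ φ) (tpow 𝕜 n x) = ∏ i, φ i x := by
  have h : ∀ w : SymTensor 𝕜 n (StrongDual 𝕜 E), symPair 𝕜 n E w (tpow 𝕜 n x) =
      PiTensorProduct.dualDistrib (PiTensorProduct.map (fun _ : Fin n =>
        (ContinuousLinearMap.coeLM 𝕜 : StrongDual 𝕜 E →ₗ[𝕜] Module.Dual 𝕜 E)) w)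
          (PiTensorProduct.tprod 𝕜 fun _ : Fin n => x) := fun _ => rfl
  rw [h, coe_tsym]
  simp only [map_smul, map_sum, PiTensorProduct.map_tprod, LinearMap.smul_apply,
    LinearMap.sum_apply, PiTensorProduct.dualDistrib_apply]
  have h2 : ∀ σ : Equiv.Perm (Fin n), ∏ i, (ContinuousLinearMap.coeLM 𝕜 (φ (σ i)) : Module.Dual 𝕜 E) x
      = ∏ i, φ i x := fun σ => Equiv.prod_comp σ fun i => φ i x
  simp only [h2, Finset.sum_const, Finset.card_univ, Fintype.card_perm, Fintype.card_fin]
  rw [nsmul_eq_mul, smul_eq_mul, ← mul_assoc, inv_mul_cancel₀, one_mul]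
  exact_mod_cast n.factorial_ne_zero

/-- Extend `l` to the full tensor power, represent the extension by a tensor of functionals, and
symmetrize that tensor. Symmetrization does not change the pairing with powers. -/
theorem exists_symPair_eq [FiniteDimensional 𝕜 E] (l : SymTensor 𝕜 n E →ₗ[𝕜] 𝕜) :
    ∃ z : SymTensor 𝕜 n (StrongDual 𝕜 E), ∀ u, symPair 𝕜 n E z u = l u := by
  obtain ⟨L, hL⟩ := LinearMap.exists_extend l
  let w : ⨂[𝕜] _ : Fin n, Module.Dual 𝕜 E :=
    (PiTensorProduct.dualDistribEquiv (R := 𝕜) (M := fun _ : Fin n => E)).symm L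
  have hw : PiTensorProduct.dualDistrib w = L :=
    (PiTensorProduct.dualDistribEquiv (R := 𝕜) (M := fun _ : Fin n => E)).apply_symm_apply L
  let S : (⨂[𝕜] _ : Fin n, Module.Dual 𝕜 E) →ₗ[𝕜] SymTensor 𝕜 n (StrongDual 𝕜 E) :=
    PiTensorProduct.lift ((tsym 𝕜 n (StrongDual 𝕜 E)).compLinearMap
      fun _ => (LinearMap.toContinuousLinearMap : (E →ₗ[𝕜] 𝕜) ≃ₗ[𝕜] _).toLinearMap)
  have hS : ∀ (w : ⨂[𝕜] _ : Fin n, Module.Dual 𝕜 E) (x : E),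
      symPair 𝕜 n E (S w) (tpow 𝕜 n x) =
        PiTensorProduct.dualDistrib w (PiTensorProduct.tprod 𝕜 fun _ => x) := by
    intro w x
    induction w using PiTensorProduct.induction_on with
    | smul_tprod r φ =>
      simp only [S, map_smul, LinearMap.smul_apply, PiTensorProduct.lift.tprod,
        MultilinearMap.compLinearMap_apply, symPair_tsym, PiTensorProduct.dualDistrib_apply]
      rfl
    | add a b ha hb => simp only [map_add, LinearMap.add_apply, ha, hb]
  refine ⟨S w, fun u => ?_⟩
  have : symPair 𝕜 n E (S w) = l := symTensor_hom_ext fun x => by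
    rw [hS, hw, ← hL]; rfl
  rw [this]

theorem symPair_symMap_bidual (u : SymTensor 𝕜 n E) (w : SymTensor 𝕜 n (StrongDual 𝕜 E)) :
    symPair 𝕜 n (StrongDual 𝕜 E) (symMap (NormedSpace.inclusionInDoubleDual 𝕜 E) u) w
      = symPair 𝕜 n E w u := by
  induction u using symTensor_induction with
  | hpow x => rw [symMap_tpow, symPair_bidual]
  | hzero => simp
  | hadd a b ha hb => simp only [map_add, LinearMap.add_apply, ha, hb]
  | hsmul c a ha => simp only [map_smul, LinearMap.smul_apply, ha]

/-- The inverse of the canonical isometry of a finite dimensional space onto its bidual. -/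
theorem exists_bidual_inv (E : Type) [NormedAddCommGroup E] [NormedSpace 𝕜 E]
    [FiniteDimensional 𝕜 E] :
    ∃ R : StrongDual 𝕜 (StrongDual 𝕜 E) →L[𝕜] E, ‖R‖ ≤ 1 ∧
      ∀ ψ, NormedSpace.inclusionInDoubleDual 𝕜 E (R ψ) = ψ := by
  have e1 : Module.finrank 𝕜 (StrongDual 𝕜 E) = Module.finrank 𝕜 E := by
    rw [← (LinearMap.toContinuousLinearMap : (E →ₗ[𝕜] 𝕜) ≃ₗ[𝕜] _).finrank_eq]
    exact Subspace.dual_finrank_eq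
  have e2 : Module.finrank 𝕜 (StrongDual 𝕜 (StrongDual 𝕜 E)) = Module.finrank 𝕜 E := by
    rw [← (LinearMap.toContinuousLinearMap : (StrongDual 𝕜 E →ₗ[𝕜] 𝕜) ≃ₗ[𝕜] _).finrank_eq, ← e1]
    exact Subspace.dual_finrank_eq
  let J := (NormedSpace.inclusionInDoubleDualLi (𝕜 := 𝕜) (E := E)).toLinearIsometryEquiv e2.symm
  refine ⟨J.symm.toContinuousLinearEquiv.toContinuousLinearMap,
    ContinuousLinearMap.opNorm_le_bound _ zero_le_one fun ψ => ?_, fun ψ => ?_⟩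
  · simp
  · exact J.apply_symm_apply ψ

/-- Reflexivity: the representing tensor over the bidual is pulled back to `E`. -/
theorem exists_symPair_eq' [FiniteDimensional 𝕜 E]
    (l : SymTensor 𝕜 n (StrongDual 𝕜 E) →ₗ[𝕜] 𝕜) :
    ∃ u : SymTensor 𝕜 n E, ∀ z, symPair 𝕜 n E z u = l z := by
  obtain ⟨w, hw⟩ := exists_symPair_eq l
  obtain ⟨R, -, hR⟩ := exists_bidual_inv (𝕜 := 𝕜) E
  refine ⟨symMap R w, fun z => ?_⟩
  rw [← symPair_symMap_bidual, ← symMap_comp, ← hw]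
  have : (NormedSpace.inclusionInDoubleDual 𝕜 E).comp R = ContinuousLinearMap.id 𝕜 _ :=
    ContinuousLinearMap.ext hR
  rw [this, symMap_id]

/-- Every polynomial on a finite dimensional space is represented by a tensor. -/
theorem IsHomPoly.exists_polyOf [FiniteDimensional 𝕜 E] {P : E → 𝕜} (hP : IsHomPoly n P) :
    ∃ z : SymTensor 𝕜 n (StrongDual 𝕜 E), polyOf z = P := by
  obtain ⟨l, hl⟩ := hP.exists_linear
  obtain ⟨z, hz⟩ := exists_symPair_eq l
  exact ⟨z, funext fun x => by rw [polyOf, hz, hl]⟩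

theorem exists_functional_of_seminorm {V : Type*} [AddCommGroup V] [Module 𝕜 V]
    (N : Seminorm 𝕜 V) (z : V) : ∃ l : V →ₗ[𝕜] 𝕜, (∀ v, ‖l v‖ ≤ N v) ∧ ‖l z‖ = N z := by
  let : SeminormedAddCommGroup V := N.toAddGroupSeminorm.toSeminormedAddCommGroup
  let : NormedSpace 𝕜 V := ⟨fun c v => (map_smul_eq_mul N c v).le⟩
  obtain ⟨g, hg, hz⟩ := exists_dual_vector'' 𝕜 z
  refine ⟨g, fun v => ?_, ?_⟩
  · refine (g.le_opNorm v).trans ?_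
    exact mul_le_of_le_one_left (norm_nonneg v) hg
  · change ‖g z‖ = ‖z‖
    rw [hz]
    simp

/-- The bipolar theorem for seminorms on `⊗^{n,s} E'`. -/
theorem seminorm_le_of_forall_symPair [FiniteDimensional 𝕜 E]
    (N : Seminorm 𝕜 (SymTensor 𝕜 n (StrongDual 𝕜 E))) (z : SymTensor 𝕜 n (StrongDual 𝕜 E)) {C : ℝ}
    (h : ∀ u : SymTensor 𝕜 n E, (∀ w, ‖symPair 𝕜 n E w u‖ ≤ N w) → ‖symPair 𝕜 n E z u‖ ≤ C) :
    N z ≤ C := by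
  obtain ⟨l, hl, hz⟩ := exists_functional_of_seminorm N z
  obtain ⟨u, hu⟩ := exists_symPair_eq' l
  rw [← hz, ← hu]
  exact h u fun w => by rw [hu]; exact hl w

end Sym

end SymRN

end

noncomputable section

namespace SymRN

open Filter Topology

theorem norm_subtypeL_le_one {𝕜 : Type} [RCLike 𝕜] {E : Type} [NormedAddCommGroup E]
    [NormedSpace 𝕜 E] (M : Submodule 𝕜 E) : ‖M.subtypeL‖ ≤ 1 :=
  ContinuousLinearMap.opNorm_le_bound _ zero_le_one fun x => by simp

namespace STensorNorm

variable {𝕜 : Type} [RCLike 𝕜] {n : ℕ} (β : STensorNorm 𝕜 n)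
variable {E : Type} [NormedAddCommGroup E] [NormedSpace 𝕜 E] [CompleteSpace E]
variable {F : Type} [NormedAddCommGroup F] [NormedSpace 𝕜 F] [CompleteSpace F]

theorem map_le_of_norm_le_one (T : E →L[𝕜] F) (hT : ‖T‖ ≤ 1) (z : SymTensor 𝕜 n E) :
    β.toSeminorm F (symMap T z) ≤ β.toSeminorm E z :=
  (β.map_le E F T z).trans
    (mul_le_of_le_one_left (apply_nonneg _ _) (pow_le_one₀ (norm_nonneg _) hT))

theorem tpow_le (x : E) : β.toSeminorm E (tpow 𝕜 n x) ≤ ‖x‖ ^ n :=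
  (β.le_piS E _).trans (piS_tpow_le x)

/-! ### The dual norm -/

/-- The finite dimensional dual norm already contracts under inclusions of subspaces, so the infimum
over subspaces is reached at the whole space. -/
theorem dual_eq_dualFin [FiniteDimensional 𝕜 E] (z : SymTensor 𝕜 n E) :
    β.dual.toSeminorm E z = β.dualFin E z := by
  change β.dualFun E z = β.dualFin E z
  refine le_antisymm ?_ ?_
  · let S : E →L[𝕜] (⊤ : Submodule 𝕜 E) :=
      (ContinuousLinearMap.id 𝕜 E).codRestrict ⊤ fun x => Submodule.mem_top
    have hS : ‖S‖ ≤ 1 := ContinuousLinearMap.opNorm_le_bound _ zero_le_one fun x => by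
      rw [one_mul]; rfl
    have hz : z = symMap (⊤ : Submodule 𝕜 E).subtypeL (symMap S z) := by
      rw [← symMap_comp]
      exact (symMap_id z).symm
    conv_lhs => rw [hz]
    exact (β.dualFun_le ⊤ _).trans (β.dualFin_map_le_of_le_one S hS z)
  · refine β.le_dualFun z fun M _ w hw => ?_
    rw [← hw]
    exact β.dualFin_map_le_of_le_one _ (norm_subtypeL_le_one M) w

theorem dual_finitelyGenerated : β.dual.FinitelyGenerated := by
  intro E _ _ _ z
  have h : {t : ℝ | ∃ (M : Submodule 𝕜 E) (_ : FiniteDimensional 𝕜 M) (w : SymTensor 𝕜 n M),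
      symMap M.subtypeL w = z ∧ t = β.dual.toSeminorm M w} =
      {t : ℝ | ∃ (M : Submodule 𝕜 E) (_ : FiniteDimensional 𝕜 M) (w : SymTensor 𝕜 n M),
      symMap M.subtypeL w = z ∧ t = β.dualFin M w} := by
    ext t
    refine exists_congr fun M => exists_congr fun hM => exists_congr fun w => ?_
    rw [β.dual_eq_dualFin]
  rw [h]
  refine isGLB_csInf ?_ ⟨0, ?_⟩
  · obtain ⟨M, hM, w, hw⟩ := exists_finiteDimensional z
    exact ⟨_, M, hM, w, hw, rfl⟩
  · rintro _ ⟨M, hM, w, -, rfl⟩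
    exact β.dualFin_nonneg w

/-- The tensor `u` lives on a finite dimensional subspace, and restricting functionals to that
subspace is a contraction for `β`. This bounds `J` by one. -/
theorem norm_symPair_le_dual (w : SymTensor 𝕜 n (StrongDual 𝕜 E)) (u : SymTensor 𝕜 n E) :
    ‖symPair 𝕜 n E w u‖ ≤ β.toSeminorm (StrongDual 𝕜 E) w * β.dual.toSeminorm E u := by
  have h : ∀ (M : Submodule 𝕜 E) [FiniteDimensional 𝕜 M] (v : SymTensor 𝕜 n M),
      symMap M.subtypeL v = u →
      ‖symPair 𝕜 n E w u‖ ≤ β.toSeminorm (StrongDual 𝕜 E) w * β.dualFin M v := by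
    intro M _ v hv
    rw [← hv, symPair_map]
    refine β.norm_symPair_le v _ (apply_nonneg _ _) ?_
    exact β.map_le_of_norm_le_one _ ((norm_transpose_le _).trans (norm_subtypeL_le_one M)) w
  rcases (apply_nonneg (β.toSeminorm (StrongDual 𝕜 E)) w).eq_or_lt with h0 | h0
  · obtain ⟨M, hM, v, hv⟩ := exists_finiteDimensional u
    have := h M v hv
    rw [← h0, zero_mul] at this ⊢
    exact this
  · rw [← div_le_iff₀' h0]
    refine β.le_dualFun u fun M _ v hv => ?_
    rw [div_le_iff₀' h0]
    exact h M v hv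

/-- The definition tests against tensors over the bidual; isometric reflexivity lets tensors over
`E` do the testing. -/
theorem dualFin_strongDual_le [FiniteDimensional 𝕜 E] (z : SymTensor 𝕜 n (StrongDual 𝕜 E)) {C : ℝ}
    (hC : 0 ≤ C)
    (h : ∀ u : SymTensor 𝕜 n E, β.toSeminorm E u ≤ 1 → ‖symPair 𝕜 n E z u‖ ≤ C) :
    β.dualFin (StrongDual 𝕜 E) z ≤ C := by
  obtain ⟨R, hR1, hR⟩ := exists_bidual_inv (𝕜 := 𝕜) E
  refine β.dualFin_le z hC fun w hw => ?_
  have hw' : w = symMap (NormedSpace.inclusionInDoubleDual 𝕜 E) (symMap R w) := by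
    rw [← symMap_comp]
    have : (NormedSpace.inclusionInDoubleDual 𝕜 E).comp R = ContinuousLinearMap.id 𝕜 _ :=
      ContinuousLinearMap.ext hR
    rw [this, symMap_id]
  rw [hw', symPair_symMap_bidual]
  exact h _ ((β.map_le_of_norm_le_one R hR1 w).trans hw)

theorem norm_symPair_le_dualFin_strongDual [FiniteDimensional 𝕜 E]
    (z : SymTensor 𝕜 n (StrongDual 𝕜 E)) (u : SymTensor 𝕜 n E) :
    ‖symPair 𝕜 n E z u‖ ≤ β.toSeminorm E u * β.dualFin (StrongDual 𝕜 E) z := by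
  rw [← symPair_symMap_bidual]
  refine β.norm_symPair_le z _ (apply_nonneg _ _) ?_
  exact β.map_le_of_norm_le_one _ (NormedSpace.inclusionInDoubleDual_norm_le 𝕜 E) u

/-- On elementary tensors this is the continuity estimate for powers, and linearity does the rest.
No uniform bound on the operators is needed because `z` is a finite sum. -/
theorem tendsto_symMap {R : ℕ → E →L[𝕜] E} (hR : ∀ x, Tendsto (fun N => R N x) atTop (𝓝 x))
    (z : SymTensor 𝕜 n E) :
    Tendsto (fun N => β.toSeminorm E (symMap (R N) z - z)) atTop (𝓝 0) := by
  induction z using symTensor_induction with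
  | hpow a =>
    simp only [symMap_tpow]
    rw [Metric.tendsto_atTop]
    intro ε hε
    have hK : 0 ≤ 2 ^ n * polConst n := mul_nonneg (by positivity) (polConst_nonneg n)
    obtain ⟨δ, hδ, hδ1, hδε⟩ : ∃ δ : ℝ, 0 < δ ∧ δ ≤ 1 ∧
        2 ^ n * polConst n * 1 * δ * (‖a‖ + 1) ^ n < ε := by
      let c := 2 ^ n * polConst n * (‖a‖ + 1) ^ n
      have hc : 0 ≤ c := mul_nonneg hK (by positivity)
      refine ⟨min 1 (ε / (2 * (c + 1))), by positivity, min_le_left _ _, ?_⟩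
      have h1 : c * min 1 (ε / (2 * (c + 1))) ≤ c * (ε / (2 * (c + 1))) := by
        gcongr
        exact min_le_right _ _
      have h2 : c * (ε / (2 * (c + 1))) < ε := by
        rw [mul_div_assoc', div_lt_iff₀ (by positivity)]
        nlinarith
      calc _ = c * min 1 (ε / (2 * (c + 1))) := by simp only [c]; ring
        _ < ε := h1.trans_lt h2
    obtain ⟨N₀, hN₀⟩ := Metric.tendsto_atTop.1 (hR a) (δ * (‖a‖ + 1)) (by positivity)
    refine ⟨N₀, fun N hN => ?_⟩
    have h1 := hN₀ N hN
    rw [dist_eq_norm] at h1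
    have h2 := seminorm_tpow_add_sub_le (β.toSeminorm E) (normSeminorm 𝕜 E) (C := 1) zero_le_one
      (fun x => by rw [one_mul]; exact β.tpow_le x) (A := ‖a‖ + 1) (by positivity) hδ hδ1 a
      (R N a - a) (by simp) h1.le
    rw [add_sub_cancel] at h2
    rw [Real.dist_eq, sub_zero, abs_of_nonneg (apply_nonneg _ _)]
    exact h2.trans_lt hδε
  | hzero => simp
  | hadd a b ha hb =>
    refine squeeze_zero (fun _ => apply_nonneg _ _) (fun N => ?_) (by simpa using ha.add hb)
    rw [map_add, add_sub_add_comm]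
    exact map_add_le_add _ _ _
  | hsmul c a ha =>
    have : ∀ N, β.toSeminorm E (symMap (R N) (c • a) - c • a) =
        ‖c‖ * β.toSeminorm E (symMap (R N) a - a) := fun N => by
      rw [map_smul, ← smul_sub, map_smul_eq_mul]
    simp only [this]
    simpa using ha.const_mul ‖c‖

end STensorNorm

/-! ### Coordinates in `c_0` and `ℓ_1` -/

section Coord

variable {𝕜 : Type} [RCLike 𝕜]

theorem norm_czero_le {x : CZero 𝕜} {C : ℝ} (hC : 0 ≤ C) : ‖x‖ ≤ C ↔ ∀ i, ‖x i‖ ≤ C :=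
  BoundedContinuousFunction.norm_le (f := x.toBCF) hC

/-- The inclusion of `ℓ_∞^N` into `c_0`. -/
def czIncl (𝕜 : Type) [RCLike 𝕜] (N : ℕ) : (Fin N → 𝕜) →L[𝕜] CZero 𝕜 :=
  LinearMap.mkContinuous
    { toFun := fun x =>
        { toFun := fun i => if h : i < N then x ⟨i, h⟩ else 0
          continuous_toFun := continuous_of_discreteTopology
          zero_at_infty' := by
            rw [cocompact_eq_cofinite, Nat.cofinite_eq_atTop]
            refine tendsto_const_nhds.congr' ?_
            filter_upwards [eventually_ge_atTop N] with i hi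
            rw [dif_neg (not_lt.2 hi)] }
      map_add' := fun x y => by
        ext i
        change (if h : i < N then (x + y) ⟨i, h⟩ else 0) =
          (if h : i < N then x ⟨i, h⟩ else 0) + (if h : i < N then y ⟨i, h⟩ else 0)
        split_ifs <;> simp
      map_smul' := fun c x => by
        ext i
        change (if h : i < N then (c • x) ⟨i, h⟩ else 0) =
          c • (if h : i < N then x ⟨i, h⟩ else 0)
        split_ifs <;> simp }
    1 fun x => by
      rw [one_mul, norm_czero_le (norm_nonneg x)]
      intro i
      change ‖if h : i < N then x ⟨i, h⟩ else 0‖ ≤ _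
      split_ifs
      · exact norm_le_pi_norm x _
      · simp

theorem czIncl_apply (N : ℕ) (x : Fin N → 𝕜) (i : ℕ) :
    czIncl 𝕜 N x i = if h : i < N then x ⟨i, h⟩ else 0 := rfl

theorem norm_czIncl_le (N : ℕ) : ‖czIncl 𝕜 N‖ ≤ 1 := LinearMap.mkContinuous_norm_le _ zero_le_one _

/-- The restriction of `c_0` to the first `N` coordinates. -/
def czProj (𝕜 : Type) [RCLike 𝕜] (N : ℕ) : CZero 𝕜 →L[𝕜] (Fin N → 𝕜) :=
  LinearMap.mkContinuous
    { toFun := fun x i => x i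
      map_add' := fun _ _ => rfl
      map_smul' := fun _ _ => rfl }
    1 fun x => by
      rw [one_mul, pi_norm_le_iff_of_nonneg (norm_nonneg x)]
      exact fun i => norm_apply_le x i

theorem czProj_apply (N : ℕ) (x : CZero 𝕜) (i : Fin N) : czProj 𝕜 N x i = x i := rfl

theorem norm_czProj_le (N : ℕ) : ‖czProj 𝕜 N‖ ≤ 1 := LinearMap.mkContinuous_norm_le _ zero_le_one _

/-- The coordinate projection of `c_0` onto the first `N` coordinates. -/
def czTrunc (𝕜 : Type) [RCLike 𝕜] (N : ℕ) : CZero 𝕜 →L[𝕜] CZero 𝕜 :=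
  (czIncl 𝕜 N).comp (czProj 𝕜 N)

theorem czTrunc_apply (N : ℕ) (x : CZero 𝕜) (i : ℕ) :
    czTrunc 𝕜 N x i = if i < N then x i else 0 := by
  change (if h : i < N then czProj 𝕜 N x ⟨i, h⟩ else 0) = _
  split_ifs <;> rfl

theorem czero_tendsto_zero (x : CZero 𝕜) : Tendsto (fun i => x i) atTop (𝓝 0) := by
  have := x.zero_at_infty'
  rwa [cocompact_eq_cofinite, Nat.cofinite_eq_atTop] at this

theorem tendsto_czTrunc (x : CZero 𝕜) : Tendsto (fun N => czTrunc 𝕜 N x) atTop (𝓝 x) := by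
  rw [Metric.tendsto_atTop]
  intro ε hε
  obtain ⟨N₀, hN₀⟩ := Metric.tendsto_atTop.1 (czero_tendsto_zero x) (ε / 2) (by positivity)
  refine ⟨N₀, fun N hN => ?_⟩
  rw [dist_eq_norm]
  refine lt_of_le_of_lt ((norm_czero_le (by positivity)).2 fun i => ?_) (half_lt_self hε)
  change ‖czTrunc 𝕜 N x i - x i‖ ≤ _
  rw [czTrunc_apply]
  split_ifs with h
  · simpa using (half_pos hε).le
  · have := hN₀ i (hN.trans (not_lt.1 h))
    rw [dist_zero_right] at this
    simpa using this.le

/-- Evaluate `φ` at the vector of phases that make every term `φ(e_i)` a nonnegative real; it has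
sup norm at most one. -/
theorem exists_pi_sum_norm (N : ℕ) (φ : StrongDual 𝕜 (Fin N → 𝕜)) :
    ∑ i, ‖φ (Pi.single i 1)‖ ≤ ‖φ‖ := by
  have h : ∀ i, ∃ c : 𝕜, ‖c‖ = 1 ∧ (‖φ (Pi.single i 1)‖ : 𝕜) = c * φ (Pi.single i 1) :=
    fun i => RCLike.exists_norm_eq_mul_self _
  choose c hc hc' using h
  have h1 : φ c = ((∑ i, ‖φ (Pi.single i 1)‖ : ℝ) : 𝕜) := by
    have h2 : c = ∑ i, c i • Pi.single (M := fun _ : Fin N => 𝕜) i 1 := by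
      ext j
      simp [Finset.sum_apply, Pi.single_apply]
    conv_lhs => rw [h2]
    rw [map_sum]
    push_cast
    exact Finset.sum_congr rfl fun i _ => by rw [map_smul, smul_eq_mul, ← hc']
  have h2 := φ.le_opNorm c
  rw [h1, RCLike.norm_ofReal, abs_of_nonneg (Finset.sum_nonneg fun _ _ => norm_nonneg _)] at h2
  refine h2.trans (mul_le_of_le_one_right (norm_nonneg _) ?_)
  rw [pi_norm_le_iff_of_nonneg zero_le_one]
  exact fun i => (hc i).le

/-- The isometric inclusion of `(ℓ_∞^N)'` into `ℓ_1`. -/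
def dualToEllOne (𝕜 : Type) [RCLike 𝕜] (N : ℕ) : StrongDual 𝕜 (Fin N → 𝕜) →L[𝕜] EllOne 𝕜 :=
  LinearMap.mkContinuous
    { toFun := fun φ => ∑ i : Fin N, lp.single 1 (i : ℕ) (φ (Pi.single i 1))
      map_add' := fun φ ψ => by
        simp [Finset.sum_add_distrib]
      map_smul' := fun c φ => by
        rw [RingHom.id_apply, Finset.smul_sum]
        exact Finset.sum_congr rfl fun i _ => by
          rw [_root_.smul_apply, lp.single_smul] }
    1 fun φ => by
      rw [one_mul]
      refine (norm_sum_le _ _).trans (le_trans (Finset.sum_le_sum fun i _ => ?_)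
        (exists_pi_sum_norm N φ))
      rw [lp.norm_single (by simp)]

theorem norm_dualToEllOne_le (N : ℕ) : ‖dualToEllOne 𝕜 N‖ ≤ 1 :=
  LinearMap.mkContinuous_norm_le _ zero_le_one _

theorem dualToEllOne_apply (N : ℕ) (φ : StrongDual 𝕜 (Fin N → 𝕜)) (i : ℕ) :
    dualToEllOne 𝕜 N φ i = if h : i < N then φ (Pi.single ⟨i, h⟩ 1) else 0 := by
  change (∑ j : Fin N, lp.single 1 (j : ℕ) (φ (Pi.single j 1)) : EllOne 𝕜) i = _
  rw [lp.coeFn_sum, Finset.sum_apply]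
  split_ifs with h
  · rw [Finset.sum_eq_single ⟨i, h⟩]
    · simp
    · intro j _ hj
      rw [lp.single_apply_ne]
      exact fun h' => hj (Fin.ext h'.symm)
    · simp
  · refine Finset.sum_eq_zero fun j _ => ?_
    rw [lp.single_apply_ne]
    exact fun h' => h (h' ▸ j.2)

/-- A functional on `ℓ_∞^N` carried into `ℓ_1` acts on `c_0` through the first `N` coordinates. This
computes the limit of the approximating tensors. -/
theorem ellOneToDual_comp_dualToEllOne (N : ℕ) :
    (ellOneToDual 𝕜).comp (dualToEllOne 𝕜 N) = transpose (czProj 𝕜 N) := by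
  ext φ x
  change ∑' i, dualToEllOne 𝕜 N φ i * x i = φ (czProj 𝕜 N x)
  rw [tsum_eq_sum (s := Finset.range N) fun i hi => by
    rw [dualToEllOne_apply, dif_neg (by simpa using hi), zero_mul]]
  rw [Finset.sum_range fun i => dualToEllOne 𝕜 N φ i * x i]
  have h2 : czProj 𝕜 N x = ∑ i : Fin N, x i • Pi.single (M := fun _ : Fin N => 𝕜) i 1 := by
    ext j
    simp [Finset.sum_apply, Pi.single_apply, czProj_apply]
  rw [h2, map_sum]
  refine Finset.sum_congr rfl fun i _ => ?_
  rw [dualToEllOne_apply, dif_pos i.2, map_smul, smul_eq_mul, mul_comm]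

/-- The copies of `(ℓ_∞^N)'` in `ℓ_1` are nested, so representing tensors of different levels can be
compared at the higher level. -/
theorem dualToEllOne_comp_transpose {N N' : ℕ} (h : N ≤ N') :
    (dualToEllOne 𝕜 N').comp (transpose ((czProj 𝕜 N).comp (czIncl 𝕜 N'))) =
      dualToEllOne 𝕜 N := by
  ext φ i
  rw [ContinuousLinearMap.comp_apply, dualToEllOne_apply, dualToEllOne_apply]
  by_cases hi : i < N
  · rw [dif_pos hi, dif_pos (hi.trans_le h), transpose_apply]
    congr 1
    ext j
    rw [ContinuousLinearMap.comp_apply, czProj_apply, czIncl_apply, dif_pos (j.2.trans_le h)]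
    simp [Pi.single_apply, Fin.ext_iff]
  · rw [dif_neg hi]
    split_ifs with hi'
    · rw [transpose_apply]
      convert map_zero φ
      ext j
      rw [ContinuousLinearMap.comp_apply, czProj_apply, czIncl_apply, dif_pos (j.2.trans_le h)]
      have : (j : ℕ) ≠ i := fun h => hi (h ▸ j.2)
      simp [Fin.ext_iff, this]
    · rfl

/-- The coordinate projection of `ℓ_1` onto the first `N` coordinates. -/
def ellOneTrunc (𝕜 : Type) [RCLike 𝕜] (N : ℕ) : EllOne 𝕜 →L[𝕜] EllOne 𝕜 :=
  (dualToEllOne 𝕜 N).comp ((transpose (czIncl 𝕜 N)).comp (ellOneToDual 𝕜))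

theorem tendsto_ellOneTrunc (a : EllOne 𝕜) :
    Tendsto (fun N => ellOneTrunc 𝕜 N a) atTop (𝓝 a) := by
  have h := (lp.hasSum_single (p := 1) (by simp) a).tendsto_sum_nat
  refine h.congr fun N => ?_
  ext i
  change _ = dualToEllOne 𝕜 N _ i
  rw [dualToEllOne_apply, lp.coeFn_sum, Finset.sum_apply]
  have h1 : ∀ j : ℕ, (lp.single 1 j (a j) : EllOne 𝕜) i = if i = j then a i else 0 := by
    intro j
    by_cases hj : i = j
    · subst hj; simp
    · rw [lp.single_apply_ne _ _ _ hj, if_neg hj]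
  simp only [h1, Finset.sum_ite_eq, Finset.mem_range]
  by_cases hi : i < N
  · rw [if_pos hi, dif_pos hi]
    change a i = ∑' j, a j * czIncl 𝕜 N (Pi.single ⟨i, hi⟩ 1) j
    rw [tsum_eq_single i]
    · simp [czIncl_apply, hi]
    · intro j hj
      rw [czIncl_apply]
      split_ifs
      · simp [hj]
      · simp
  · rw [if_neg hi, dif_neg hi]

theorem norm_ellOneToDual_le : ‖ellOneToDual 𝕜‖ ≤ 1 :=
  LinearMap.mkContinuous₂_norm_le _ zero_le_one _

end Coord

/-! ### Isometric isomorphisms with the dual of a completion -/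

/-- The bound `hB` and the lower estimate `hlow` make `z ↦ B z` isometric, so it extends to the
completion. A functional is attained if it is the pointwise limit of `B (z N)` along a Cauchy
sequence, whose limit in the completion is the preimage. -/
theorem exists_completion_isometryEquiv {𝕜 : Type} [RCLike 𝕜] {F G : Type}
    [SeminormedAddCommGroup F] [NormedSpace 𝕜 F] [SeminormedAddCommGroup G] [NormedSpace 𝕜 G]
    (B : F →ₗ[𝕜] G →ₗ[𝕜] 𝕜) (hB : ∀ z u, ‖B z u‖ ≤ ‖z‖ * ‖u‖)
    (hlow : ∀ z C, 0 ≤ C → (∀ u, ‖B z u‖ ≤ C * ‖u‖) → ‖z‖ ≤ C)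
    (hsurj : ∀ f : StrongDual 𝕜 G, ∃ z : ℕ → F, CauchySeq z ∧
      ∀ u, Tendsto (fun N => B (z N) u) atTop (𝓝 (f u))) :
    ∃ J : UniformSpace.Completion F ≃ₗᵢ[𝕜] StrongDual 𝕜 (UniformSpace.Completion G),
      ∀ (z : F) (u : G), J z u = B z u := by
  let b : F →L[𝕜] StrongDual 𝕜 G := B.mkContinuous₂ 1 fun z u => by rw [one_mul]; exact hB z u
  have hb : ∀ z u, b z u = B z u := fun _ _ => rfl
  have hext : ∀ (f g : StrongDual 𝕜 (UniformSpace.Completion G)), (∀ u : G, f u = g u) → f = g := by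
    intro f g h
    ext x
    induction x using UniformSpace.Completion.induction_on with
    | hp => exact isClosed_eq f.continuous g.continuous
    | ih u => exact h u
  let I : F →ₗᵢ[𝕜] StrongDual 𝕜 (UniformSpace.Completion G) :=
    { toFun := fun z => (b z).fromCompletion
      map_add' := fun x y => hext _ _ fun u => by
        simp [ContinuousLinearMap.fromCompletion_apply_coe]
      map_smul' := fun c x => hext _ _ fun u => by
        simp [ContinuousLinearMap.fromCompletion_apply_coe]
      norm_map' := fun z => by
        refine le_antisymm ?_ ?_
        · refine ContinuousLinearMap.opNorm_le_bound _ (norm_nonneg z) fun x => ?_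
          induction x using UniformSpace.Completion.induction_on with
          | hp =>
            exact isClosed_le (by fun_prop) (by fun_prop)
          | ih u =>
            change ‖(b z).fromCompletion u‖ ≤ _
            rw [ContinuousLinearMap.fromCompletion_apply_coe, UniformSpace.Completion.norm_coe]
            exact hB z u
        · refine hlow z _ (norm_nonneg _) fun u => ?_
          have := ((b z).fromCompletion).le_opNorm (u : UniformSpace.Completion G)
          rwa [ContinuousLinearMap.fromCompletion_apply_coe,
            UniformSpace.Completion.norm_coe] at this }
  have hI : ∀ z (u : G), I z u = B z u := fun z u =>
    ContinuousLinearMap.fromCompletion_apply_coe _ _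
  let J₀ : UniformSpace.Completion F →ₗᵢ[𝕜] StrongDual 𝕜 (UniformSpace.Completion G) :=
    { I.toContinuousLinearMap.fromCompletion with
      norm_map' := fun x => by
        change ‖I.toContinuousLinearMap.fromCompletion x‖ = ‖x‖
        induction x using UniformSpace.Completion.induction_on with
        | hp => exact isClosed_eq (by fun_prop) (by fun_prop)
        | ih z =>
          rw [ContinuousLinearMap.fromCompletion_apply_coe, UniformSpace.Completion.norm_coe]
          exact I.norm_map z }
  have hJ₀ : ∀ z : F, J₀ z = I z := fun z =>
    ContinuousLinearMap.fromCompletion_apply_coe I.toContinuousLinearMap z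
  have hs : Function.Surjective J₀ := by
    intro g
    obtain ⟨z, hz, hlim⟩ := hsurj (g.comp UniformSpace.Completion.toComplL)
    have hz' : CauchySeq fun N => (z N : UniformSpace.Completion F) :=
      hz.map (UniformSpace.Completion.uniformContinuous_coe F)
    obtain ⟨ζ, hζ⟩ := cauchySeq_tendsto_of_complete hz'
    refine ⟨ζ, hext _ _ fun u => ?_⟩
    have h1 : Tendsto (fun N => J₀ (z N : UniformSpace.Completion F)) atTop (𝓝 (J₀ ζ)) :=
      (J₀.continuous.tendsto ζ).comp hζ
    have h2 : Tendsto (fun N => J₀ (z N : UniformSpace.Completion F) (u : UniformSpace.Completion G))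
        atTop (𝓝 (J₀ ζ u)) :=
      ((ContinuousLinearMap.apply 𝕜 𝕜 (u : UniformSpace.Completion G)).continuous.tendsto _).comp h1
    refine tendsto_nhds_unique h2 ?_
    simpa [hJ₀, hI] using hlim u
  refine ⟨LinearIsometryEquiv.ofSurjective J₀ hs, fun z u => ?_⟩
  rw [LinearIsometryEquiv.coe_ofSurjective, hJ₀, hI]

/-- The Cauchy property which ensures the symmetric Radon-Nikodym property. -/
def PolyClass.CauchyProperty {𝕜 : Type} [RCLike 𝕜] (n : ℕ) (𝓠 : PolyClass 𝕜) : Prop :=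
  ∀ (P : CZero 𝕜 → 𝕜), IsHomPoly n P → ∀ C : ℝ,
    (∀ N, 𝓠.Mem (Fin N → 𝕜) (P ∘ czIncl 𝕜 N) ∧ 𝓠.norm (Fin N → 𝕜) (P ∘ czIncl 𝕜 N) ≤ C) →
    ∀ ε > 0, ∃ N₀, ∀ N ≥ N₀, ∀ N' ≥ N,
      𝓠.norm (Fin N' → 𝕜) (fun x => P (czIncl 𝕜 N' x) - P (czTrunc 𝕜 N (czIncl 𝕜 N' x))) ≤ ε

/-- Isometry holds for every `β`, by truncation to finitely many coordinates and finite dimensional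
duality. Only surjectivity needs the Cauchy property. -/
theorem STensorNorm.IsAssociated.hasSRN {𝕜 : Type} [RCLike 𝕜] {n : ℕ} {β : STensorNorm 𝕜 n}
    {𝓠 : PolyClass 𝕜} (hβ : β.IsAssociated 𝓠) (hC : 𝓠.CauchyProperty n) : β.HasSRN := by
  let B : β.Space (EllOne 𝕜) →ₗ[𝕜] β.dual.Space (CZero 𝕜) →ₗ[𝕜] 𝕜 :=
    (symPair 𝕜 n (CZero 𝕜)).comp (symMap (ellOneToDual 𝕜))
  -- Tensors in the polar of the `β`-unit ball over `(ℓ_∞^N)'` land in the `β'`-unit ball over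
  -- `c_0`. This is how information on `c_0` is turned into bounds at level `N`.
  have hunit : ∀ (N : ℕ) (u : SymTensor 𝕜 n (Fin N → 𝕜)),
      (∀ w, ‖symPair 𝕜 n (Fin N → 𝕜) w u‖ ≤ β.toSeminorm (StrongDual 𝕜 (Fin N → 𝕜)) w) →
      β.dual.toSeminorm (CZero 𝕜) (symMap (czIncl 𝕜 N) u) ≤ 1 := by
    intro N u hu
    refine (β.dual.map_le_of_norm_le_one _ (norm_czIncl_le N) u).trans ?_
    rw [β.dual_eq_dualFin]
    exact β.dualFin_le u zero_le_one fun w hw => (hu w).trans hw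
  refine exists_completion_isometryEquiv B ?_ ?_ ?_
  · intro z u
    refine (β.norm_symPair_le_dual _ u).trans ?_
    refine mul_le_mul_of_nonneg_right ?_ (apply_nonneg _ _)
    exact β.map_le_of_norm_le_one _ norm_ellOneToDual_le z
  -- The truncations of `z` factor through `(ℓ_∞^N)'`, where the bipolar theorem bounds them by `C`;
  -- they converge to `z` in the norm `β`.
  · intro (z : SymTensor 𝕜 n (EllOne 𝕜)) C hC0 hz
    have h1 : ∀ N, β.toSeminorm _ (symMap (ellOneTrunc 𝕜 N) z) ≤ C := by
      intro N
      rw [ellOneTrunc, symMap_comp]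
      refine (β.map_le_of_norm_le_one _ (norm_dualToEllOne_le N) _).trans ?_
      refine seminorm_le_of_forall_symPair _ _ fun u hu => ?_
      rw [symMap_comp, ← symPair_map]
      refine (hz (β.dual.toSpace _ (symMap (czIncl 𝕜 N) u))).trans ?_
      exact mul_le_of_le_one_right hC0 (hunit N u hu)
    have h2 := β.tendsto_symMap (R := ellOneTrunc 𝕜) tendsto_ellOneTrunc z
    have h3 : ∀ N, β.toSeminorm _ z ≤ C + β.toSeminorm _ (symMap (ellOneTrunc 𝕜 N) z - z) := by
      intro N
      have := map_sub_le_add (β.toSeminorm _) (symMap (ellOneTrunc 𝕜 N) z)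
        (symMap (ellOneTrunc 𝕜 N) z - z)
      rw [sub_sub_cancel] at this
      exact this.trans (add_le_add_left (h1 N) _)
    have h4 := le_of_tendsto_of_tendsto' tendsto_const_nhds (h2.const_add C) h3
    rw [add_zero] at h4
    exact h4
  -- The preimage of `f` is the limit of the tensors `v N` that represent the restrictions to
  -- `ℓ_∞^N`, transported into `ℓ_1`.
  · intro f
    let l : SymTensor 𝕜 n (CZero 𝕜) →ₗ[𝕜] 𝕜 := (f : β.dual.Space (CZero 𝕜) →ₗ[𝕜] 𝕜)
    have hl : ∀ u, ‖l u‖ ≤ ‖f‖ * β.dual.toSeminorm (CZero 𝕜) u := fun u => f.le_opNorm u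
    let P : CZero 𝕜 → 𝕜 := fun x => l (tpow 𝕜 n x)
    have hP : IsHomPoly n P := isHomPoly_of_linear l (norm_nonneg f) fun x =>
      (hl _).trans (mul_le_mul_of_nonneg_left (β.dual.tpow_le x) (norm_nonneg f))
    have hv : ∀ N, ∃ v : SymTensor 𝕜 n (StrongDual 𝕜 (Fin N → 𝕜)),
        ∀ u, symPair 𝕜 n _ v u = l (symMap (czIncl 𝕜 N) u) := fun N =>
      exists_symPair_eq (l.comp (symMap (czIncl 𝕜 N)))
    choose v hv using hv
    have hvP : ∀ N, polyOf (v N) = P ∘ czIncl 𝕜 N := fun N => funext fun x => by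
      rw [polyOf, hv, symMap_tpow]; rfl
    have hvn : ∀ N, β.toSeminorm _ (v N) ≤ ‖f‖ := fun N =>
      seminorm_le_of_forall_symPair _ _ fun u hu => by
        rw [hv]
        exact (hl _).trans (mul_le_of_le_one_right (norm_nonneg f) (hunit N u hu))
    refine ⟨fun N => β.toSpace _ (symMap (dualToEllOne 𝕜 N) (v N)), ?_,
      fun (u : SymTensor 𝕜 n (CZero 𝕜)) => ?_⟩
    · rw [Metric.cauchySeq_iff']
      intro ε hε
      obtain ⟨N₀, hN₀⟩ := hC P hP ‖f‖ (fun N => by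
        rw [← hvP, ((hβ.2 _).1 (v N)).2]
        exact ⟨((hβ.2 _).1 (v N)).1, hvn N⟩) (ε / 2) (by positivity)
      refine ⟨N₀, fun N hN => ?_⟩
      have h1 := hN₀ N₀ le_rfl N hN
      rw [dist_eq_norm]
      change β.toSeminorm _ (symMap (dualToEllOne 𝕜 N) (v N) -
        symMap (dualToEllOne 𝕜 N₀) (v N₀)) < ε
      -- Both tensors are now written over `(ℓ_∞^N)'`, where `β` equals the class norm and the
      -- difference represents `P` minus its truncation.
      rw [← dualToEllOne_comp_transpose hN, symMap_comp, ← map_sub]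
      refine ((β.map_le_of_norm_le_one _ (norm_dualToEllOne_le N) _).trans ?_).trans_lt
        (half_lt_self hε)
      rw [← ((hβ.2 _).1 _).2]
      refine le_of_eq_of_le (congrArg (𝓠.norm (Fin N → 𝕜)) (funext fun x => ?_)) h1
      rw [polyOf, map_sub, LinearMap.sub_apply, ← symPair_map, symMap_tpow, hv, hv, symMap_tpow,
        symMap_tpow]
      rfl
    · have h1 : ∀ N, symPair 𝕜 n _ (symMap (ellOneToDual 𝕜)
          (symMap (dualToEllOne 𝕜 N) (v N))) u = l (symMap (czTrunc 𝕜 N) u) := by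
        intro N
        rw [← symMap_comp, ellOneToDual_comp_dualToEllOne, ← symPair_map, hv, ← symMap_comp]
        rfl
      have h2 : Tendsto (fun N => l (symMap (czTrunc 𝕜 N) u)) atTop (𝓝 (l u)) := by
        rw [tendsto_iff_norm_sub_tendsto_zero]
        refine squeeze_zero (fun _ => norm_nonneg _) (fun N => ?_)
          (by
            have := (β.dual.tendsto_symMap (R := czTrunc 𝕜) tendsto_czTrunc u).const_mul ‖f‖
            rwa [mul_zero] at this)
        rw [show l (symMap (czTrunc 𝕜 N) u) - l u = l (symMap (czTrunc 𝕜 N) u - u) from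
          (LinearMap.map_sub l _ _).symm]
        exact hl _
      exact h2.congr fun N => (h1 N).symm

end SymRN

end

noncomputable section

namespace SymRN

/-! ### Normed ideals of polynomials -/

/-- A class of `n`-homogeneous polynomials is a normed ideal. -/
structure PolyClass.IsIdeal {𝕜 : Type} [RCLike 𝕜] (n : ℕ) (𝓠 : PolyClass 𝕜) : Prop where
  isHomPoly : ∀ (E : Type) [NormedAddCommGroup E] [NormedSpace 𝕜 E] (P : E → 𝕜),
    𝓠.Mem E P → IsHomPoly n P
  add : ∀ (E : Type) [NormedAddCommGroup E] [NormedSpace 𝕜 E] (P Q : E → 𝕜),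
    𝓠.Mem E P → 𝓠.Mem E Q → 𝓠.Mem E (P + Q) ∧ 𝓠.norm E (P + Q) ≤ 𝓠.norm E P + 𝓠.norm E Q
  smul : ∀ (E : Type) [NormedAddCommGroup E] [NormedSpace 𝕜 E] (c : 𝕜) (P : E → 𝕜),
    𝓠.Mem E P → 𝓠.Mem E (c • P) ∧ 𝓠.norm E (c • P) ≤ ‖c‖ * 𝓠.norm E P
  pow : ∀ (E : Type) [NormedAddCommGroup E] [NormedSpace 𝕜 E] (φ : StrongDual 𝕜 E),
    𝓠.Mem E (fun x => φ x ^ n) ∧ 𝓠.norm E (fun x => φ x ^ n) ≤ ‖φ‖ ^ n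
  bound : ∀ (E : Type) [NormedAddCommGroup E] [NormedSpace 𝕜 E] (P : E → 𝕜),
    𝓠.Mem E P → 0 ≤ 𝓠.norm E P ∧ ∀ x, ‖P x‖ ≤ 𝓠.norm E P * ‖x‖ ^ n
  comp : ∀ (E F : Type) [NormedAddCommGroup E] [NormedSpace 𝕜 E] [NormedAddCommGroup F]
    [NormedSpace 𝕜 F] (T : E →L[𝕜] F) (P : F → 𝕜),
    𝓠.Mem F P → 𝓠.Mem E (P ∘ T) ∧ 𝓠.norm E (P ∘ T) ≤ ‖T‖ ^ n * 𝓠.norm F P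

namespace PolyClass

variable {𝕜 : Type} [RCLike 𝕜] {n : ℕ} {𝓠 : PolyClass 𝕜}
variable {E : Type} [NormedAddCommGroup E] [NormedSpace 𝕜 E]
variable {F : Type} [NormedAddCommGroup F] [NormedSpace 𝕜 F]

theorem IsIdeal.mem_polyOf (h : 𝓠.IsIdeal n) (z : SymTensor 𝕜 n (StrongDual 𝕜 E)) :
    𝓠.Mem E (polyOf z) := by
  have hzero : 𝓠.Mem E (polyOf (0 : SymTensor 𝕜 n (StrongDual 𝕜 E))) := by
    have := (h.smul E 0 _ (h.pow E 0).1).1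
    convert this using 1
    funext x
    simp [polyOf]
  induction z using symTensor_induction with
  | hpow φ =>
    convert (h.pow E φ).1 using 1
    funext x
    simp [polyOf]
  | hzero => exact hzero
  | hadd a b ha hb =>
    convert (h.add E _ _ ha hb).1 using 1
    funext x
    simp [polyOf]
  | hsmul c a ha =>
    convert (h.smul E c _ ha).1 using 1
    funext x
    simp [polyOf]

/-- The norm on `⊗^{n,s} E` in duality with the polynomials of the class on `E`. -/
def predualFun (n : ℕ) (𝓠 : PolyClass 𝕜) (E : Type) [NormedAddCommGroup E] [NormedSpace 𝕜 E]
    (u : SymTensor 𝕜 n E) : ℝ :=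
  sSup {t : ℝ | ∃ l : SymTensor 𝕜 n E →ₗ[𝕜] 𝕜, 𝓠.Mem E (fun x => l (tpow 𝕜 n x)) ∧
    𝓠.norm E (fun x => l (tpow 𝕜 n x)) ≤ 1 ∧ t = ‖l u‖}

theorem norm_linear_le {m : ℕ} (c : Fin m → 𝕜) (x : Fin m → E) (l : SymTensor 𝕜 n E →ₗ[𝕜] 𝕜)
    (hl : ∀ x, ‖l (tpow 𝕜 n x)‖ ≤ ‖x‖ ^ n) :
    ‖l (∑ i, c i • tpow 𝕜 n (x i))‖ ≤ ∑ i, ‖c i‖ * ‖x i‖ ^ n := by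
  rw [map_sum]
  refine (norm_sum_le _ _).trans (Finset.sum_le_sum fun i _ => ?_)
  rw [map_smul, norm_smul]
  exact mul_le_mul_of_nonneg_left (hl _) (norm_nonneg _)

theorem IsIdeal.norm_tpow_le (h : 𝓠.IsIdeal n) {l : SymTensor 𝕜 n E →ₗ[𝕜] 𝕜}
    (hl : 𝓠.Mem E fun x => l (tpow 𝕜 n x)) (hl1 : 𝓠.norm E (fun x => l (tpow 𝕜 n x)) ≤ 1) (x : E) :
    ‖l (tpow 𝕜 n x)‖ ≤ ‖x‖ ^ n :=
  ((h.bound E _ hl).2 x).trans (mul_le_of_le_one_left (by positivity) hl1)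

theorem IsIdeal.le_predualFun (h : 𝓠.IsIdeal n) {l : SymTensor 𝕜 n E →ₗ[𝕜] 𝕜}
    (hl : 𝓠.Mem E fun x => l (tpow 𝕜 n x)) (hl1 : 𝓠.norm E (fun x => l (tpow 𝕜 n x)) ≤ 1)
    (u : SymTensor 𝕜 n E) : ‖l u‖ ≤ predualFun n 𝓠 E u := by
  refine le_csSup ?_ ⟨l, hl, hl1, rfl⟩
  obtain ⟨m, c, x, rfl⟩ := exists_rep u
  refine ⟨∑ i, ‖c i‖ * ‖x i‖ ^ n, ?_⟩
  rintro _ ⟨l, hl, hl1, rfl⟩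
  exact norm_linear_le c x l (h.norm_tpow_le hl hl1)

theorem predualFun_le (u : SymTensor 𝕜 n E) {C : ℝ} (hC : 0 ≤ C)
    (h : ∀ l : SymTensor 𝕜 n E →ₗ[𝕜] 𝕜, 𝓠.Mem E (fun x => l (tpow 𝕜 n x)) →
      𝓠.norm E (fun x => l (tpow 𝕜 n x)) ≤ 1 → ‖l u‖ ≤ C) : predualFun n 𝓠 E u ≤ C := by
  refine Real.sSup_le ?_ hC
  rintro _ ⟨l, hl, hl1, rfl⟩
  exact h l hl hl1

theorem predualFun_nonneg (u : SymTensor 𝕜 n E) : 0 ≤ predualFun n 𝓠 E u := by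
  apply Real.sSup_nonneg
  rintro _ ⟨l, -, -, rfl⟩
  positivity

theorem IsIdeal.norm_linear_le_mul (h : 𝓠.IsIdeal n) {l : SymTensor 𝕜 n E →ₗ[𝕜] 𝕜}
    (hl : 𝓠.Mem E fun x => l (tpow 𝕜 n x)) {C : ℝ}
    (hC : 𝓠.norm E (fun x => l (tpow 𝕜 n x)) ≤ C) (u : SymTensor 𝕜 n E) :
    ‖l u‖ ≤ C * predualFun n 𝓠 E u := by
  have hC0 : 0 ≤ C := (h.bound E _ hl).1.trans hC
  -- Normalizing by `C + η` and letting `η` tend to `0` covers the case `C = 0`.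
  have hlim : Filter.Tendsto (fun η : ℝ => (C + η) * predualFun n 𝓠 E u)
      (nhdsWithin 0 (Set.Ioi 0)) (nhds (C * predualFun n 𝓠 E u)) := by
    have : Continuous fun η : ℝ => (C + η) * predualFun n 𝓠 E u := by fun_prop
    have h2 := (this.tendsto 0).mono_left (nhdsWithin_le_nhds (s := Set.Ioi 0))
    simpa using h2
  refine ge_of_tendsto hlim ?_
  filter_upwards [self_mem_nhdsWithin] with η hη
  have hpos : 0 < C + η := add_pos_of_nonneg_of_pos hC0 hη
  have hnorm : ‖((C + η : ℝ) : 𝕜)⁻¹‖ = (C + η)⁻¹ := by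
    rw [norm_inv, RCLike.norm_ofReal, abs_of_pos hpos]
  obtain ⟨h1, h2⟩ := h.smul E ((C + η : ℝ) : 𝕜)⁻¹ _ hl
  have h3 := h.le_predualFun (l := ((C + η : ℝ) : 𝕜)⁻¹ • l) h1 (h2.trans (by
    rw [hnorm, inv_mul_le_iff₀ hpos, mul_one]
    exact hC.trans (le_add_of_nonneg_right (le_of_lt hη)))) u
  rw [LinearMap.smul_apply, norm_smul, hnorm, inv_mul_le_iff₀ hpos] at h3
  exact h3

/-- The s-tensor norm in duality with a normed ideal of polynomials. -/
def IsIdeal.predual (h : 𝓠.IsIdeal n) : STensorNorm 𝕜 n where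
  toSeminorm E _ _ _ := Seminorm.ofSMulLE (predualFun n 𝓠 E)
    (le_antisymm (predualFun_le _ le_rfl fun l _ _ => by simp) (predualFun_nonneg _))
    (fun x y => predualFun_le _ (add_nonneg (predualFun_nonneg _) (predualFun_nonneg _))
      fun l hl hl1 => by
        rw [map_add]
        exact (norm_add_le _ _).trans
          (add_le_add (h.le_predualFun hl hl1 x) (h.le_predualFun hl hl1 y)))
    (fun c x => predualFun_le _ (mul_nonneg (norm_nonneg _) (predualFun_nonneg _))
      fun l hl hl1 => by
        rw [map_smul, norm_smul]
        exact mul_le_mul_of_nonneg_left (h.le_predualFun hl hl1 x) (norm_nonneg _))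
  epsS_le E _ _ _ z := by
    change epsS z ≤ predualFun n 𝓠 E z
    refine Real.iSup_le ?_ (predualFun_nonneg z)
    rintro ⟨φ, hφ⟩
    have h1 : ‖φ‖ ≤ 1 := by simpa using hφ
    have h2 := h.pow E φ
    simp only [← symPair_tpow] at h2
    exact h.le_predualFun h2.1 (h2.2.trans (pow_le_one₀ (norm_nonneg _) h1)) z
  le_piS E _ _ _ z := by
    change predualFun n 𝓠 E z ≤ piS z
    refine le_csInf ?_ ?_
    · obtain ⟨m, c, x, h⟩ := exists_rep z
      exact ⟨_, m, c, x, h, rfl⟩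
    · rintro _ ⟨m, c, x, rfl, rfl⟩
      exact predualFun_le _ (by positivity) fun l hl hl1 =>
        norm_linear_le c x l (h.norm_tpow_le hl hl1)
  map_le E F _ _ _ _ _ _ T z := by
    change predualFun n 𝓠 F (symMap T z) ≤ ‖T‖ ^ n * predualFun n 𝓠 E z
    refine predualFun_le _ (mul_nonneg (by positivity) (predualFun_nonneg z)) fun l hl hl1 => ?_
    obtain ⟨h1, h2⟩ := h.comp E F T _ hl
    have h3 : (fun x => l (tpow 𝕜 n x)) ∘ T = fun x => (l.comp (symMap T)) (tpow 𝕜 n x) := by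
      funext x
      simp
    rw [h3] at h1 h2
    refine h.norm_linear_le_mul h1 (h2.trans ?_) z
    exact mul_le_of_le_one_right (by positivity) hl1

/-- Every normed ideal of polynomials has an associated s-tensor norm. -/
theorem IsIdeal.exists_isAssociated (h : 𝓠.IsIdeal n) :
    ∃ β : STensorNorm 𝕜 n, β.IsAssociated 𝓠 := by
  -- The associated norm is the dual of the norm in duality with the class: on finite dimensional
  -- spaces, taking the polar twice returns the class norm.
  refine ⟨h.predual.dual, h.predual.dual_finitelyGenerated, fun M _ _ _ =>
    ⟨fun z => ⟨h.mem_polyOf z, ?_⟩, fun P hP => (h.isHomPoly M P hP).exists_polyOf⟩⟩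
  have : FiniteDimensional 𝕜 (StrongDual 𝕜 M) := inferInstance
  have : CompleteSpace M := FiniteDimensional.complete 𝕜 M
  rw [h.predual.dual_eq_dualFin]
  have hpred : ∀ u : SymTensor 𝕜 n M, h.predual.toSeminorm M u = predualFun n 𝓠 M u := fun _ => rfl
  refine le_antisymm ?_ ?_
  · let N : Seminorm 𝕜 (SymTensor 𝕜 n (StrongDual 𝕜 M)) :=
      Seminorm.ofSMulLE (fun z => 𝓠.norm M (polyOf z))
        (by
          have h1 := (h.smul M 0 _ (h.mem_polyOf (E := M) (0 : SymTensor 𝕜 n _))).2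
          have h2 : (0 : 𝕜) • polyOf (E := M) (0 : SymTensor 𝕜 n (StrongDual 𝕜 M)) =
            polyOf (0 : SymTensor 𝕜 n _) := by funext x; simp [polyOf]
          rw [h2, norm_zero, zero_mul] at h1
          exact le_antisymm h1 (h.bound M _ (h.mem_polyOf _)).1)
        (fun x y => by
          have h2 : polyOf (x + y) = polyOf x + polyOf y := by funext v; simp [polyOf]
          change 𝓠.norm M (polyOf (x + y)) ≤ _
          rw [h2]
          exact (h.add M _ _ (h.mem_polyOf x) (h.mem_polyOf y)).2)
        (fun c x => by
          have h2 : polyOf (c • x) = c • polyOf x := by funext v; simp [polyOf]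
          change 𝓠.norm M (polyOf (c • x)) ≤ _
          rw [h2]
          exact (h.smul M c _ (h.mem_polyOf x)).2)
    have hN : ∀ z, N z = 𝓠.norm M (polyOf z) := fun _ => rfl
    rw [← hN]
    -- The bipolar theorem for the class norm: a tensor `u` in the polar of `N` has predual norm at
    -- most one, so it is admissible in the definition of the dual norm.
    refine seminorm_le_of_forall_symPair N z fun u hu => ?_
    refine (h.predual.norm_symPair_le_dualFin_strongDual z u).trans ?_
    refine mul_le_of_le_one_left (h.predual.dualFin_nonneg z) ?_
    rw [hpred]
    refine predualFun_le u zero_le_one fun l hl hl1 => ?_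
    obtain ⟨z', hz'⟩ := exists_symPair_eq l
    have h3 : polyOf z' = fun x => l (tpow 𝕜 n x) := funext fun x => hz' _
    rw [← hz']
    refine (hu z').trans ?_
    rwa [hN, h3]
  · refine h.predual.dualFin_strongDual_le z (h.bound M _ (h.mem_polyOf z)).1 fun u hu => ?_
    rw [hpred] at hu
    refine (h.norm_linear_le_mul (l := symPair 𝕜 n M z) (h.mem_polyOf z) le_rfl u).trans ?_
    exact mul_le_of_le_one_right (h.bound M _ (h.mem_polyOf z)).1 hu

end PolyClass

end SymRN

end

noncomputable section

namespace SymRN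

open MeasureTheory

/-! ### Direct sums of `L_r` spaces -/

section LpSum

variable {𝕜 : Type} [RCLike 𝕜] {r : ℝ≥0∞} [Fact (1 ≤ r)]
variable {Ω Ω' : Type} [MeasurableSpace Ω] [MeasurableSpace Ω']

/-- The direct sum of two measures. -/
def sumMeasure (μ : Measure Ω) (ν : Measure Ω') : Measure (Ω ⊕ Ω') :=
  μ.map Sum.inl + ν.map Sum.inr

theorem measurableEmbedding_inl : MeasurableEmbedding (Sum.inl : Ω → Ω ⊕ Ω') :=
  ⟨Sum.inl_injective, measurable_inl, fun _ hs => measurableSet_inl_image.2 hs⟩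

theorem measurableEmbedding_inr : MeasurableEmbedding (Sum.inr : Ω' → Ω ⊕ Ω') :=
  ⟨Sum.inr_injective, measurable_inr, fun _ hs => measurableSet_inr_image.2 hs⟩

theorem memLp_comp_of_map_le {μ : Measure Ω} {μ' : Measure Ω'} {e : Ω → Ω'} (he : Measurable e)
    (h : μ.map e ≤ μ') (F : Lp 𝕜 r μ') : MemLp (F ∘ e) r μ :=
  MemLp.comp_of_map ((Lp.memLp F).mono_measure h) he.aemeasurable

/-- The pullback of `L_r` functions along a measurable map that does not increase measures. -/
def lpPull (𝕜 : Type) [RCLike 𝕜] (r : ℝ≥0∞) [Fact (1 ≤ r)] {μ : Measure Ω} {μ' : Measure Ω'}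
    (e : Ω → Ω') (he : Measurable e) (h : μ.map e ≤ μ') : Lp 𝕜 r μ' →L[𝕜] Lp 𝕜 r μ :=
  LinearMap.mkContinuous
    { toFun := fun F => (memLp_comp_of_map_le he h F).toLp _
      map_add' := fun F G => by
        have hq : Measure.QuasiMeasurePreserving e μ μ' :=
          ⟨he, Measure.absolutelyContinuous_of_le h⟩
        rw [← MemLp.toLp_add]
        exact MemLp.toLp_congr _ _ (hq.ae_eq (Lp.coeFn_add F G))
      map_smul' := fun c F => by
        have hq : Measure.QuasiMeasurePreserving e μ μ' :=
          ⟨he, Measure.absolutelyContinuous_of_le h⟩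
        rw [RingHom.id_apply, ← MemLp.toLp_const_smul]
        exact MemLp.toLp_congr _ _ (hq.ae_eq (Lp.coeFn_smul c F)) }
    1 fun F => by
      rw [one_mul]
      change ‖(memLp_comp_of_map_le he h F).toLp _‖ ≤ _
      rw [Lp.norm_toLp, Lp.norm_def]
      refine ENNReal.toReal_mono (Lp.eLpNorm_ne_top F) ?_
      rw [← eLpNorm_map_measure ((Lp.aestronglyMeasurable F).mono_measure h) he.aemeasurable]
      exact eLpNorm_mono_measure _ h

theorem norm_lpPull_le {μ : Measure Ω} {μ' : Measure Ω'} (e : Ω → Ω') (he : Measurable e)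
    (h : μ.map e ≤ μ') : ‖lpPull 𝕜 r e he h‖ ≤ 1 :=
  LinearMap.mkContinuous_norm_le _ zero_le_one _

theorem lpPull_coe {μ : Measure Ω} {μ' : Measure Ω'} (e : Ω → Ω') (he : Measurable e)
    (h : μ.map e ≤ μ') (F : Lp 𝕜 r μ') : lpPull 𝕜 r e he h F =ᵐ[μ] F ∘ e :=
  MemLp.coeFn_toLp (memLp_comp_of_map_le he h F)

theorem ofReal_norm_rpow (hr : r ≠ ∞) {μ : Measure Ω} (f : Lp 𝕜 r μ) :
    ENNReal.ofReal (‖f‖ ^ r.toReal) = ∫⁻ ω, ‖f ω‖ₑ ^ r.toReal ∂μ := by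
  have h1 : (1 : ℝ≥0∞) ≤ r := Fact.out
  have h0 : r ≠ 0 := (zero_lt_one.trans_le h1).ne'
  have hpos : 0 < r.toReal := ENNReal.toReal_pos h0 hr
  rw [← ENNReal.ofReal_rpow_of_nonneg (norm_nonneg _) hpos.le, ofReal_norm, Lp.enorm_def,
    eLpNorm_eq_lintegral_rpow_enorm_toReal h0 hr, ← ENNReal.rpow_mul, one_div,
    inv_mul_cancel₀ hpos.ne', ENNReal.rpow_one]

variable (μ : Measure Ω) (ν : Measure Ω')

/-- The restriction to the first summand. -/
def lpLeft (𝕜 : Type) [RCLike 𝕜] (r : ℝ≥0∞) [Fact (1 ≤ r)] :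
    Lp 𝕜 r (sumMeasure μ ν) →L[𝕜] Lp 𝕜 r μ :=
  lpPull 𝕜 r Sum.inl measurable_inl (Measure.le_add_right le_rfl)

/-- The restriction to the second summand. -/
def lpRight (𝕜 : Type) [RCLike 𝕜] (r : ℝ≥0∞) [Fact (1 ≤ r)] :
    Lp 𝕜 r (sumMeasure μ ν) →L[𝕜] Lp 𝕜 r ν :=
  lpPull 𝕜 r Sum.inr measurable_inr (Measure.le_add_left le_rfl)

theorem lpSum_norm_rpow (hr : r ≠ ∞) (F : Lp 𝕜 r (sumMeasure μ ν)) :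
    ‖F‖ ^ r.toReal = ‖lpLeft μ ν 𝕜 r F‖ ^ r.toReal + ‖lpRight μ ν 𝕜 r F‖ ^ r.toReal := by
  have h : ENNReal.ofReal (‖F‖ ^ r.toReal) =
      ENNReal.ofReal (‖lpLeft μ ν 𝕜 r F‖ ^ r.toReal + ‖lpRight μ ν 𝕜 r F‖ ^ r.toReal) := by
    rw [ENNReal.ofReal_add (by positivity) (by positivity), ofReal_norm_rpow hr,
      ofReal_norm_rpow hr, ofReal_norm_rpow hr]
    have hsum : ∀ G : Ω ⊕ Ω' → ℝ≥0∞, ∫⁻ ω, G ω ∂(sumMeasure μ ν) =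
        ∫⁻ ω, G (Sum.inl ω) ∂μ + ∫⁻ ω, G (Sum.inr ω) ∂ν := fun G => by
      rw [sumMeasure, lintegral_add_measure, measurableEmbedding_inl.lintegral_map,
        measurableEmbedding_inr.lintegral_map]
    rw [hsum]
    congr 1
    · refine lintegral_congr_ae ?_
      filter_upwards [lpPull_coe (μ := μ) (μ' := sumMeasure μ ν) Sum.inl measurable_inl
        (Measure.le_add_right le_rfl) F] with ω hω
      rw [lpLeft, hω]; rfl
    · refine lintegral_congr_ae ?_
      filter_upwards [lpPull_coe (μ := ν) (μ' := sumMeasure μ ν) Sum.inr measurable_inr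
        (Measure.le_add_left le_rfl) F] with ω hω
      rw [lpRight, hω]; rfl
  exact (ENNReal.ofReal_eq_ofReal_iff (by positivity) (by positivity)).1 h

theorem lp_top_norm_le_iff {μ : Measure Ω} (F : Lp 𝕜 ∞ μ) {C : ℝ} (hC : 0 ≤ C) :
    ‖F‖ ≤ C ↔ ∀ᵐ ω ∂μ, ‖F ω‖ ≤ C := by
  constructor
  · intro h
    filter_upwards [ae_le_eLpNormEssSup (f := F) (μ := μ)] with ω hω
    rw [← eLpNorm_exponent_top, ← Lp.enorm_def, enorm_le_iff_norm_le] at hω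
    exact hω.trans h
  · intro h
    rw [Lp.norm_def]
    exact ENNReal.toReal_le_of_le_ofReal hC (eLpNormEssSup_le_of_ae_bound h)

theorem ae_sumMeasure_iff {p : Ω ⊕ Ω' → Prop} : (∀ᵐ ω ∂(sumMeasure μ ν), p ω) ↔
    (∀ᵐ ω ∂μ, p (Sum.inl ω)) ∧ ∀ᵐ ω ∂ν, p (Sum.inr ω) := by
  rw [sumMeasure, ae_add_measure_iff, measurableEmbedding_inl.ae_map_iff,
    measurableEmbedding_inr.ae_map_iff]

theorem lpLeft_coe (F : Lp 𝕜 r (sumMeasure μ ν)) : lpLeft μ ν 𝕜 r F =ᵐ[μ] F ∘ Sum.inl :=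
  lpPull_coe _ _ _ F

theorem lpRight_coe (F : Lp 𝕜 r (sumMeasure μ ν)) : lpRight μ ν 𝕜 r F =ᵐ[ν] F ∘ Sum.inr :=
  lpPull_coe _ _ _ F

theorem lpSum_norm_le_top (F : Lp 𝕜 ∞ (sumMeasure μ ν)) {C : ℝ} (hl : ‖lpLeft μ ν 𝕜 ∞ F‖ ≤ C)
    (hr : ‖lpRight μ ν 𝕜 ∞ F‖ ≤ C) : ‖F‖ ≤ C := by
  have hC : 0 ≤ C := (norm_nonneg _).trans hl
  rw [lp_top_norm_le_iff _ hC] at hl hr ⊢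
  rw [ae_sumMeasure_iff]
  constructor
  · filter_upwards [hl, lpLeft_coe μ ν F] with ω h1 h2
    rwa [h2] at h1
  · filter_upwards [hr, lpRight_coe μ ν F] with ω h1 h2
    rwa [h2] at h1

theorem exists_lpSum (f : Lp 𝕜 r μ) (g : Lp 𝕜 r ν) :
    ∃ F : Lp 𝕜 r (sumMeasure μ ν), lpLeft μ ν 𝕜 r F = f ∧ lpRight μ ν 𝕜 r F = g := by
  have hm : StronglyMeasurable (Sum.elim f g : Ω ⊕ Ω' → 𝕜) :=
    ((Lp.stronglyMeasurable f).measurable.sumElim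
      (Lp.stronglyMeasurable g).measurable).stronglyMeasurable
  have hmem : MemLp (Sum.elim f g : Ω ⊕ Ω' → 𝕜) r (sumMeasure μ ν) := by
    refine ⟨hm.aestronglyMeasurable, ?_⟩
    have hl : eLpNorm (Sum.elim f g : Ω ⊕ Ω' → 𝕜) r (μ.map Sum.inl) < ∞ := by
      rw [eLpNorm_map_measure hm.aestronglyMeasurable measurable_inl.aemeasurable]
      exact Lp.eLpNorm_lt_top f
    have hr : eLpNorm (Sum.elim f g : Ω ⊕ Ω' → 𝕜) r (ν.map Sum.inr) < ∞ := by
      rw [eLpNorm_map_measure hm.aestronglyMeasurable measurable_inr.aemeasurable]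
      exact Lp.eLpNorm_lt_top g
    have h1 : (1 : ℝ≥0∞) ≤ r := Fact.out
    have h0 : r ≠ 0 := (zero_lt_one.trans_le h1).ne'
    by_cases htop : r = ∞
    · subst htop
      rw [eLpNorm_exponent_top] at hl hr ⊢
      refine (eLpNormEssSup_le_of_ae_enorm_bound
        (C := max (eLpNormEssSup (Sum.elim f g : Ω ⊕ Ω' → 𝕜) (μ.map Sum.inl))
          (eLpNormEssSup (Sum.elim f g : Ω ⊕ Ω' → 𝕜) (ν.map Sum.inr))) ?_).trans_lt (max_lt hl hr)
      refine ae_add_measure_iff.2 ⟨?_, ?_⟩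
      · filter_upwards [enorm_ae_le_eLpNormEssSup (Sum.elim f g : Ω ⊕ Ω' → 𝕜) (μ.map Sum.inl)]
          with ω hω using hω.trans (le_max_left _ _)
      · filter_upwards [enorm_ae_le_eLpNormEssSup (Sum.elim f g : Ω ⊕ Ω' → 𝕜) (ν.map Sum.inr)]
          with ω hω using hω.trans (le_max_right _ _)
    · rw [eLpNorm_lt_top_iff_lintegral_rpow_enorm_lt_top h0 htop] at hl hr ⊢
      rw [sumMeasure, lintegral_add_measure]
      exact ENNReal.add_lt_top.2 ⟨hl, hr⟩
  have hF := (ae_sumMeasure_iff μ ν).1 hmem.coeFn_toLp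
  refine ⟨hmem.toLp _, Lp.ext ?_, Lp.ext ?_⟩
  · filter_upwards [lpLeft_coe μ ν (hmem.toLp _), hF.1] with ω h1 h2
    rw [h1, Function.comp_apply, h2, Sum.elim_inl]
  · filter_upwards [lpRight_coe μ ν (hmem.toLp _), hF.2] with ω h1 h2
    rw [h1, Function.comp_apply, h2, Sum.elim_inr]

theorem lpSum_eq_zero (F : Lp 𝕜 r (sumMeasure μ ν)) (hl : lpLeft μ ν 𝕜 r F = 0)
    (hr : lpRight μ ν 𝕜 r F = 0) : F = 0 := by
  refine Lp.ext ?_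
  have h1 := Lp.ext_iff.1 hl
  have h2 := Lp.ext_iff.1 hr
  have h3 : ∀ᵐ ω ∂(sumMeasure μ ν), F ω = 0 := by
    rw [ae_sumMeasure_iff]
    constructor
    · filter_upwards [h1, lpLeft_coe μ ν F, Lp.coeFn_zero 𝕜 r μ] with ω h1 h2 h3
      rwa [h1, h3, eq_comm] at h2
    · filter_upwards [h2, lpRight_coe μ ν F, Lp.coeFn_zero 𝕜 r ν] with ω h1 h2 h3
      rwa [h1, h3, eq_comm] at h2
  filter_upwards [h3, Lp.coeFn_zero 𝕜 r (sumMeasure μ ν)] with ω h4 h5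
  rw [h4, h5]; rfl

/-- The identification of `L_r` of the sum with the product of the `L_r` spaces. -/
def lpSumEquiv (𝕜 : Type) [RCLike 𝕜] (r : ℝ≥0∞) [Fact (1 ≤ r)] :
    Lp 𝕜 r (sumMeasure μ ν) ≃L[𝕜] Lp 𝕜 r μ × Lp 𝕜 r ν :=
  ContinuousLinearEquiv.ofBijective ((lpLeft μ ν 𝕜 r).prod (lpRight μ ν 𝕜 r))
    (LinearMap.ker_eq_bot'.2 fun F hF =>
      lpSum_eq_zero μ ν F (congrArg Prod.fst hF) (congrArg Prod.snd hF))
    (LinearMap.range_eq_top.2 fun fg => by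
      obtain ⟨F, h1, h2⟩ := exists_lpSum μ ν fg.1 fg.2
      exact ⟨F, Prod.ext h1 h2⟩)

variable {E : Type} [NormedAddCommGroup E] [NormedSpace 𝕜 E]

/-- The operator with components `S` and `T`. -/
def lpPair {μ : Measure Ω} {ν : Measure Ω'} (S : E →L[𝕜] Lp 𝕜 r μ) (T : E →L[𝕜] Lp 𝕜 r ν) :
    E →L[𝕜] Lp 𝕜 r (sumMeasure μ ν) :=
  (lpSumEquiv μ ν 𝕜 r).symm.toContinuousLinearMap.comp (S.prod T)

variable {μ ν}

theorem lpLeft_lpPair (S : E →L[𝕜] Lp 𝕜 r μ) (T : E →L[𝕜] Lp 𝕜 r ν) (x : E) :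
    lpLeft μ ν 𝕜 r (lpPair S T x) = S x :=
  congrArg Prod.fst ((lpSumEquiv μ ν 𝕜 r).apply_symm_apply (S x, T x))

theorem lpRight_lpPair (S : E →L[𝕜] Lp 𝕜 r μ) (T : E →L[𝕜] Lp 𝕜 r ν) (x : E) :
    lpRight μ ν 𝕜 r (lpPair S T x) = T x :=
  congrArg Prod.snd ((lpSumEquiv μ ν 𝕜 r).apply_symm_apply (S x, T x))

theorem norm_lpPair_le (hr : r ≠ ∞) (S : E →L[𝕜] Lp 𝕜 r μ) (T : E →L[𝕜] Lp 𝕜 r ν)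
    {a b c : ℝ} (ha : ‖S‖ ≤ a) (hb : ‖T‖ ≤ b) (hc : 0 ≤ c)
    (h : a ^ r.toReal + b ^ r.toReal ≤ c ^ r.toReal) : ‖lpPair S T‖ ≤ c := by
  have h1 : (1 : ℝ≥0∞) ≤ r := Fact.out
  have hpos : 0 < r.toReal := ENNReal.toReal_pos (zero_lt_one.trans_le h1).ne' hr
  refine ContinuousLinearMap.opNorm_le_bound _ hc fun x => ?_
  rw [← Real.rpow_le_rpow_iff (norm_nonneg _) (by positivity) hpos, lpSum_norm_rpow _ _ hr,
    lpLeft_lpPair, lpRight_lpPair, Real.mul_rpow hc (norm_nonneg _)]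
  have hS : ‖S x‖ ^ r.toReal ≤ a ^ r.toReal * ‖x‖ ^ r.toReal := by
    rw [← Real.mul_rpow ((norm_nonneg _).trans ha) (norm_nonneg _)]
    exact Real.rpow_le_rpow (norm_nonneg _) ((S.le_opNorm x).trans (by gcongr)) hpos.le
  have hT : ‖T x‖ ^ r.toReal ≤ b ^ r.toReal * ‖x‖ ^ r.toReal := by
    rw [← Real.mul_rpow ((norm_nonneg _).trans hb) (norm_nonneg _)]
    exact Real.rpow_le_rpow (norm_nonneg _) ((T.le_opNorm x).trans (by gcongr)) hpos.le
  have h2 : 0 ≤ ‖x‖ ^ r.toReal := by positivity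
  nlinarith

theorem norm_lpPair_le_top {μ : Measure Ω} {ν : Measure Ω'} (S : E →L[𝕜] Lp 𝕜 ∞ μ)
    (T : E →L[𝕜] Lp 𝕜 ∞ ν) {c : ℝ} (hS : ‖S‖ ≤ c) (hT : ‖T‖ ≤ c) : ‖lpPair S T‖ ≤ c := by
  refine ContinuousLinearMap.opNorm_le_bound _ ((norm_nonneg _).trans hS) fun x => ?_
  refine lpSum_norm_le_top _ _ _ ?_ ?_
  · rw [lpLeft_lpPair]
    exact (S.le_opNorm x).trans (by gcongr)
  · rw [lpRight_lpPair]
    exact (T.le_opNorm x).trans (by gcongr)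

theorem norm_lpLeft_le (F : Lp 𝕜 r (sumMeasure μ ν)) : ‖lpLeft μ ν 𝕜 r F‖ ≤ ‖F‖ := by
  refine ((lpLeft μ ν 𝕜 r).le_opNorm F).trans (mul_le_of_le_one_left (norm_nonneg _) ?_)
  exact norm_lpPull_le _ _ _

theorem norm_lpRight_le (F : Lp 𝕜 r (sumMeasure μ ν)) : ‖lpRight μ ν 𝕜 r F‖ ≤ ‖F‖ := by
  refine ((lpRight μ ν 𝕜 r).le_opNorm F).trans (mul_le_of_le_one_left (norm_nonneg _) ?_)
  exact norm_lpPull_le _ _ _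

end LpSum

end SymRN

end

noncomputable section

namespace SymRN

open MeasureTheory

/-! ### Hölder's inequality for positive forms -/

section Positive

/-- Divide column `i` by its `ρ`-mean. The weighted arithmetic-geometric mean inequality, used
twice, bounds a product of entries `y_i` by the average of `(n/ρ) y_i^ρ + (1 - n/ρ)`. Summing over
the shifts `s` runs through each whole column, whose normalized mean is one. -/
theorem sum_cyclic_prod_le {n : ℕ} [NeZero n] {ρ : ℝ} (hρ : (n : ℝ) ≤ ρ) (B : Fin n → Fin n → ℝ)
    (hB : ∀ j i, 0 ≤ B j i) :
    ∑ s, ∏ i, B (i + s) i ≤ n * ∏ i, ((1 / n : ℝ) * ∑ j, B j i ^ ρ) ^ (1 / ρ) := by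
  have hn : 0 < (n : ℝ) := Nat.cast_pos.2 (Nat.pos_of_ne_zero (NeZero.ne n))
  have hρ0 : 0 < ρ := hn.trans_le hρ
  set h : Fin n → ℝ := fun i => ((1 / n : ℝ) * ∑ j, B j i ^ ρ) ^ (1 / ρ) with hh
  have hS : ∀ i, 0 ≤ (1 / n : ℝ) * ∑ j, B j i ^ ρ := fun i =>
    mul_nonneg (by positivity) (Finset.sum_nonneg fun j _ => Real.rpow_nonneg (hB j i) _)
  have hh0 : ∀ i, 0 ≤ h i := fun i => Real.rpow_nonneg (hS i) _
  have hhρ : ∀ i, h i ^ ρ = (1 / n : ℝ) * ∑ j, B j i ^ ρ := fun i => by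
    rw [hh]
    dsimp only
    rw [← Real.rpow_mul (hS i), one_div_mul_cancel hρ0.ne', Real.rpow_one]
  -- A column with mean zero cannot be normalized, but it vanishes identically and kills every
  -- product.
  by_cases hz : ∃ i, h i = 0
  · obtain ⟨i, hi⟩ := hz
    have h1 : ∀ j, B j i = 0 := by
      have h2 := hhρ i
      rw [hi, Real.zero_rpow hρ0.ne', eq_comm, mul_eq_zero_iff_left (by positivity),
        Finset.sum_eq_zero_iff_of_nonneg fun j _ => Real.rpow_nonneg (hB j i) _] at h2
      intro j
      exact (Real.rpow_eq_zero (hB j i) hρ0.ne').1 (h2 j (Finset.mem_univ j))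
    have h3 : ∑ s, ∏ i, B (i + s) i = 0 :=
      Finset.sum_eq_zero fun s _ => Finset.prod_eq_zero (Finset.mem_univ i) (h1 _)
    rw [h3]
    exact mul_nonneg hn.le (Finset.prod_nonneg fun i _ => hh0 i)
  · push Not at hz
    have hpos : ∀ i, 0 < h i := fun i => (hh0 i).lt_of_ne (hz i).symm
    have hprod : 0 < ∏ i, h i := Finset.prod_pos fun i _ => hpos i
    rw [← div_le_iff₀ hprod, Finset.sum_div]
    have h1 : ∀ s : Fin n, (∏ i, B (i + s) i) / ∏ i, h i ≤
        ∑ i, (1 / n : ℝ) * ((n / ρ) * (B (i + s) i / h i) ^ ρ + (1 - n / ρ)) := by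
      intro s
      rw [← Finset.prod_div_distrib]
      have hy : ∀ i, 0 ≤ B (i + s) i / h i := fun i => div_nonneg (hB _ _) (hh0 i)
      have h2 := Real.geom_mean_le_arith_mean_weighted Finset.univ (fun _ : Fin n => (1 / n : ℝ))
        (fun i => (B (i + s) i / h i) ^ (n : ℝ)) (fun _ _ => by positivity)
        (by simp [hn.ne']) (fun i _ => Real.rpow_nonneg (hy i) _)
      have h3 : ∀ i, ((B (i + s) i / h i) ^ (n : ℝ)) ^ (1 / n : ℝ) = B (i + s) i / h i := fun i => by
        rw [← Real.rpow_mul (hy i), mul_one_div_cancel hn.ne', Real.rpow_one]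
      simp only [h3] at h2
      refine h2.trans (Finset.sum_le_sum fun i _ => mul_le_mul_of_nonneg_left ?_ (by positivity))
      -- This replaces the exponent `n` by `ρ`; the second weight `1 - n/ρ` is nonnegative because
      -- `n ≤ ρ`.
      have h4 := Real.geom_mean_le_arith_mean2_weighted (w₁ := n / ρ) (w₂ := 1 - n / ρ)
        (p₁ := (B (i + s) i / h i) ^ ρ) (p₂ := 1) (by positivity)
        (sub_nonneg.2 ((div_le_one hρ0).2 hρ)) (Real.rpow_nonneg (hy i) _) zero_le_one (by ring)
      rwa [Real.one_rpow, mul_one, mul_one, ← Real.rpow_mul (hy i), mul_div_cancel₀ _ hρ0.ne'] at h4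
    refine (Finset.sum_le_sum fun s _ => h1 s).trans (le_of_eq ?_)
    rw [Finset.sum_comm]
    have h5 : ∀ i, ∑ s : Fin n, (1 / n : ℝ) * ((n / ρ) * (B (i + s) i / h i) ^ ρ + (1 - n / ρ)) =
        1 := by
      intro i
      rw [← Finset.mul_sum, Finset.sum_add_distrib, ← Finset.mul_sum]
      have h6 : ∑ s : Fin n, (B (i + s) i / h i) ^ ρ = n := by
        have h7 : ∑ s : Fin n, (B (i + s) i / h i) ^ ρ = ∑ j, (B j i / h i) ^ ρ :=
          Equiv.sum_comp (Equiv.addLeft i) fun j => (B j i / h i) ^ ρ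
        rw [h7]
        simp only [Real.div_rpow (hB _ _) (hh0 _)]
        rw [← Finset.sum_div, hhρ, div_eq_iff]
        · rw [← mul_assoc, mul_one_div_cancel hn.ne', one_mul]
        · rw [← hhρ]
          exact (Real.rpow_pos_of_pos (hpos i) _).ne'
      rw [h6]
      simp only [Finset.sum_const, Finset.card_univ, Fintype.card_fin, nsmul_eq_mul]
      field_simp
      ring
    simp only [h5]
    simp

variable {𝕜 : Type} [RCLike 𝕜]

/-- With nonnegative symmetric coefficients, the sum of absolute values is unchanged by a cyclic
shift of the arguments. Averaging over all shifts and applying `sum_cyclic_prod_le` at each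
multi-index replaces the `n` arguments by their pointwise `ρ`-mean. -/
theorem norm_form_le_of_coeff {n : ℕ} [NeZero n] {ρ : ℝ} (hρ : (n : ℝ) ≤ ρ) {V : Type*} [Fintype V]
    [DecidableEq V] (Ψ : MultilinearMap 𝕜 (fun _ : Fin n => V → 𝕜) 𝕜) (b : (Fin n → V) → ℝ)
    (hb : ∀ k, 0 ≤ b k) (hΨ : ∀ k, Ψ (fun i => Pi.single (k i) 1) = (b k : 𝕜))
    (hsymm : ∀ (σ : Equiv.Perm (Fin n)) (c : Fin n → V → 𝕜), Ψ (fun i => c (σ i)) = Ψ c)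
    (c : Fin n → V → 𝕜) :
    ‖Ψ c‖ ≤ ‖Ψ fun _ v => ((((1 / n : ℝ) * ∑ j, ‖c j v‖ ^ ρ) ^ (1 / ρ) : ℝ) : 𝕜)‖ := by
  have hn : 0 < (n : ℝ) := Nat.cast_pos.2 (Nat.pos_of_ne_zero (NeZero.ne n))
  have hexp : ∀ c : Fin n → V → 𝕜, Ψ c = ∑ k : Fin n → V, (∏ i, c i (k i)) * (b k : 𝕜) := by
    intro c
    have h1 : c = fun i => ∑ v, c i v • (Pi.single v 1 : V → 𝕜) := by
      funext i v
      simp [Finset.sum_apply, Pi.single_apply]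
    conv_lhs => rw [h1]
    rw [Ψ.map_sum]
    refine Finset.sum_congr rfl fun k _ => ?_
    rw [Ψ.map_smul_univ, hΨ, smul_eq_mul]
  have hbs : ∀ (σ : Equiv.Perm (Fin n)) (k : Fin n → V), b (fun i => k (σ i)) = b k := by
    intro σ k
    have := hsymm σ fun i => Pi.single (k i) 1
    rw [hΨ fun i => k (σ i), hΨ k] at this
    exact_mod_cast this
  set h : V → ℝ := fun v => ((1 / n : ℝ) * ∑ j, ‖c j v‖ ^ ρ) ^ (1 / ρ) with hh
  have hh0 : ∀ v, 0 ≤ h v := fun v => Real.rpow_nonneg (mul_nonneg (by positivity)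
    (Finset.sum_nonneg fun j _ => Real.rpow_nonneg (norm_nonneg _) _)) _
  set X : ℝ := ∑ k : Fin n → V, (∏ i, ‖c i (k i)‖) * b k with hX
  have h1 : ‖Ψ c‖ ≤ X := by
    rw [hexp]
    refine (norm_sum_le _ _).trans (le_of_eq (Finset.sum_congr rfl fun k _ => ?_))
    rw [norm_mul, norm_prod, RCLike.norm_ofReal, abs_of_nonneg (hb k)]
  have h2 : ∀ s : Fin n, X = ∑ k : Fin n → V, (∏ i, ‖c (i + s) (k i)‖) * b k := by
    intro s
    rw [hX]
    refine Fintype.sum_equiv ((Equiv.addRight s).symm.arrowCongr (Equiv.refl V)) _ _ fun k => ?_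
    have h3 : ((Equiv.addRight s).symm.arrowCongr (Equiv.refl V)) k =
        fun i => k (Equiv.addRight s i) := rfl
    rw [h3, hbs]
    congr 1
    exact (Equiv.prod_comp (Equiv.addRight s) fun i => ‖c i (k i)‖).symm
  have h4 : (n : ℝ) * X ≤ n * ∑ k : Fin n → V, (∏ i, h (k i)) * b k := by
    have h5 : (n : ℝ) * X = ∑ s : Fin n, ∑ k : Fin n → V, (∏ i, ‖c (i + s) (k i)‖) * b k := by
      rw [← Finset.sum_congr rfl fun s _ => h2 s]
      simp
    rw [h5, Finset.sum_comm, Finset.mul_sum]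
    refine Finset.sum_le_sum fun k _ => ?_
    rw [← Finset.sum_mul, ← mul_assoc]
    exact mul_le_mul_of_nonneg_right
      (sum_cyclic_prod_le hρ (fun j i => ‖c j (k i)‖) fun _ _ => norm_nonneg _) (hb k)
  refine h1.trans ((le_of_mul_le_mul_left h4 hn).trans (le_of_eq ?_))
  rw [hexp]
  have h6 : ∑ k : Fin n → V, (∏ i, ((h (k i) : ℝ) : 𝕜)) * (b k : 𝕜) =
      ((∑ k : Fin n → V, (∏ i, h (k i)) * b k : ℝ) : 𝕜) := by
    push_cast
    rfl
  rw [h6, RCLike.norm_ofReal, abs_of_nonneg]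
  exact Finset.sum_nonneg fun k _ => mul_nonneg (Finset.prod_nonneg fun i _ => hh0 _) (hb k)

variable {r : ℝ≥0∞} [Fact (1 ≤ r)] {Ω : Type} [MeasurableSpace Ω] {μ : Measure Ω}

/-- Every finite family of simple functions lies in the range of a positive operator from a finite
dimensional space, given by a partition. -/
theorem exists_partition_operator (hr : r ≠ ∞) {n : ℕ} (g : Fin n → Lp.simpleFunc 𝕜 r μ) :
    ∃ (V : Type) (_ : Fintype V) (L : (V → 𝕜) →ₗ[𝕜] Lp 𝕜 r μ) (s : Ω → Option V)
      (c : Fin n → V → 𝕜), (∀ a, L a =ᵐ[μ] fun ω => (s ω).elim 0 a) ∧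
      ∀ i, L (c i) = g i := by
  classical
  have h1 : (1 : ℝ≥0∞) ≤ r := Fact.out
  have h0 : r ≠ 0 := (zero_lt_one.trans_le h1).ne'
  let G : Fin n → SimpleFunc Ω 𝕜 := fun i => Lp.simpleFunc.toSimpleFunc (g i)
  have hG : ∀ i, (G i).FinMeasSupp μ := fun i =>
    (SimpleFunc.memLp_iff_finMeasSupp h0 hr).1 (Lp.simpleFunc.memLp (g i))
  -- The `n` simple functions are combined into one vector valued simple function whose nonzero
  -- values index the partition. The value zero is left out because its level set may have infinite
  -- measure.
  let S : SimpleFunc Ω (Fin n → 𝕜) :=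
    { toFun := fun ω i => G i ω
      measurableSet_fiber' := fun v =>
        (measurable_pi_iff.2 fun i => (G i).measurable) (measurableSet_singleton v)
      finite_range' := by
        refine (Set.Finite.pi fun i => (G i).finite_range).subset ?_
        rintro _ ⟨ω, rfl⟩ i _
        exact ⟨ω, rfl⟩ }
  have hSv : ∀ ω i, S ω i = G i ω := fun _ _ => rfl
  have hS : S.FinMeasSupp μ := by
    rw [SimpleFunc.finMeasSupp_iff_support]
    have hsub : Function.support S ⊆ ⋃ i, Function.support (G i) := by
      intro ω hω
      rw [Function.mem_support, Function.ne_iff] at hω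
      obtain ⟨i, hi⟩ := hω
      exact Set.mem_iUnion.2 ⟨i, hi⟩
    refine (measure_mono hsub).trans_lt ((measure_iUnion_le _).trans_lt ?_)
    rw [tsum_fintype]
    exact ENNReal.sum_lt_top.2 fun i _ => SimpleFunc.finMeasSupp_iff_support.1 (hG i)
  let R : Finset (Fin n → 𝕜) := S.range.filter (· ≠ 0)
  let s : (Fin n → 𝕜) → Option R := fun v => if h : v ∈ R then some ⟨v, h⟩ else none
  have hs0 : ∀ a : R → 𝕜, (s 0).elim 0 a = 0 := by
    intro a
    have : (0 : Fin n → 𝕜) ∉ R := by simp [R]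
    simp [s, this]
  have hmem : ∀ a : R → 𝕜, MemLp (S.map fun v => (s v).elim 0 a) r μ := fun a =>
    (SimpleFunc.memLp_iff_finMeasSupp h0 hr).2 (hS.map (hs0 a))
  let L : (R → 𝕜) →ₗ[𝕜] Lp 𝕜 r μ :=
    { toFun := fun a => (hmem a).toLp _
      map_add' := fun a b => by
        rw [← MemLp.toLp_add]
        refine MemLp.toLp_congr _ _ (Filter.Eventually.of_forall fun ω => ?_)
        simp only [SimpleFunc.coe_map, Function.comp_apply, Pi.add_apply]
        cases s (S ω) <;> simp
      map_smul' := fun c a => by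
        rw [RingHom.id_apply, ← MemLp.toLp_const_smul]
        refine MemLp.toLp_congr _ _ (Filter.Eventually.of_forall fun ω => ?_)
        simp only [SimpleFunc.coe_map, Function.comp_apply, Pi.smul_apply]
        cases s (S ω) <;> simp }
  have hL : ∀ a, L a =ᵐ[μ] fun ω => (s (S ω)).elim 0 a := fun a => (hmem a).coeFn_toLp
  refine ⟨R, inferInstance, L, fun ω => s (S ω), fun i v => v.1 i, hL, fun i => Lp.ext ?_⟩
  filter_upwards [hL fun v => v.1 i, Lp.simpleFunc.toSimpleFunc_eq_toFun (g i)] with ω h2 h3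
  rw [h2, ← h3]
  change _ = S ω i
  by_cases hω : S ω = 0
  · rw [hω, hs0]; rfl
  · have : S ω ∈ R := Finset.mem_filter.2 ⟨S.mem_range_self ω, hω⟩
    simp [s, this]

/-- By density the arguments are simple, hence constant on a common partition, and positivity makes
the coefficients there nonnegative. The mean produced by `norm_form_le_of_coeff` has an `r`-th power
norm equal to the average of those of the arguments. Unlike general polarization, no constant
depending on `n` appears, which the exact isometric statement requires. -/
theorem norm_positive_form_le {n : ℕ} [NeZero n] (hr : r ≠ ∞) (hn : (n : ℝ) ≤ r.toReal)
    (Φ : ContinuousMultilinearMap 𝕜 (fun _ : Fin n => Lp 𝕜 r μ) 𝕜)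
    (hsymm : ∀ (σ : Equiv.Perm (Fin n)) (f : Fin n → Lp 𝕜 r μ), Φ (fun i => f (σ i)) = Φ f)
    (hpos : ∀ f : Fin n → Lp 𝕜 r μ,
      (∀ i, ∀ᵐ ω ∂μ, 0 ≤ RCLike.re (f i ω) ∧ RCLike.im (f i ω) = 0) →
        0 ≤ RCLike.re (Φ f) ∧ RCLike.im (Φ f) = 0)
    {t : ℝ} (ht : ∀ f, ‖Φ fun _ => f‖ ≤ t * ‖f‖ ^ n) (f : Fin n → Lp 𝕜 r μ) :
    ‖Φ f‖ ≤ t * (((1 / n : ℝ) * ∑ i, ‖f i‖ ^ r.toReal) ^ (1 / r.toReal)) ^ n := by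
  classical
  have h1 : (1 : ℝ≥0∞) ≤ r := Fact.out
  have hρ : 0 < r.toReal := ENNReal.toReal_pos (zero_lt_one.trans_le h1).ne' hr
  have hn0 : 0 < (n : ℝ) := Nat.cast_pos.2 (Nat.pos_of_ne_zero (NeZero.ne n))
  have hdense : DenseRange fun (g : Fin n → Lp.simpleFunc 𝕜 r μ) (i : Fin n) => (g i : Lp 𝕜 r μ) :=
    DenseRange.piMap fun _ => Lp.simpleFunc.denseRange hr
  refine hdense.induction_on f ?_ fun g => ?_
  · refine isClosed_le (by fun_prop) ?_
    refine continuous_const.mul (Continuous.pow ?_ _)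
    refine Continuous.rpow_const ?_ fun _ => Or.inr (by positivity)
    refine continuous_const.mul (continuous_finsetSum _ fun i _ => ?_)
    exact Continuous.rpow_const (by fun_prop) fun _ => Or.inr hρ.le
  · obtain ⟨V, _, L, s, c, hL, hc⟩ := exists_partition_operator hr g
    simp only [← hc]
    let Ψ : MultilinearMap 𝕜 (fun _ : Fin n => V → 𝕜) 𝕜 :=
      Φ.toMultilinearMap.compLinearMap fun _ => L
    have hΨ : ∀ a, Ψ a = Φ fun i => L (a i) := fun _ => rfl
    have hcoef : ∀ k : Fin n → V, 0 ≤ RCLike.re (Ψ fun i => Pi.single (k i) 1) ∧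
        RCLike.im (Ψ fun i => Pi.single (k i) 1) = 0 := by
      intro k
      refine hpos _ fun i => ?_
      filter_upwards [hL (Pi.single (k i) 1)] with ω hω
      rw [hω]
      cases s ω with
      | none => simp
      | some v =>
        by_cases hv : v = k i
        · subst hv; simp
        · simp [hv]
    have h2 := norm_form_le_of_coeff hn Ψ (fun k => RCLike.re (Ψ fun i => Pi.single (k i) 1))
      (fun k => (hcoef k).1) (fun k => RCLike.ext (by simp) (by simp [(hcoef k).2]))
      (fun σ a => hsymm σ fun i => L (a i)) c
    refine h2.trans ((ht _).trans_eq ?_)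
    congr 2
    set h : V → ℝ := fun v => ((1 / n : ℝ) * ∑ j, ‖c j v‖ ^ r.toReal) ^ (1 / r.toReal) with hh
    have hS : ∀ v, 0 ≤ (1 / n : ℝ) * ∑ j, ‖c j v‖ ^ r.toReal := fun v =>
      mul_nonneg (by positivity) (Finset.sum_nonneg fun j _ => Real.rpow_nonneg (norm_nonneg _) _)
    have hhρ : ∀ v, h v ^ r.toReal = (1 / n : ℝ) * ∑ j, ‖c j v‖ ^ r.toReal := fun v => by
      rw [hh]
      dsimp only
      rw [← Real.rpow_mul (hS v), one_div_mul_cancel hρ.ne', Real.rpow_one]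
    have hsum : 0 ≤ ∑ i, ‖L (c i)‖ ^ r.toReal :=
      Finset.sum_nonneg fun j _ => Real.rpow_nonneg (norm_nonneg _) _
    -- On each cell `h^r` is the average of the `|c_j|^r`, so integrating gives the average of the
    -- norms.
    suffices h3 : ‖L fun v => (h v : 𝕜)‖ ^ r.toReal = (1 / n : ℝ) * ∑ i, ‖L (c i)‖ ^ r.toReal by
      rw [← h3, ← Real.rpow_mul (norm_nonneg _), mul_one_div_cancel hρ.ne', Real.rpow_one]
    have h4 : ∀ a : V → 𝕜, ENNReal.ofReal (‖L a‖ ^ r.toReal) =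
        ∫⁻ ω, ENNReal.ofReal ((s ω).elim 0 fun v => ‖a v‖ ^ r.toReal) ∂μ := by
      intro a
      rw [ofReal_norm_rpow hr]
      refine lintegral_congr_ae ?_
      filter_upwards [hL a] with ω hω
      rw [hω]
      cases s ω with
      | none => simp [hρ]
      | some v =>
        simp only [Option.elim_some]
        rw [← ENNReal.ofReal_rpow_of_nonneg (norm_nonneg _) hρ.le, ofReal_norm]
    have hmeas : ∀ i, AEMeasurable
        (fun ω => ENNReal.ofReal ((s ω).elim 0 fun v => ‖c i v‖ ^ r.toReal)) μ := by
      intro i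
      have h5 : AEMeasurable (fun ω => ENNReal.ofReal (‖L (c i) ω‖ ^ r.toReal)) μ :=
        (((Lp.aestronglyMeasurable (L (c i))).norm.aemeasurable).pow_const _).ennreal_ofReal
      refine h5.congr ?_
      filter_upwards [hL (c i)] with ω hω
      rw [hω]
      cases s ω with
      | none => simp [hρ.ne']
      | some v => simp
    have h6 : ENNReal.ofReal (‖L fun v => (h v : 𝕜)‖ ^ r.toReal) =
        ENNReal.ofReal ((1 / n : ℝ) * ∑ i, ‖L (c i)‖ ^ r.toReal) := by
      rw [ENNReal.ofReal_mul (by positivity),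
        ENNReal.ofReal_sum_of_nonneg fun i _ => Real.rpow_nonneg (norm_nonneg _) _]
      simp only [h4]
      rw [← lintegral_finsetSum' _ fun i _ => hmeas i,
        ← lintegral_const_mul' _ _ ENNReal.ofReal_ne_top]
      refine lintegral_congr fun ω => ?_
      cases s ω with
      | none => simp
      | some v =>
        simp only [Option.elim_some]
        rw [← ENNReal.ofReal_sum_of_nonneg fun i _ => Real.rpow_nonneg (norm_nonneg _) _,
          ← ENNReal.ofReal_mul (by positivity), RCLike.norm_ofReal,
          abs_of_nonneg (Real.rpow_nonneg (hS v) _), hhρ]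
    exact (ENNReal.ofReal_eq_ofReal_iff (by positivity) (mul_nonneg (by positivity) hsum)).1 h6

end Positive

end SymRN

end

noncomputable section

namespace SymRN

open MeasureTheory

/-! ### Classes of polynomials that factor through `L_r` -/

section Factor

/-- A class of functions on the spaces `L_r(μ)`. -/
abbrev LpPred (𝕜 : Type) [RCLike 𝕜] (r : ℝ≥0∞) [Fact (1 ≤ r)] : Type 1 :=
  ∀ (Ω : Type) [MeasurableSpace Ω] (μ : Measure Ω), (Lp 𝕜 r μ → 𝕜) → Prop

/-- The polynomials `Q ∘ T` with `T` an operator into some `L_r(μ)` and `Q` in the class `K`. -/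
def factorClass {𝕜 : Type} [RCLike 𝕜] (n : ℕ) {r : ℝ≥0∞} [Fact (1 ≤ r)] (K : LpPred 𝕜 r) :
    PolyClass 𝕜 where
  Mem E _ _ P :=
    ∃ (Ω : Type) (_ : MeasurableSpace Ω) (μ : Measure Ω)
      (T : E →L[𝕜] Lp 𝕜 r μ) (Q : Lp 𝕜 r μ → 𝕜), K Ω μ Q ∧ P = Q ∘ T
  norm E _ _ P :=
    sInf {t : ℝ | ∃ (Ω : Type) (_ : MeasurableSpace Ω) (μ : Measure Ω)
      (T : E →L[𝕜] Lp 𝕜 r μ) (Q : Lp 𝕜 r μ → 𝕜), K Ω μ Q ∧ P = Q ∘ T ∧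
        t = polyNorm Q * ‖T‖ ^ n}

variable {𝕜 : Type} [RCLike 𝕜] {n : ℕ} {r : ℝ≥0∞} [Fact (1 ≤ r)]
variable {E : Type} [NormedAddCommGroup E] [NormedSpace 𝕜 E]
variable {F : Type} [NormedAddCommGroup F] [NormedSpace 𝕜 F]

/-- The class of continuous `n`-homogeneous polynomials on the spaces `L_r(μ)`. -/
def homPred (𝕜 : Type) [RCLike 𝕜] (n : ℕ) (r : ℝ≥0∞) [Fact (1 ≤ r)] : LpPred 𝕜 r :=
  fun _ _ _ Q => IsHomPoly n Q

/-- The class of positive `n`-homogeneous polynomials on the spaces `L_r(μ)`. -/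
def posPred (𝕜 : Type) [RCLike 𝕜] (n : ℕ) (r : ℝ≥0∞) [Fact (1 ≤ r)] : LpPred 𝕜 r :=
  fun _ _ _ Q => IsPositivePoly n Q

theorem factorable_eq : factorable 𝕜 n r = factorClass n (homPred 𝕜 n r) := rfl

/-- `P` factors through a contraction into some `L_r(μ)` and a polynomial in `K` of norm at
most `t`. -/
def FactorsWith (n : ℕ) (K : LpPred 𝕜 r) (P : E → 𝕜) (t : ℝ) : Prop :=
  ∃ (Ω : Type) (_ : MeasurableSpace Ω) (μ : Measure Ω) (T : E →L[𝕜] Lp 𝕜 r μ)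
    (Q : Lp 𝕜 r μ → 𝕜), K Ω μ Q ∧ P = Q ∘ T ∧ ‖T‖ ≤ 1 ∧ ∀ f, ‖Q f‖ ≤ t * ‖f‖ ^ n

theorem IsHomPoly.map_smul {P : E → 𝕜} (hP : IsHomPoly n P) (c : 𝕜) (x : E) :
    P (c • x) = c ^ n * P x := by
  obtain ⟨Φ, hΦ⟩ := hP
  rw [hΦ, hΦ]
  have := Φ.map_smul_univ (fun _ => c) fun _ => x
  simpa using this

theorem IsHomPoly.comp {P : F → 𝕜} (hP : IsHomPoly n P) (T : E →L[𝕜] F) : IsHomPoly n (P ∘ T) := by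
  obtain ⟨Φ, hΦ⟩ := hP
  exact ⟨Φ.compContinuousLinearMap fun _ => T, fun x => by simp [hΦ]⟩

theorem IsHomPoly.add {P Q : E → 𝕜} (hP : IsHomPoly n P) (hQ : IsHomPoly n Q) :
    IsHomPoly n (P + Q) := by
  obtain ⟨Φ, hΦ⟩ := hP
  obtain ⟨Ψ, hΨ⟩ := hQ
  exact ⟨Φ + Ψ, fun x => by simp [hΦ, hΨ]⟩

theorem IsHomPoly.smul {P : E → 𝕜} (hP : IsHomPoly n P) (c : 𝕜) : IsHomPoly n (c • P) := by
  obtain ⟨Φ, hΦ⟩ := hP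
  exact ⟨c • Φ, fun x => by simp [hΦ]⟩

theorem polyNorm_nonneg (P : E → 𝕜) : 0 ≤ polyNorm P := Real.iSup_nonneg fun _ => norm_nonneg _

theorem polyNorm_le {P : E → 𝕜} {t : ℝ} (ht : 0 ≤ t) (h : ∀ x, ‖P x‖ ≤ t * ‖x‖ ^ n) :
    polyNorm P ≤ t := by
  refine Real.iSup_le (fun x => (h x).trans ?_) ht
  have hx : ‖(x : E)‖ ≤ 1 := mem_closedBall_zero_iff.1 x.2
  exact mul_le_of_le_one_right ht (pow_le_one₀ (norm_nonneg _) hx)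

theorem IsHomPoly.norm_le_polyNorm {P : E → 𝕜} (hP : IsHomPoly n P) (x : E) :
    ‖P x‖ ≤ polyNorm P * ‖x‖ ^ n := by
  obtain ⟨C, hC, hb⟩ := hP.exists_bound
  have hbdd : BddAbove (Set.range fun x : Metric.closedBall (0 : E) 1 => ‖P x‖) := by
    refine ⟨C, ?_⟩
    rintro _ ⟨x, rfl⟩
    have hx : ‖(x : E)‖ ≤ 1 := mem_closedBall_zero_iff.1 x.2
    exact (hb x).trans (mul_le_of_le_one_right hC (pow_le_one₀ (norm_nonneg _) hx))
  by_cases hx : ‖x‖ = 0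
  · rcases Nat.eq_zero_or_pos n with rfl | hn
    · have h0 := le_ciSup hbdd ⟨0, by simp⟩
      have h1 := hP.map_smul 0 x
      simp only [zero_smul, pow_zero, one_mul] at h1
      rw [← h1, pow_zero, mul_one]
      exact h0
    · have h1 := hb x
      rw [hx, zero_pow hn.ne', mul_zero] at h1 ⊢
      exact h1
  · have hx' : 0 < ‖x‖ := (norm_nonneg x).lt_of_ne' hx
    have h0 := le_ciSup hbdd ⟨((‖x‖⁻¹ : ℝ) : 𝕜) • x, by
      simp [norm_smul, inv_mul_cancel₀ hx]⟩
    simp only [hP.map_smul] at h0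
    rw [norm_mul, norm_pow, RCLike.norm_ofReal, abs_of_pos (inv_pos.2 hx'), inv_pow,
      inv_mul_le_iff₀ (by positivity), mul_comm] at h0
    exact h0

namespace factorClass

theorem norm_nonneg {K : LpPred 𝕜 r} (P : E → 𝕜) : 0 ≤ (factorClass n K).norm E P := by
  apply Real.sInf_nonneg
  rintro _ ⟨_, _, _, _, Q, _, _, rfl⟩
  exact mul_nonneg (polyNorm_nonneg Q) (by positivity)

theorem norm_le {K : LpPred 𝕜 r} {Ω : Type} [MeasurableSpace Ω] {μ : Measure Ω}
    (T : E →L[𝕜] Lp 𝕜 r μ) (Q : Lp 𝕜 r μ → 𝕜) (hQ : K Ω μ Q) :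
    (factorClass n K).norm E (Q ∘ T) ≤ polyNorm Q * ‖T‖ ^ n := by
  refine csInf_le ⟨0, ?_⟩ ⟨Ω, _, μ, T, Q, hQ, rfl, rfl⟩
  rintro _ ⟨_, _, _, _, Q, _, _, rfl⟩
  exact mul_nonneg (polyNorm_nonneg Q) (by positivity)

theorem of_factorsWith {K : LpPred 𝕜 r} {P : E → 𝕜} {t : ℝ} (ht : 0 ≤ t)
    (h : FactorsWith n K P t) : (factorClass n K).Mem E P ∧ (factorClass n K).norm E P ≤ t := by
  obtain ⟨Ω, _, μ, T, Q, hQ, rfl, hT, hb⟩ := h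
  refine ⟨⟨Ω, _, μ, T, Q, hQ, rfl⟩, (norm_le T Q hQ).trans ?_⟩
  exact (mul_le_mul (polyNorm_le ht hb) (pow_le_one₀ (_root_.norm_nonneg _) hT)
    (by positivity) ht).trans_eq (mul_one t)

end factorClass

/-- The stability properties of a class `K` of polynomials on the spaces `L_r(μ)` under which the
polynomials factoring through `K` form a normed ideal. -/
structure LpStable (n : ℕ) (K : LpPred 𝕜 r) : Prop where
  isHomPoly : ∀ (Ω : Type) [MeasurableSpace Ω] (μ : Measure Ω) (Q : Lp 𝕜 r μ → 𝕜), K Ω μ Q →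
    IsHomPoly n Q
  smul : ∀ (Ω : Type) [MeasurableSpace Ω] (μ : Measure Ω) (Q : Lp 𝕜 r μ → 𝕜), K Ω μ Q →
    ∀ c : ℝ, 0 ≤ c → K Ω μ fun f => (c : 𝕜) * Q f
  sum : ∀ (Ω Ω' : Type) [MeasurableSpace Ω] [MeasurableSpace Ω'] (μ : Measure Ω) (ν : Measure Ω')
    (Q : Lp 𝕜 r μ → 𝕜) (Q' : Lp 𝕜 r ν → 𝕜), K Ω μ Q → K Ω' ν Q' →
    K (Ω ⊕ Ω') (sumMeasure μ ν) fun f => Q (lpLeft μ ν 𝕜 r f) + Q' (lpRight μ ν 𝕜 r f)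
  diff : ∀ (Ω : Type) [MeasurableSpace Ω] (μ : Measure Ω) (Q : Lp 𝕜 r μ → 𝕜), K Ω μ Q →
    ∀ c : ℝ, 0 ≤ c → K (Ω ⊕ Ω) (sumMeasure μ μ) fun f =>
      Q (lpLeft μ μ 𝕜 r f + (c : 𝕜) • lpRight μ μ 𝕜 r f) - Q (lpLeft μ μ 𝕜 r f)
  pow : K Unit (Measure.dirac ()) fun f => f () ^ n
  rotate : ∀ (Ω : Type) [MeasurableSpace Ω] (μ : Measure Ω) (Q : Lp 𝕜 r μ → 𝕜), K Ω μ Q →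
    ∀ t : ℝ, (∀ f, ‖Q f‖ ≤ t * ‖f‖ ^ n) → ∀ c : 𝕜, ‖c‖ = 1 →
      FactorsWith n K (fun f => c * Q f) t

theorem FactorsWith.comp {K : LpPred 𝕜 r} {P : F → 𝕜} {t : ℝ} (h : FactorsWith n K P t)
    (T : E →L[𝕜] F) (hT : ‖T‖ ≤ 1) : FactorsWith n K (P ∘ T) t := by
  obtain ⟨Ω, _, μ, S, Q, hQ, rfl, hS, hb⟩ := h
  exact ⟨Ω, _, μ, S.comp T, Q, hQ, rfl, (S.opNorm_comp_le T).trans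
    (mul_le_one₀ hS (norm_nonneg _) hT), hb⟩

namespace LpStable

variable {K : LpPred 𝕜 r} (hK : LpStable n K)
include hK

/-- By homogeneity the norm of the operator can be moved onto the polynomial. The scaling factor is
`‖T‖ + η` because `T` may be zero. -/
theorem exists_factorsWith {P : E → 𝕜} (hP : (factorClass n K).Mem E P) {t : ℝ}
    (ht : (factorClass n K).norm E P < t) : FactorsWith n K P t := by
  obtain ⟨Ω₀, _, μ₀, T₀, Q₀, hQ₀, hP₀⟩ := hP
  obtain ⟨_, ⟨Ω, _, μ, T, Q, hQ, rfl, rfl⟩, hlt⟩ :=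
    exists_lt_of_csInf_lt (by exact ⟨_, Ω₀, _, μ₀, T₀, Q₀, hQ₀, hP₀, rfl⟩) ht
  have hcont : Filter.Tendsto (fun η : ℝ => polyNorm Q * (‖T‖ + η) ^ n) (nhdsWithin 0 (Set.Ioi 0))
      (nhds (polyNorm Q * (‖T‖ + 0) ^ n)) :=
    ((by fun_prop : Continuous fun η : ℝ => polyNorm Q * (‖T‖ + η) ^ n).tendsto 0).mono_left
      nhdsWithin_le_nhds
  rw [add_zero] at hcont
  obtain ⟨η, hη, hη0⟩ := ((hcont.eventually_lt_const hlt).and self_mem_nhdsWithin).exists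
  have ha : 0 < ‖T‖ + η := add_pos_of_nonneg_of_pos (norm_nonneg _) hη0
  set a := ‖T‖ + η with hadef
  have hH := hK.isHomPoly _ _ _ hQ
  refine ⟨Ω, _, μ, ((a⁻¹ : ℝ) : 𝕜) • T, fun f => ((a ^ n : ℝ) : 𝕜) * Q f,
    hK.smul _ _ _ hQ _ (by positivity), ?_, ?_, fun f => ?_⟩
  · funext x
    simp only [Function.comp_apply, _root_.smul_apply, hH.map_smul]
    rw [← mul_assoc, ← RCLike.ofReal_pow, ← RCLike.ofReal_mul, ← mul_pow, mul_inv_cancel₀ ha.ne',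
      one_pow, RCLike.ofReal_one, one_mul]
  · rw [norm_smul, RCLike.norm_ofReal, abs_of_pos (inv_pos.2 ha), inv_mul_le_iff₀ ha, mul_one]
    exact le_add_of_nonneg_right (le_of_lt hη0)
  · rw [norm_mul, RCLike.norm_ofReal, abs_of_pos (by positivity)]
    calc a ^ n * ‖Q f‖ ≤ a ^ n * (polyNorm Q * ‖f‖ ^ n) := by
          gcongr
          exact hH.norm_le_polyNorm f
      _ = polyNorm Q * a ^ n * ‖f‖ ^ n := by ring
      _ ≤ t * ‖f‖ ^ n := by gcongr

theorem factorsWith_smul {P : E → 𝕜} {t : ℝ} (h : FactorsWith n K P t) {c : ℝ} (hc : 0 ≤ c) :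
    FactorsWith n K (fun x => (c : 𝕜) * P x) (c * t) := by
  obtain ⟨Ω, _, μ, T, Q, hQ, rfl, hT, hb⟩ := h
  refine ⟨Ω, _, μ, T, _, hK.smul _ _ _ hQ c hc, rfl, hT, fun f => ?_⟩
  rw [norm_mul, RCLike.norm_ofReal, abs_of_nonneg hc, mul_assoc]
  exact mul_le_mul_of_nonneg_left (hb f) hc

theorem factorsWith_rotate {P : E → 𝕜} {t : ℝ} (h : FactorsWith n K P t) {c : 𝕜} (hc : ‖c‖ = 1) :
    FactorsWith n K (fun x => c * P x) t := by
  obtain ⟨Ω, _, μ, T, Q, hQ, rfl, hT, hb⟩ := h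
  exact (hK.rotate Ω μ Q hQ t hb c hc).comp T hT

/-- Weights `s`, `s'` with `s^r = a/(a+b)` and `s'^r = b/(a+b)` make the pair of operators a
contraction into the direct sum. The polynomials absorb the factors `s^{-n}`, and convexity of `u ↦
u^{r/n}` yields exactly `a + b`. For `r = ∞` no weights are needed. -/
theorem factorsWith_add (hn : n ≠ 0) (hr : (n : ℝ≥0∞) ≤ r) {P P' : E → 𝕜} {a b : ℝ} (ha : 0 < a)
    (hb : 0 < b) (h : FactorsWith n K P a) (h' : FactorsWith n K P' b) :
    FactorsWith n K (P + P') (a + b) := by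
  obtain ⟨Ω, _, μ, T, Q, hQ, rfl, hT, hQa⟩ := h
  obtain ⟨Ω', _, ν, T', Q', hQ', rfl, hT', hQb⟩ := h'
  by_cases hr' : r = ∞
  · subst hr'
    refine ⟨_, _, _, lpPair T T', _, hK.sum _ _ _ _ _ _ hQ hQ', ?_,
      norm_lpPair_le_top _ _ hT hT', fun f => ?_⟩
    · funext x
      simp [lpLeft_lpPair, lpRight_lpPair]
    · rw [add_mul]
      refine (norm_add_le _ _).trans (add_le_add ((hQa _).trans ?_) ((hQb _).trans ?_))
      · gcongr
        exact norm_lpLeft_le f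
      · gcongr
        exact norm_lpRight_le f
  · have hn0 : 0 < (n : ℝ) := Nat.cast_pos.2 (Nat.pos_of_ne_zero hn)
    have hρn : (n : ℝ) ≤ r.toReal := by
      have := ENNReal.toReal_mono hr' hr
      simpa using this
    set ρ := r.toReal with hρdef
    have hρ : 0 < ρ := hn0.trans_le hρn
    have hA : 0 < a + b := add_pos ha hb
    -- Jensen's inequality for the exponent `r/n`, which is at least one.
    have key : ∀ u v : ℝ, 0 ≤ u → 0 ≤ v → u * (a / (a + b)) + v * (b / (a + b)) ≤
        (u ^ (ρ / n) * (a / (a + b)) + v ^ (ρ / n) * (b / (a + b))) ^ (n / ρ) := by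
      intro u v hu hv
      have h1 := (convexOn_rpow (p := ρ / n) ((one_le_div hn0).2 hρn)).2 (Set.mem_Ici.2 hu)
        (Set.mem_Ici.2 hv) (by positivity : 0 ≤ a / (a + b)) (by positivity : 0 ≤ b / (a + b))
        (by rw [← add_div, div_self hA.ne'])
      simp only [smul_eq_mul] at h1
      have h2 : n / ρ = (ρ / n)⁻¹ := by rw [inv_div]
      rw [h2, ← Real.rpow_le_rpow_iff (z := ρ / n) (by positivity) (by positivity) (by positivity),
        Real.rpow_inv_rpow (by positivity) (by positivity)]
      rwa [mul_comm u, mul_comm v, mul_comm (u ^ _), mul_comm (v ^ _)]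
    have scale : ∀ w : ℝ, 0 < w → ∃ s : ℝ, 0 < s ∧ s ^ ρ = w := fun w hw =>
      ⟨w ^ ρ⁻¹, by positivity, Real.rpow_inv_rpow hw.le hρ.ne'⟩
    obtain ⟨s, hs, hsρ⟩ := scale (a / (a + b)) (by positivity)
    obtain ⟨s', hs', hsρ'⟩ := scale (b / (a + b)) (by positivity)
    have cancel : ∀ s : ℝ, 0 < s → (((s ^ n)⁻¹ : ℝ) : 𝕜) * (s : 𝕜) ^ n = 1 := fun s hs => by
      rw [← RCLike.ofReal_pow, ← RCLike.ofReal_mul, inv_mul_cancel₀ (by positivity),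
        RCLike.ofReal_one]
    refine ⟨_, _, _, lpPair ((s : 𝕜) • T) ((s' : 𝕜) • T'), _,
      hK.sum _ _ _ _ _ _ (hK.smul _ _ _ hQ (s ^ n)⁻¹ (by positivity))
        (hK.smul _ _ _ hQ' (s' ^ n)⁻¹ (by positivity)), ?_, ?_, fun f => ?_⟩
    · funext x
      simp only [Pi.add_apply, Function.comp_apply, lpLeft_lpPair, lpRight_lpPair,
        _root_.smul_apply, (hK.isHomPoly _ _ _ hQ).map_smul, (hK.isHomPoly _ _ _ hQ').map_smul,
        ← mul_assoc, cancel s hs, cancel s' hs', one_mul]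
    · refine norm_lpPair_le hr' _ _ (a := s) (b := s') ?_ ?_ zero_le_one ?_
      · rw [norm_smul, RCLike.norm_ofReal, abs_of_pos hs]
        exact mul_le_of_le_one_right hs.le hT
      · rw [norm_smul, RCLike.norm_ofReal, abs_of_pos hs']
        exact mul_le_of_le_one_right hs'.le hT'
      · rw [← hρdef, hsρ, hsρ', ← add_div, div_self hA.ne', Real.one_rpow]
    · set x := ‖lpLeft μ ν 𝕜 r f‖ with hx
      set y := ‖lpRight μ ν 𝕜 r f‖ with hy
      have hx0 : 0 ≤ x := norm_nonneg _
      have hy0 : 0 ≤ y := norm_nonneg _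
      have h1 : ‖(((s ^ n)⁻¹ : ℝ) : 𝕜) * Q (lpLeft μ ν 𝕜 r f)‖ ≤ a * (x / s) ^ n := by
        rw [norm_mul, RCLike.norm_ofReal, abs_of_pos (by positivity), div_pow, mul_div_assoc',
          inv_mul_eq_div]
        gcongr
        exact hQa _
      have h2 : ‖(((s' ^ n)⁻¹ : ℝ) : 𝕜) * Q' (lpRight μ ν 𝕜 r f)‖ ≤ b * (y / s') ^ n := by
        rw [norm_mul, RCLike.norm_ofReal, abs_of_pos (by positivity), div_pow, mul_div_assoc',
          inv_mul_eq_div]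
        gcongr
        exact hQb _
      refine (norm_add_le _ _).trans ((add_le_add h1 h2).trans ?_)
      have h3 := key ((x / s) ^ n) ((y / s') ^ n) (by positivity) (by positivity)
      have h4 : ∀ x s : ℝ, 0 ≤ x → 0 < s → ((x / s) ^ n) ^ (ρ / n) * s ^ ρ = x ^ ρ := by
        intro x s hx hs
        rw [← Real.rpow_natCast, ← Real.rpow_mul (by positivity), mul_div_cancel₀ _ hn0.ne',
          Real.div_rpow hx hs.le, div_mul_cancel₀ _ (by positivity)]
      rw [← hsρ, ← hsρ', h4 x s hx0 hs, h4 y s' hy0 hs', hx, hy, ← lpSum_norm_rpow _ _ hr',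
        ← Real.rpow_mul (norm_nonneg _), mul_div_cancel₀ _ hρ.ne', Real.rpow_natCast, hsρ,
        hsρ'] at h3
      calc a * (x / s) ^ n + b * (y / s') ^ n =
          (a + b) * ((x / s) ^ n * (a / (a + b)) + (y / s') ^ n * (b / (a + b))) := by
            field_simp
        _ ≤ (a + b) * ‖f‖ ^ n := mul_le_mul_of_nonneg_left h3 hA.le

theorem isIdeal (hn : n ≠ 0) (hr : (n : ℝ≥0∞) ≤ r) : (factorClass n K).IsIdeal n where
  isHomPoly E _ _ P hP := by
    obtain ⟨Ω, _, μ, T, Q, hQ, rfl⟩ := hP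
    exact (hK.isHomPoly _ _ _ hQ).comp T
  add E _ _ P P' hP hP' := by
    have h : ∀ ε : ℝ, 0 < ε → (factorClass n K).Mem E (P + P') ∧ (factorClass n K).norm E (P + P') ≤
        (factorClass n K).norm E P + (factorClass n K).norm E P' + ε := by
      intro ε hε
      have h1 := factorClass.norm_nonneg (n := n) (K := K) P
      have h2 := factorClass.norm_nonneg (n := n) (K := K) P'
      have h3 := factorClass.of_factorsWith (by positivity) (hK.factorsWith_add hn hr
        (by positivity) (by positivity)
        (hK.exists_factorsWith hP (lt_add_of_pos_right _ (half_pos hε)))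
        (hK.exists_factorsWith hP' (lt_add_of_pos_right _ (half_pos hε))))
      exact ⟨h3.1, h3.2.trans_eq (by ring)⟩
    exact ⟨(h 1 one_pos).1, le_of_forall_pos_le_add fun ε hε => (h ε hε).2⟩
  -- The scalar is split into modulus and phase; the phase is handled by the `rotate` axiom without
  -- loss of norm.
  smul E _ _ c P hP := by
    have hu : ∃ u : 𝕜, ‖u‖ = 1 ∧ c = (‖c‖ : 𝕜) * u := by
      by_cases hc : c = 0
      · exact ⟨1, by simp, by simp [hc]⟩
      · have hc' : (‖c‖ : 𝕜) ≠ 0 := by simpa using hc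
        exact ⟨(‖c‖ : 𝕜)⁻¹ * c, by simp [hc], by rw [mul_inv_cancel_left₀ hc']⟩
    obtain ⟨u, hu, hcu⟩ := hu
    have h : ∀ t : ℝ, (factorClass n K).norm E P < t → (factorClass n K).Mem E (c • P) ∧
        (factorClass n K).norm E (c • P) ≤ ‖c‖ * t := by
      intro t ht
      have ht0 : 0 ≤ t := (factorClass.norm_nonneg P).trans ht.le
      have h3 := factorClass.of_factorsWith (by positivity) (hK.factorsWith_smul
        (hK.factorsWith_rotate (hK.exists_factorsWith hP ht) hu) (norm_nonneg c))
      have h4 : (fun x => (‖c‖ : 𝕜) * (u * P x)) = c • P := by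
        funext x
        rw [← mul_assoc, ← hcu]
        rfl
      rwa [h4] at h3
    refine ⟨(h _ (lt_add_one _)).1, ?_⟩
    by_cases hc : c = 0
    · have := (h _ (lt_add_one _)).2
      simpa [hc] using this
    · have hc' : 0 < ‖c‖ := norm_pos_iff.2 hc
      rw [← div_le_iff₀' hc']
      refine le_of_forall_gt_imp_ge_of_dense fun t ht => ?_
      rw [div_le_iff₀' hc']
      exact (h t ht).2
  -- The scalar field is `L_r` of a one point space, so `φ^n` is the monomial there composed with
  -- `φ`.
  pow E _ _ φ := by
    have h0 : r ≠ 0 := (zero_lt_one.trans_le (Fact.out : 1 ≤ r)).ne'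
    let T : E →L[𝕜] Lp 𝕜 r (Measure.dirac ()) := (Lp.constL r (Measure.dirac ()) 𝕜).comp φ
    have hT : ∀ x, T x () = φ x := fun x => by
      have h1 : T x =ᵐ[Measure.dirac ()] Function.const Unit (φ x) := Lp.coeFn_const r _ (φ x)
      have h2 : T x () = Function.const Unit (φ x) () := by
        simpa [Filter.EventuallyEq] using h1
      exact h2
    have hev : (fun x => φ x ^ n) = (fun f : Lp 𝕜 r (Measure.dirac ()) => f () ^ n) ∘ T := by
      funext x
      simp [hT]
    have hnorm : ∀ f : Lp 𝕜 r (Measure.dirac ()), ‖f ()‖ = ‖f‖ := fun f => by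
      have h1 : f = Lp.const r (Measure.dirac ()) (f ()) := by
        refine Lp.ext ?_
        filter_upwards [Lp.coeFn_const r (Measure.dirac ()) (f ())] with ω h
        rw [h]
        rfl
      conv_rhs => rw [h1, Lp.norm_const _ _ _ h0]
      simp
    rw [hev]
    refine ⟨⟨_, _, _, T, _, hK.pow, rfl⟩, (factorClass.norm_le T _ hK.pow).trans ?_⟩
    refine (mul_le_mul (b := 1) ?_ (pow_le_pow_left₀ (norm_nonneg _) ?_ n) (by positivity)
      zero_le_one).trans_eq (one_mul _)
    · exact polyNorm_le zero_le_one fun f => by rw [norm_pow, hnorm, one_mul]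
    · refine ContinuousLinearMap.opNorm_le_bound _ (norm_nonneg _) fun x => ?_
      rw [← hnorm, hT]
      exact φ.le_opNorm x
  bound E _ _ P hP := by
    refine ⟨factorClass.norm_nonneg P, fun x => ?_⟩
    have h : ∀ t : ℝ, (factorClass n K).norm E P < t → ‖P x‖ ≤ t * ‖x‖ ^ n := by
      intro t ht
      have ht0 : 0 ≤ t := (factorClass.norm_nonneg P).trans ht.le
      obtain ⟨Ω, _, μ, T, Q, hQ, rfl, hT, hb⟩ := hK.exists_factorsWith hP ht
      refine (hb _).trans ?_
      gcongr
      exact (T.le_opNorm x).trans (mul_le_of_le_one_left (norm_nonneg _) hT)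
    have hlim : Filter.Tendsto (fun t : ℝ => t * ‖x‖ ^ n)
        (nhdsWithin ((factorClass n K).norm E P) (Set.Ioi ((factorClass n K).norm E P)))
        (nhds ((factorClass n K).norm E P * ‖x‖ ^ n)) :=
      ((by fun_prop : Continuous fun t : ℝ => t * ‖x‖ ^ n).tendsto _).mono_left nhdsWithin_le_nhds
    exact ge_of_tendsto hlim (Filter.mem_of_superset self_mem_nhdsWithin h)
  comp E F _ _ _ _ T P hP := by
    obtain ⟨Ω₀, _, μ₀, T₀, Q₀, hQ₀, hP₀⟩ := hP
    refine ⟨⟨Ω₀, _, μ₀, T₀.comp T, Q₀, hQ₀, by rw [hP₀]; rfl⟩, ?_⟩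
    have h : ∀ t ∈ {t : ℝ | ∃ (Ω : Type) (_ : MeasurableSpace Ω) (μ : Measure Ω)
        (S : F →L[𝕜] Lp 𝕜 r μ) (Q : Lp 𝕜 r μ → 𝕜), K Ω μ Q ∧ P = Q ∘ S ∧
          t = polyNorm Q * ‖S‖ ^ n}, (factorClass n K).norm E (P ∘ T) ≤ ‖T‖ ^ n * t := by
      rintro _ ⟨Ω, _, μ, S, Q, hQ, rfl, rfl⟩
      refine (factorClass.norm_le (S.comp T) Q hQ).trans ?_
      have h1 := S.opNorm_comp_le T
      have h2 := polyNorm_nonneg Q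
      calc polyNorm Q * ‖S.comp T‖ ^ n ≤ polyNorm Q * (‖S‖ * ‖T‖) ^ n := by gcongr
        _ = _ := by ring
    have hne : {t : ℝ | ∃ (Ω : Type) (_ : MeasurableSpace Ω) (μ : Measure Ω)
        (S : F →L[𝕜] Lp 𝕜 r μ) (Q : Lp 𝕜 r μ → 𝕜), K Ω μ Q ∧ P = Q ∘ S ∧
          t = polyNorm Q * ‖S‖ ^ n}.Nonempty := ⟨_, Ω₀, _, μ₀, T₀, Q₀, hQ₀, hP₀, rfl⟩
    by_cases hT : ‖T‖ ^ n = 0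
    · obtain ⟨t, ht⟩ := hne
      simpa [hT] using h t ht
    · have hT' : 0 < ‖T‖ ^ n := lt_of_le_of_ne (by positivity) (Ne.symm hT)
      rw [← div_le_iff₀' hT']
      exact le_csInf hne fun t ht => by
        rw [div_le_iff₀' hT']
        exact h t ht

end LpStable

end Factor

end SymRN

end

noncomputable section

namespace SymRN

open MeasureTheory

/-! ### The classes of all polynomials and of positive polynomials are stable -/

section Stable

variable {𝕜 : Type} [RCLike 𝕜] {n : ℕ} {r : ℝ≥0∞} [Fact (1 ≤ r)]

/-- Evaluation of functions on a one point space. -/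
def unitEval (𝕜 : Type) [RCLike 𝕜] (r : ℝ≥0∞) [Fact (1 ≤ r)] :
    Lp 𝕜 r (Measure.dirac ()) →L[𝕜] 𝕜 :=
  LinearMap.mkContinuous
    { toFun := fun f => f ()
      map_add' := fun f g => by
        have h := Lp.coeFn_add f g
        simpa [Filter.EventuallyEq] using h
      map_smul' := fun c f => by
        have h := Lp.coeFn_smul c f
        simpa [Filter.EventuallyEq] using h } 1 fun f => by
    have h0 : r ≠ 0 := (zero_lt_one.trans_le (Fact.out : 1 ≤ r)).ne'
    have h1 : f = Lp.const r (Measure.dirac ()) (f ()) := by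
      refine Lp.ext ?_
      filter_upwards [Lp.coeFn_const r (Measure.dirac ()) (f ())] with ω h
      rw [h]
      rfl
    conv_rhs => rw [h1, Lp.norm_const _ _ _ h0]
    simp

theorem unitEval_apply (f : Lp 𝕜 r (Measure.dirac ())) : unitEval 𝕜 r f = f () := rfl

theorem isHomPoly_const_mul {E : Type} [NormedAddCommGroup E] [NormedSpace 𝕜 E] {P : E → 𝕜}
    (hP : IsHomPoly n P) (c : 𝕜) : IsHomPoly n fun x => c * P x := hP.smul c

theorem homPred_stable (n : ℕ) (𝕜 : Type) [RCLike 𝕜] (r : ℝ≥0∞) [Fact (1 ≤ r)] :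
    LpStable n (homPred 𝕜 n r) where
  isHomPoly _ _ _ _ hQ := hQ
  smul _ _ _ _ hQ c _ := isHomPoly_const_mul hQ c
  sum _ _ _ _ μ ν _ _ hQ hQ' := (hQ.comp (lpLeft μ ν 𝕜 r)).add (hQ'.comp (lpRight μ ν 𝕜 r))
  diff _ _ μ Q hQ c _ := by
    have h1 := hQ.comp (lpLeft μ μ 𝕜 r + (c : 𝕜) • lpRight μ μ 𝕜 r)
    have h2 := (hQ.comp (lpLeft μ μ 𝕜 r)).smul (-1)
    have h3 := h1.add h2
    have h4 : (Q ∘ ⇑(lpLeft μ μ 𝕜 r + (c : 𝕜) • lpRight μ μ 𝕜 r) + (-1 : 𝕜) • Q ∘ ⇑(lpLeft μ μ 𝕜 r)) =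
        fun f => Q (lpLeft μ μ 𝕜 r f + (c : 𝕜) • lpRight μ μ 𝕜 r f) - Q (lpLeft μ μ 𝕜 r f) := by
      funext f
      simp only [Pi.add_apply, Pi.smul_apply, Function.comp_apply, _root_.add_apply,
        _root_.smul_apply, smul_eq_mul]
      ring
    rw [h4] at h3
    exact h3
  pow := ⟨(ContinuousMultilinearMap.mkPiAlgebra 𝕜 (Fin n) 𝕜).compContinuousLinearMap
    fun _ => unitEval 𝕜 r, fun f => by simp [unitEval_apply]⟩
  rotate Ω _ μ Q hQ t ht c hc := by
    refine ⟨Ω, _, μ, ContinuousLinearMap.id 𝕜 _, _, isHomPoly_const_mul hQ c, rfl,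
      ContinuousLinearMap.norm_id_le, fun f => ?_⟩
    rw [norm_mul, hc, one_mul]
    exact ht f

/-- A scalar that is a nonnegative real number. -/
def NonnegReal (z : 𝕜) : Prop := 0 ≤ RCLike.re z ∧ RCLike.im z = 0

theorem nonnegReal_iff (z : 𝕜) : NonnegReal z ↔ ∃ a : ℝ, 0 ≤ a ∧ z = a := by
  constructor
  · rintro ⟨h1, h2⟩
    exact ⟨_, h1, RCLike.ext (by simp) (by simp [h2])⟩
  · rintro ⟨a, ha, rfl⟩
    exact ⟨by simpa using ha, by simp⟩

theorem NonnegReal.add {z w : 𝕜} (hz : NonnegReal z) (hw : NonnegReal w) : NonnegReal (z + w) := by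
  obtain ⟨a, ha, rfl⟩ := (nonnegReal_iff z).1 hz
  obtain ⟨b, hb, rfl⟩ := (nonnegReal_iff w).1 hw
  exact (nonnegReal_iff _).2 ⟨a + b, by positivity, by simp⟩

theorem NonnegReal.mul {z w : 𝕜} (hz : NonnegReal z) (hw : NonnegReal w) : NonnegReal (z * w) := by
  obtain ⟨a, ha, rfl⟩ := (nonnegReal_iff z).1 hz
  obtain ⟨b, hb, rfl⟩ := (nonnegReal_iff w).1 hw
  exact (nonnegReal_iff _).2 ⟨a * b, by positivity, by simp⟩

theorem nonnegReal_zero : NonnegReal (0 : 𝕜) := by simp [NonnegReal]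

theorem nonnegReal_ofReal {a : ℝ} (ha : 0 ≤ a) : NonnegReal (a : 𝕜) :=
  (nonnegReal_iff _).2 ⟨a, ha, rfl⟩

theorem NonnegReal.sum {ι : Type*} {s : Finset ι} {z : ι → 𝕜} (h : ∀ i ∈ s, NonnegReal (z i)) :
    NonnegReal (∑ i ∈ s, z i) :=
  Finset.sum_induction _ _ (fun _ _ => NonnegReal.add) nonnegReal_zero h

theorem NonnegReal.prod {ι : Type*} {s : Finset ι} {z : ι → 𝕜} (h : ∀ i ∈ s, NonnegReal (z i)) :
    NonnegReal (∏ i ∈ s, z i) :=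
  Finset.prod_induction _ _ (fun _ _ => NonnegReal.mul) (by simp [NonnegReal]) h

variable {Ω Ω' : Type} [MeasurableSpace Ω] [MeasurableSpace Ω'] {μ : Measure Ω} {ν : Measure Ω'}

/-- The cone of nonnegative functions in `L_r(μ)`. -/
def NonnegLp (f : Lp 𝕜 r μ) : Prop := ∀ᵐ ω ∂μ, NonnegReal (f ω)

theorem NonnegLp.smul {f : Lp 𝕜 r μ} (hf : NonnegLp f) {c : ℝ} (hc : 0 ≤ c) :
    NonnegLp ((c : 𝕜) • f) := by
  filter_upwards [hf, Lp.coeFn_smul (c : 𝕜) f] with ω h1 h2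
  rw [h2]
  exact (nonnegReal_ofReal hc).mul h1

theorem NonnegLp.left {F : Lp 𝕜 r (sumMeasure μ ν)} (hF : NonnegLp F) :
    NonnegLp (lpLeft μ ν 𝕜 r F) := by
  filter_upwards [((ae_sumMeasure_iff μ ν).1 hF).1, lpLeft_coe μ ν F] with ω h1 h2
  rw [h2]
  exact h1

theorem NonnegLp.right {F : Lp 𝕜 r (sumMeasure μ ν)} (hF : NonnegLp F) :
    NonnegLp (lpRight μ ν 𝕜 r F) := by
  filter_upwards [((ae_sumMeasure_iff μ ν).1 hF).2, lpRight_coe μ ν F] with ω h1 h2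
  rw [h2]
  exact h1

/-- A symmetric `n`-linear form on `L_r(μ)` that is nonnegative on nonnegative functions. -/
structure IsPositiveForm (Φ : ContinuousMultilinearMap 𝕜 (fun _ : Fin n => Lp 𝕜 r μ) 𝕜) :
    Prop where
  symm : ∀ (σ : Equiv.Perm (Fin n)) (f : Fin n → Lp 𝕜 r μ), Φ (fun i => f (σ i)) = Φ f
  nonneg : ∀ f : Fin n → Lp 𝕜 r μ, (∀ i, NonnegLp (f i)) → NonnegReal (Φ f)

theorem isPositivePoly_iff (Q : Lp 𝕜 r μ → 𝕜) : IsPositivePoly n Q ↔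
    ∃ Φ : ContinuousMultilinearMap 𝕜 (fun _ : Fin n => Lp 𝕜 r μ) 𝕜,
      (∀ f, Q f = Φ fun _ => f) ∧ IsPositiveForm Φ :=
  ⟨fun ⟨Φ, h1, h2, h3⟩ => ⟨Φ, h1, h2, h3⟩, fun ⟨Φ, h1, h2⟩ => ⟨Φ, h1, h2.symm, h2.nonneg⟩⟩

/-- All terms of the multilinear expansion are nonnegative, so removing the leading one keeps
positivity. Hence a positive polynomial increases by a positive polynomial, as the `diff` axiom
demands. -/
theorem IsPositiveForm.nonneg_sub {Φ : ContinuousMultilinearMap 𝕜 (fun _ : Fin n => Lp 𝕜 r μ) 𝕜}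
    (h : IsPositiveForm Φ) (f g : Fin n → Lp 𝕜 r μ) (hf : ∀ i, NonnegLp (f i))
    (hg : ∀ i, NonnegLp (g i)) : NonnegReal (Φ (fun i => f i + g i) - Φ f) := by
  have h1 : (fun i => f i + g i) = f + g := rfl
  rw [h1, Φ.map_add_univ, ← Finset.add_sum_erase _ _ (Finset.mem_univ Finset.univ),
    Finset.piecewise_univ, add_sub_cancel_left]
  refine NonnegReal.sum fun s _ => h.nonneg _ fun i => ?_
  by_cases hi : i ∈ s
  · simpa [hi] using hf i
  · simpa [hi] using hg i

/-- The operators on the two summands of `L_r(μ ⊕ μ)` that are used to multiply one variable of a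
form by a scalar. -/
def slotOp (μ : Measure Ω) (𝕜 : Type) [RCLike 𝕜] (r : ℝ≥0∞) [Fact (1 ≤ r)] (a b : ℝ) (j i : Fin n) :
    Lp 𝕜 r (sumMeasure μ μ) →L[𝕜] Lp 𝕜 r μ :=
  if i = j then (b : 𝕜) • lpRight μ μ 𝕜 r else (a : 𝕜) • lpLeft μ μ 𝕜 r

/-- The symmetrization of the form with the right part of a function in one variable and its left
part in the others. -/
def slotForm (Φ : ContinuousMultilinearMap 𝕜 (fun _ : Fin n => Lp 𝕜 r μ) 𝕜) (a b : ℝ) :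
    ContinuousMultilinearMap 𝕜 (fun _ : Fin n => Lp 𝕜 r (sumMeasure μ μ)) 𝕜 :=
  ((1 / n : ℝ) : 𝕜) • ∑ j : Fin n, Φ.compContinuousLinearMap fun i => slotOp μ 𝕜 r a b j i

theorem slotForm_apply (Φ : ContinuousMultilinearMap 𝕜 (fun _ : Fin n => Lp 𝕜 r μ) 𝕜) (a b : ℝ)
    (f : Fin n → Lp 𝕜 r (sumMeasure μ μ)) :
    slotForm Φ a b f = ((1 / n : ℝ) : 𝕜) * ∑ j : Fin n, Φ fun i => slotOp μ 𝕜 r a b j i (f i) := by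
  simp [slotForm]

/-- Permuting the arguments only permutes the distinguished slot `j`, over which the form sums. -/
theorem IsPositiveForm.slotForm {Φ : ContinuousMultilinearMap 𝕜 (fun _ : Fin n => Lp 𝕜 r μ) 𝕜}
    (h : IsPositiveForm Φ) {a b : ℝ} (ha : 0 ≤ a) (hb : 0 ≤ b) :
    IsPositiveForm (slotForm Φ a b) where
  symm σ f := by
    rw [slotForm_apply, slotForm_apply,
      ← Equiv.sum_comp σ fun j => Φ fun i => slotOp μ 𝕜 r a b j i (f i)]
    congr 1
    refine Finset.sum_congr rfl fun j _ => ?_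
    rw [← h.symm σ fun i => slotOp μ 𝕜 r a b (σ j) i (f i)]
    congr 1
    funext i
    simp [slotOp]
  nonneg f hf := by
    rw [slotForm_apply]
    refine (nonnegReal_ofReal (by positivity)).mul (NonnegReal.sum fun j _ => h.nonneg _ fun i => ?_)
    by_cases hi : i = j
    · simpa [slotOp, hi] using (hf j).right.smul hb
    · simpa [slotOp, hi] using (hf i).left.smul ha

/-- Only `rotate` is delicate, since a complex or negative multiple of a positive polynomial need
not be positive. -/
theorem posPred_stable (hn : 2 ≤ n) (hr : r ≠ ∞) (hnr : (n : ℝ≥0∞) ≤ r) :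
    LpStable n (posPred 𝕜 n r) where
  isHomPoly _ _ _ _ hQ := by
    obtain ⟨Φ, h, _⟩ := hQ
    exact ⟨Φ, h⟩
  smul _ _ _ Q hQ c hc := by
    obtain ⟨Φ, h, hΦ⟩ := (isPositivePoly_iff Q).1 hQ
    refine (isPositivePoly_iff _).2 ⟨(c : 𝕜) • Φ, fun f => by rw [h]; rfl,
      fun σ f => congrArg ((c : 𝕜) * ·) (hΦ.symm σ f), fun f hf => ?_⟩
    · exact (nonnegReal_ofReal hc).mul (hΦ.nonneg f hf)
  sum _ _ _ _ μ ν Q Q' hQ hQ' := by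
    obtain ⟨Φ, h, hΦ⟩ := (isPositivePoly_iff Q).1 hQ
    obtain ⟨Φ', h', hΦ'⟩ := (isPositivePoly_iff Q').1 hQ'
    refine (isPositivePoly_iff _).2 ⟨Φ.compContinuousLinearMap (fun _ => lpLeft μ ν 𝕜 r) +
      Φ'.compContinuousLinearMap (fun _ => lpRight μ ν 𝕜 r), fun f => by simp [h, h'],
      fun σ f => ?_, fun f hf => ?_⟩
    · have h1 := hΦ.symm σ fun i => lpLeft μ ν 𝕜 r (f i)
      have h2 := hΦ'.symm σ fun i => lpRight μ ν 𝕜 r (f i)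
      simp [h1, h2]
    · exact (hΦ.nonneg _ fun i => (hf i).left).add (hΦ'.nonneg _ fun i => (hf i).right)
  diff _ _ μ Q hQ c hc := by
    obtain ⟨Φ, h, hΦ⟩ := (isPositivePoly_iff Q).1 hQ
    refine (isPositivePoly_iff _).2 ⟨Φ.compContinuousLinearMap
        (fun _ => lpLeft μ μ 𝕜 r + (c : 𝕜) • lpRight μ μ 𝕜 r) -
      Φ.compContinuousLinearMap (fun _ => lpLeft μ μ 𝕜 r), fun f => by simp [h],
      fun σ f => ?_, fun f hf => ?_⟩
    · have h1 := hΦ.symm σ fun i => lpLeft μ μ 𝕜 r (f i)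
      have h2 := hΦ.symm σ fun i => lpLeft μ μ 𝕜 r (f i) + (c : 𝕜) • lpRight μ μ 𝕜 r (f i)
      exact congrArg₂ (· - ·) h2 h1
    · exact hΦ.nonneg_sub _ _ (fun i => (hf i).left) fun i => (hf i).right.smul hc
  pow := by
    refine (isPositivePoly_iff _).2 ⟨(ContinuousMultilinearMap.mkPiAlgebra 𝕜 (Fin n)
      𝕜).compContinuousLinearMap fun _ => unitEval 𝕜 r, fun f => by simp [unitEval_apply],
      fun σ f => ?_, fun f hf => ?_⟩
    · simpa using Equiv.prod_comp σ fun i => unitEval 𝕜 r (f i)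
    · have h1 : ∀ i, NonnegReal (unitEval 𝕜 r (f i)) := fun i => by
        simpa [NonnegLp, unitEval_apply] using hf i
      simpa using NonnegReal.prod (s := Finset.univ) fun i _ => h1 i
  -- The operator sends `f` to `(a f, b c f)`, and the positive form `slotForm` reads one variable
  -- from the second component and the others from the first. The phase `c` therefore enters exactly
  -- once, through the operator and not through the form.
  rotate Ω _ μ Q hQ t ht c hc := by
    obtain ⟨Φ, h, hΦ⟩ := (isPositivePoly_iff Q).1 hQ
    have hn0 : 0 < (n : ℝ) := by positivity
    have : NeZero n := ⟨by omega⟩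
    have hn1 : 0 < (n : ℝ) - 1 := by
      have : (2 : ℝ) ≤ n := by exact_mod_cast hn
      linarith
    have hρn : (n : ℝ) ≤ r.toReal := by
      have := ENNReal.toReal_mono hr hnr
      simpa using this
    have hρ : 0 < r.toReal := hn0.trans_le hρn
    have scale : ∀ w : ℝ, 0 < w → ∃ s : ℝ, 0 < s ∧ s ^ r.toReal = w := fun w hw =>
      ⟨w ^ r.toReal⁻¹, by positivity, Real.rpow_inv_rpow hw.le hρ.ne'⟩
    -- The weights mirror the `n - 1` left slots and the single right slot. Their `r`-th powers sum
    -- to one, and `a` is positive because `n ≥ 2`.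
    obtain ⟨a, ha, haρ⟩ := scale ((n - 1) / n) (by positivity)
    obtain ⟨b, hb, hbρ⟩ := scale (1 / n) (by positivity)
    let T : Lp 𝕜 r μ →L[𝕜] Lp 𝕜 r (sumMeasure μ μ) :=
      lpPair ((a : 𝕜) • ContinuousLinearMap.id 𝕜 _) (((b : 𝕜) * c) • ContinuousLinearMap.id 𝕜 _)
    refine ⟨_, _, _, T, fun f => slotForm Φ a⁻¹ b⁻¹ fun _ => f, (isPositivePoly_iff _).2
      ⟨_, fun f => rfl, hΦ.slotForm (inv_nonneg.2 ha.le) (inv_nonneg.2 hb.le)⟩, ?_, ?_, fun f => ?_⟩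
    · funext f
      have h1 : ∀ j i : Fin n, slotOp μ 𝕜 r a⁻¹ b⁻¹ j i (T f) =
          (if i = j then c else 1 : 𝕜) • f := by
        intro j i
        have hc : ∀ a : ℝ, 0 < a → ((a⁻¹ : ℝ) : 𝕜) * (a : 𝕜) = 1 := fun a ha => by
          rw [← RCLike.ofReal_mul, inv_mul_cancel₀ ha.ne', RCLike.ofReal_one]
        by_cases hi : i = j
        · simp only [slotOp, if_pos hi, _root_.smul_apply, T, lpRight_lpPair, smul_smul,
            ContinuousLinearMap.id_apply]
          rw [← mul_assoc, hc b hb, one_mul]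
        · simp only [slotOp, if_neg hi, _root_.smul_apply, T, lpLeft_lpPair, smul_smul,
            ContinuousLinearMap.id_apply]
          rw [hc a ha]
      have h2 : ∀ j : Fin n, (Φ fun i => (if i = j then c else 1 : 𝕜) • f) = c * Q f := by
        intro j
        rw [h, Φ.map_smul_univ]
        simp
      rw [Function.comp_apply, slotForm_apply]
      simp only [h1, h2, Finset.sum_const, Finset.card_univ, Fintype.card_fin, nsmul_eq_mul]
      rw [← mul_assoc]
      have h3 : ((1 / n : ℝ) : 𝕜) * (n : 𝕜) = 1 := by
        have : (n : 𝕜) = ((n : ℝ) : 𝕜) := by simp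
        rw [this, ← RCLike.ofReal_mul, one_div_mul_cancel hn0.ne', RCLike.ofReal_one]
      rw [h3, one_mul]
    · refine norm_lpPair_le hr _ _ (a := a) (b := b) ?_ ?_ zero_le_one ?_
      · rw [norm_smul, RCLike.norm_ofReal, abs_of_pos ha]
        exact mul_le_of_le_one_right ha.le ContinuousLinearMap.norm_id_le
      · rw [norm_smul, norm_mul, hc, mul_one, RCLike.norm_ofReal, abs_of_pos hb]
        exact mul_le_of_le_one_right hb.le ContinuousLinearMap.norm_id_le
      · rw [haρ, hbρ, ← add_div, sub_add_cancel, div_self hn0.ne', Real.one_rpow]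
    · have h1 : ∀ j : Fin n, ‖Φ fun i => slotOp μ 𝕜 r a⁻¹ b⁻¹ j i f‖ ≤ t * ‖f‖ ^ n := by
        intro j
        refine (norm_positive_form_le hr hρn Φ hΦ.symm hΦ.nonneg (fun f => by
          rw [← h]; exact ht f) _).trans_eq ?_
        congr 2
        have h2 : ∀ i : Fin n, ‖slotOp μ 𝕜 r a⁻¹ b⁻¹ j i f‖ ^ r.toReal =
            if i = j then n * ‖lpRight μ μ 𝕜 r f‖ ^ r.toReal else
              n / (n - 1) * ‖lpLeft μ μ 𝕜 r f‖ ^ r.toReal := by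
          intro i
          have hc : ∀ a : ℝ, 0 < a → ∀ g : Lp 𝕜 r μ, ‖((a⁻¹ : ℝ) : 𝕜) • g‖ ^ r.toReal =
              (a ^ r.toReal)⁻¹ * ‖g‖ ^ r.toReal := fun a ha g => by
            rw [norm_smul, RCLike.norm_ofReal, abs_of_pos (inv_pos.2 ha),
              Real.mul_rpow (inv_nonneg.2 ha.le) (norm_nonneg _), Real.inv_rpow ha.le]
          by_cases hi : i = j
          · simp only [slotOp, if_pos hi, _root_.smul_apply]
            rw [hc b hb, hbρ, one_div, inv_inv]
          · simp only [slotOp, if_neg hi, _root_.smul_apply]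
            rw [hc a ha, haρ, inv_div]
        -- With these weights the mean in `norm_positive_form_le` is exactly the norm of `f` in the
        -- direct sum, so the norm bound `t` is preserved.
        have h3 : (1 / n : ℝ) * ∑ i : Fin n, ‖slotOp μ 𝕜 r a⁻¹ b⁻¹ j i f‖ ^ r.toReal =
            ‖f‖ ^ r.toReal := by
          simp only [h2]
          rw [← Finset.add_sum_erase _ _ (Finset.mem_univ j), if_pos rfl,
            Finset.sum_congr rfl fun i hi => if_neg (Finset.ne_of_mem_erase hi),
            Finset.sum_const, Finset.card_erase_of_mem (Finset.mem_univ j), Finset.card_univ,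
            Fintype.card_fin, nsmul_eq_mul, Nat.cast_sub (by omega), Nat.cast_one,
            lpSum_norm_rpow _ _ hr]
          field_simp
          ring
        rw [h3, ← Real.rpow_mul (norm_nonneg _), mul_one_div_cancel hρ.ne', Real.rpow_one]
      change ‖slotForm Φ a⁻¹ b⁻¹ fun _ => f‖ ≤ _
      rw [slotForm_apply, norm_mul, RCLike.norm_ofReal, abs_of_pos (by positivity)]
      refine (mul_le_mul_of_nonneg_left ((norm_sum_le _ _).trans
        (Finset.sum_le_sum fun j _ => h1 j)) (by positivity)).trans_eq ?_
      simp only [Finset.sum_const, Finset.card_univ, Fintype.card_fin, nsmul_eq_mul]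
      rw [← mul_assoc, one_div_mul_cancel hn0.ne', one_mul]

end Stable

end SymRN

end

noncomputable section

namespace SymRN

open MeasureTheory

/-! ### The Cauchy property for `r < ∞` -/

section Blocks

/-- Iterate the hypothesis, starting each search where the previous block ended. -/
theorem exists_blocks {B : ℕ → ℕ → Prop} (h : ∀ N₀, ∃ N ≥ N₀, ∃ N' ≥ N, B N N') :
    ∃ a b : ℕ → ℕ, ∀ k, a k ≤ b k ∧ b k ≤ a (k + 1) ∧ B (a k) (b k) := by
  choose f hf g hg hB using h
  let s : ℕ → ℕ := fun k => Nat.rec 0 (fun _ m => g m) k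
  exact ⟨fun k => f (s k), fun k => g (s k), fun k => ⟨hg _, hf (s (k + 1)), hB _⟩⟩

/-- An index lies in at most one block. The sharper bound by the indicator of `i < a m` is what
carries the induction. -/
theorem sum_indicator_blocks_le {a b : ℕ → ℕ} (h : ∀ k, a k ≤ b k ∧ b k ≤ a (k + 1)) (m i : ℕ) :
    (∑ k ∈ Finset.range m, if a k ≤ i ∧ i < b k then (1 : ℝ) else 0) ≤
      if i < a m then 1 else 0 := by
  induction m with
  | zero => rw [Finset.range_zero, Finset.sum_empty]; split_ifs <;> norm_num
  | succ m ih =>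
    rw [Finset.sum_range_succ]
    obtain ⟨h1, h2⟩ := h m
    by_cases hi : i < a m
    · rw [if_pos hi] at ih
      rw [if_neg (by omega), if_pos (by omega), add_zero]
      exact ih
    · rw [if_neg hi] at ih
      by_cases hi' : i < b m
      · rw [if_pos ⟨by omega, hi'⟩, if_pos (by omega)]
        linarith
      · rw [if_neg (by omega), add_zero]
        exact ih.trans (by split_ifs <;> norm_num)

variable {𝕜 : Type} [RCLike 𝕜]

theorem block_le {a b : ℕ → ℕ} (h : ∀ k, a k ≤ b k ∧ b k ≤ a (k + 1)) {k m : ℕ} (hk : k < m) :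
    b k ≤ a m :=
  (h k).2.trans (monotone_nat_of_le_succ (fun k => (h k).1.trans (h k).2) hk)

/-- The coordinate projection of `c_0` onto the coordinates in `[a, b)`. -/
def czBlock (𝕜 : Type) [RCLike 𝕜] (a b : ℕ) : CZero 𝕜 →L[𝕜] CZero 𝕜 := czTrunc 𝕜 b - czTrunc 𝕜 a

theorem czBlock_apply {a b : ℕ} (h : a ≤ b) (x : CZero 𝕜) (i : ℕ) :
    czBlock 𝕜 a b x i = if a ≤ i ∧ i < b then x i else 0 := by
  change czTrunc 𝕜 b x i - czTrunc 𝕜 a x i = _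
  rw [czTrunc_apply, czTrunc_apply]
  by_cases h1 : i < a
  · rw [if_pos (by omega), if_pos h1, if_neg (by omega), sub_self]
  · rw [if_neg h1, sub_zero]
    exact if_congr (by omega) rfl rfl

theorem czero_sum_apply {ι : Type*} (s : Finset ι) (x : ι → CZero 𝕜) (i : ℕ) :
    (∑ k ∈ s, x k) i = ∑ k ∈ s, x k i := by
  classical
  induction s using Finset.induction_on with
  | empty => rfl
  | insert k s hk ih => rw [Finset.sum_insert hk, Finset.sum_insert hk, ← ih]; rfl

theorem norm_sum_blocks_le {a b : ℕ → ℕ} (h : ∀ k, a k ≤ b k ∧ b k ≤ a (k + 1)) (m : ℕ)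
    (x : ℕ → CZero 𝕜) (hx : ∀ k, ‖x k‖ ≤ 1) (c : ℕ → 𝕜) (hc : ∀ k, ‖c k‖ ≤ 1) :
    ‖∑ k ∈ Finset.range m, c k • czBlock 𝕜 (a k) (b k) (x k)‖ ≤ 1 := by
  refine (norm_czero_le zero_le_one).2 fun i => ?_
  rw [czero_sum_apply]
  refine (norm_sum_le _ _).trans ((Finset.sum_le_sum fun k _ => ?_).trans
    ((sum_indicator_blocks_le h m i).trans (by split_ifs <;> norm_num)))
  change ‖c k * czBlock 𝕜 (a k) (b k) (x k) i‖ ≤ _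
  rw [czBlock_apply (h k).1]
  split_ifs
  · rw [norm_mul]
    exact mul_le_one₀ (hc k) (norm_nonneg _) ((norm_apply_le _ _).trans (hx k))
  · simp

/-- Clarkson's inequality for scalars: superadditivity of `t^{ρ/2}`, the parallelogram law and
convexity of `t^{ρ/2}`, all applied to squares. -/
theorem two_mul_rpow_add_le {ρ : ℝ} (hρ : 2 ≤ ρ) (a b : 𝕜) :
    2 * (‖a‖ ^ ρ + ‖b‖ ^ ρ) ≤ ‖a + b‖ ^ ρ + ‖a - b‖ ^ ρ := by
  have h1 : 1 ≤ ρ / 2 := by linarith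
  have hsq : ∀ x : ℝ, 0 ≤ x → (x ^ 2) ^ (ρ / 2) = x ^ ρ := fun x hx => by
    rw [← Real.rpow_natCast, ← Real.rpow_mul hx]
    congr 1
    push_cast
    ring
  have h2 := Real.add_rpow_le_rpow_add (p := ρ / 2) (sq_nonneg ‖a‖) (sq_nonneg ‖b‖) h1
  rw [hsq _ (norm_nonneg _), hsq _ (norm_nonneg _)] at h2
  have h3 := (convexOn_rpow h1).2 (Set.mem_Ici.2 (sq_nonneg ‖a + b‖))
    (Set.mem_Ici.2 (sq_nonneg ‖a - b‖)) (by norm_num : (0 : ℝ) ≤ 1 / 2)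
    (by norm_num : (0 : ℝ) ≤ 1 / 2) (by norm_num)
  simp only [smul_eq_mul] at h3
  rw [hsq _ (norm_nonneg _), hsq _ (norm_nonneg _)] at h3
  have h4 := parallelogram_law_with_norm 𝕜 a b
  have h5 : 1 / 2 * ‖a + b‖ ^ 2 + 1 / 2 * ‖a - b‖ ^ 2 = ‖a‖ ^ 2 + ‖b‖ ^ 2 := by
    nlinarith
  rw [h5] at h3
  linarith

variable {r : ℝ≥0∞} [Fact (1 ≤ r)] {Ω : Type} [MeasurableSpace Ω] {μ : Measure Ω}

theorem lp_two_mul_rpow_add_le (hr : r ≠ ∞) (hρ : 2 ≤ r.toReal) (f g : Lp 𝕜 r μ) :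
    2 * (‖f‖ ^ r.toReal + ‖g‖ ^ r.toReal) ≤ ‖f + g‖ ^ r.toReal + ‖f - g‖ ^ r.toReal := by
  have hpt : ∀ x : 𝕜, ‖x‖ₑ ^ r.toReal = ENNReal.ofReal (‖x‖ ^ r.toReal) := fun x => by
    rw [← ENNReal.ofReal_rpow_of_nonneg (norm_nonneg _) (by positivity), ofReal_norm]
  have hmeas : ∀ f : Lp 𝕜 r μ, AEMeasurable (fun ω => ‖f ω‖ₑ ^ r.toReal) μ := fun f =>
    ((Lp.aestronglyMeasurable f).enorm).pow_const _
  rw [← ENNReal.ofReal_le_ofReal_iff (by positivity), ENNReal.ofReal_mul (by norm_num),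
    ENNReal.ofReal_add (by positivity) (by positivity),
    ENNReal.ofReal_add (by positivity) (by positivity), ofReal_norm_rpow hr, ofReal_norm_rpow hr,
    ofReal_norm_rpow hr, ofReal_norm_rpow hr, ← lintegral_add_left' (hmeas f),
    ← lintegral_add_left' (hmeas _), ← lintegral_const_mul' _ _ ENNReal.ofReal_ne_top]
  refine lintegral_mono_ae ?_
  filter_upwards [Lp.coeFn_add f g, Lp.coeFn_sub f g] with ω h1 h2
  rw [h1, h2, Pi.add_apply, Pi.sub_apply]
  simp only [hpt]
  rw [← ENNReal.ofReal_add (by positivity) (by positivity),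
    ← ENNReal.ofReal_add (by positivity) (by positivity), ← ENNReal.ofReal_mul (by norm_num)]
  exact ENNReal.ofReal_le_ofReal (two_mul_rpow_add_le hρ _ _)

/-- A lower `r`-estimate in `L_r`, with signs chosen one at a time: by Clarkson's inequality the
better of the two signs gains at least `‖f m‖^r`. -/
theorem exists_signs (hr : r ≠ ∞) (hρ : 2 ≤ r.toReal) (m : ℕ) (f : ℕ → Lp 𝕜 r μ) :
    ∃ c : ℕ → 𝕜, (∀ k, ‖c k‖ ≤ 1) ∧
      ∑ k ∈ Finset.range m, ‖f k‖ ^ r.toReal ≤ ‖∑ k ∈ Finset.range m, c k • f k‖ ^ r.toReal := by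
  induction m with
  | zero =>
    refine ⟨fun _ => 1, fun k => by simp, ?_⟩
    rw [Finset.range_zero, Finset.sum_empty]
    positivity
  | succ m ih =>
    obtain ⟨c, hc, h⟩ := ih
    have h1 := lp_two_mul_rpow_add_le hr hρ (∑ k ∈ Finset.range m, c k • f k) (f m)
    have h2 : ∀ u : 𝕜, ‖u‖ ≤ 1 → (∑ k ∈ Finset.range m, ‖f k‖ ^ r.toReal) + ‖f m‖ ^ r.toReal ≤
        ‖(∑ k ∈ Finset.range m, c k • f k) + u • f m‖ ^ r.toReal → ∃ c : ℕ → 𝕜,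
        (∀ k, ‖c k‖ ≤ 1) ∧ ∑ k ∈ Finset.range (m + 1), ‖f k‖ ^ r.toReal ≤
          ‖∑ k ∈ Finset.range (m + 1), c k • f k‖ ^ r.toReal := by
      intro u hu hle
      refine ⟨fun k => if k = m then u else c k, fun k => ?_, ?_⟩
      · dsimp only
        split_ifs
        exacts [hu, hc k]
      · rw [Finset.sum_range_succ, Finset.sum_range_succ]
        dsimp only
        rw [if_pos rfl]
        refine hle.trans_eq ?_
        congr 3
        refine Finset.sum_congr rfl fun k hk => ?_
        rw [if_neg (Finset.mem_range.1 hk).ne]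
    by_cases hle : (∑ k ∈ Finset.range m, ‖f k‖ ^ r.toReal) + ‖f m‖ ^ r.toReal ≤
        ‖(∑ k ∈ Finset.range m, c k • f k) + f m‖ ^ r.toReal
    · exact h2 1 (by simp) (by rwa [one_smul])
    · refine h2 (-1) (by simp) ?_
      rw [neg_one_smul, ← sub_eq_add_neg]
      linarith

/-- Otherwise choose nearly norming vectors on the `m` blocks. With suitable signs their sum has
norm at most one in `c_0`, since the blocks are disjoint, while its image has `r`-th power norm
exceeding `m δ^r ≥ 1`. -/
theorem exists_small_block (hr : r ≠ ∞) (hρ : 2 ≤ r.toReal) {a b : ℕ → ℕ}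
    (h : ∀ k, a k ≤ b k ∧ b k ≤ a (k + 1)) (U : CZero 𝕜 →L[𝕜] Lp 𝕜 r μ) (hU : ‖U‖ ≤ 1) {m : ℕ}
    {δ : ℝ} (hδ : 0 < δ) (hm : 1 ≤ m * δ ^ r.toReal) :
    ∃ k < m, ‖U.comp (czBlock 𝕜 (a k) (b k))‖ ≤ δ := by
  by_contra! hcon
  have h1 : ∀ k, ∃ x : CZero 𝕜, ‖x‖ ≤ 1 ∧ (k < m → δ < ‖U (czBlock 𝕜 (a k) (b k) x)‖) := by
    intro k
    by_cases hk : k < m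
    · obtain ⟨x, hx1, hx⟩ := ContinuousLinearMap.exists_lt_apply_of_lt_opNorm _ (hcon k hk)
      exact ⟨x, hx1.le, fun _ => hx⟩
    · exact ⟨0, by simp, fun hk' => absurd hk' hk⟩
  choose x hx1 hx using h1
  obtain ⟨c, hc, hle⟩ := exists_signs hr hρ m fun k => U (czBlock 𝕜 (a k) (b k) (x k))
  have h2 : ‖∑ k ∈ Finset.range m, c k • U (czBlock 𝕜 (a k) (b k) (x k))‖ ≤ 1 := by
    have h3 : ∑ k ∈ Finset.range m, c k • U (czBlock 𝕜 (a k) (b k) (x k)) =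
        U (∑ k ∈ Finset.range m, c k • czBlock 𝕜 (a k) (b k) (x k)) := by simp
    rw [h3]
    exact (U.le_opNorm _).trans (mul_le_one₀ hU (norm_nonneg _) (norm_sum_blocks_le h m x hx1 c hc))
  have h4 := hle.trans (Real.rpow_le_one (norm_nonneg _) h2 (by linarith))
  have hm0 : (Finset.range m).Nonempty := by
    rw [Finset.nonempty_range_iff]
    rintro rfl
    norm_num at hm
  have h5 : ∑ k ∈ Finset.range m, δ ^ r.toReal <
      ∑ k ∈ Finset.range m, ‖U (czBlock 𝕜 (a k) (b k) (x k))‖ ^ r.toReal :=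
    Finset.sum_lt_sum_of_nonempty hm0 fun k hk =>
      Real.rpow_lt_rpow hδ.le (hx k (Finset.mem_range.1 hk)) (by linarith)
  rw [Finset.sum_const, Finset.card_range, nsmul_eq_mul] at h5
  linarith

variable {n : ℕ} {K : LpPred 𝕜 r}
variable {E : Type} [NormedAddCommGroup E] [NormedSpace 𝕜 E]

/-- The increment is itself factored through `L_r ⊕ L_r`. The operator `x ↦ (B x, δ⁻¹ S x)` has norm
at most two although `S` is small, and the polynomial `(f, g) ↦ Q(f + δ g) - Q(f)` has norm of order
`δ`. -/
theorem LpStable.norm_diff_le (hK : LpStable n K) (hr : r ≠ ∞) {Q : Lp 𝕜 r μ → 𝕜}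
    (hQ : K Ω μ Q) {C δ : ℝ} (hC : 0 ≤ C) (hb : ∀ f, ‖Q f‖ ≤ C * ‖f‖ ^ n) (hδ : 0 < δ)
    (hδ1 : δ ≤ 1) (B S : E →L[𝕜] Lp 𝕜 r μ) (hB : ‖B‖ ≤ 1) (hS : ‖S‖ ≤ δ) :
    (factorClass n K).norm E (fun x => Q (B x + S x) - Q (B x)) ≤
      2 ^ n * polConst n * C * δ * 2 ^ n := by
  have h1 : (1 : ℝ) ≤ r.toReal := by
    simpa using ENNReal.toReal_mono hr (Fact.out : 1 ≤ r)
  have hc0 := polConst_nonneg n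
  let T : E →L[𝕜] Lp 𝕜 r (sumMeasure μ μ) := lpPair B (((δ⁻¹ : ℝ) : 𝕜) • S)
  let Q' : Lp 𝕜 r (sumMeasure μ μ) → 𝕜 := fun f =>
    Q (lpLeft μ μ 𝕜 r f + (δ : 𝕜) • lpRight μ μ 𝕜 r f) - Q (lpLeft μ μ 𝕜 r f)
  have hQ' : K _ _ Q' := hK.diff _ _ _ hQ δ hδ.le
  have hPQ : (fun x => Q (B x + S x) - Q (B x)) = Q' ∘ T := by
    funext x
    simp only [Q', T, Function.comp_apply, lpLeft_lpPair, lpRight_lpPair, _root_.smul_apply,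
      smul_smul]
    rw [← RCLike.ofReal_mul, mul_inv_cancel₀ hδ.ne', RCLike.ofReal_one, one_smul]
  have hT : ‖T‖ ≤ 2 := by
    refine norm_lpPair_le hr _ _ (a := 1) (b := 1) hB ?_ zero_le_two ?_
    · rw [norm_smul, RCLike.norm_ofReal, abs_of_pos (inv_pos.2 hδ), inv_mul_le_iff₀ hδ, mul_one]
      exact hS
    · rw [Real.one_rpow]
      have := Real.rpow_le_rpow_of_exponent_le (one_le_two : (1 : ℝ) ≤ 2) h1
      rw [Real.rpow_one] at this
      linarith
  have hbound : ∀ f, ‖Q' f‖ ≤ 2 ^ n * polConst n * C * δ * ‖f‖ ^ n := by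
    intro f
    by_cases hf : f = 0
    · have : Q' f = 0 := by simp [Q', hf]
      rw [this, norm_zero]
      positivity
    · refine (hK.isHomPoly _ _ _ hQ).norm_add_sub_le (normSeminorm 𝕜 _) hC hb (norm_pos_iff.2 hf)
        hδ hδ1 _ _ (norm_lpLeft_le f) ?_
      change ‖(δ : 𝕜) • lpRight μ μ 𝕜 r f‖ ≤ _
      rw [norm_smul, RCLike.norm_ofReal, abs_of_pos hδ]
      exact mul_le_mul_of_nonneg_left (norm_lpRight_le f) hδ.le
  rw [hPQ]
  exact (factorClass.norm_le T Q' hQ').trans (mul_le_mul (polyNorm_le (by positivity) hbound)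
    (pow_le_pow_left₀ (norm_nonneg _) hT n) (by positivity) (by positivity))

theorem czTrunc_czIncl_of_le {N M : ℕ} (h : N ≤ M) (x : Fin N → 𝕜) :
    czTrunc 𝕜 M (czIncl 𝕜 N x) = czIncl 𝕜 N x := by
  ext i
  rw [czTrunc_apply]
  split_ifs with hi
  · rfl
  · rw [czIncl_apply, dif_neg (by omega)]

theorem czTrunc_czTrunc_of_le {N M : ℕ} (h : N ≤ M) (x : CZero 𝕜) :
    czTrunc 𝕜 M (czTrunc 𝕜 N x) = czTrunc 𝕜 N x :=
  czTrunc_czIncl_of_le h _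

theorem norm_czTrunc_le (N : ℕ) : ‖czTrunc 𝕜 N‖ ≤ 1 :=
  ((czIncl 𝕜 N).opNorm_comp_le _).trans
    (mul_le_one₀ (norm_czIncl_le N) (norm_nonneg _) (norm_czProj_le N))

/-- The uniform bound `C` gives, for `M` beyond any prescribed number of bad blocks, one
factorization of `P` on `ℓ_∞^M` of controlled size. Its operator is small on some bad block, and
there the increment estimate contradicts badness. -/
theorem LpStable.cauchyProperty (hK : LpStable n K) (hr : r ≠ ∞) (hρ : 2 ≤ r.toReal) :
    (factorClass n K).CauchyProperty n := by
  intro P hP C hPC ε hε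
  by_contra! hcon
  obtain ⟨a, b, hab⟩ := exists_blocks hcon
  have hab' : ∀ k, a k ≤ b k ∧ b k ≤ a (k + 1) := fun k => ⟨(hab k).1, (hab k).2.1⟩
  have hC : 0 ≤ C := (factorClass.norm_nonneg _).trans (hPC 0).2
  have hc0 := polConst_nonneg n
  -- This is the constant of `LpStable.norm_diff_le` with `δ` removed, so that `D δ ≤ ε` below; `C +
  -- 1` replaces `C` because a factorization needs a strict inequality.
  set D : ℝ := 2 ^ n * polConst n * (C + 1) * 2 ^ n with hD
  have hD0 : 0 ≤ D := by positivity
  set δ : ℝ := min 1 (ε / (D + 1)) with hδdef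
  have hδ : 0 < δ := lt_min one_pos (by positivity)
  have hδ1 : δ ≤ 1 := min_le_left _ _
  obtain ⟨m, hm⟩ := exists_nat_ge (1 / δ ^ r.toReal)
  rw [div_le_iff₀ (by positivity)] at hm
  -- All of the first `m` blocks end at or before `a m`.
  set M := a m with hM
  obtain ⟨Ω, _, μ, T, Q, hQ, hPQ, hT, hQb⟩ :=
    hK.exists_factorsWith (hPC M).1 ((hPC M).2.trans_lt (lt_add_one C))
  let U : CZero 𝕜 →L[𝕜] Lp 𝕜 r μ := T.comp (czProj 𝕜 M)
  have hU : ‖U‖ ≤ 1 :=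
    (T.opNorm_comp_le _).trans (mul_le_one₀ hT (norm_nonneg _) (norm_czProj_le M))
  have hPU : ∀ x, czTrunc 𝕜 M x = x → P x = Q (U x) := by
    intro x hx
    conv_lhs => rw [← hx]
    exact congrFun hPQ (czProj 𝕜 M x)
  obtain ⟨k, hk, hsmall⟩ := exists_small_block hr hρ hab' U hU hδ hm
  have hbM : b k ≤ M := block_le hab' hk
  have hι := norm_czIncl_le (𝕜 := 𝕜) (b k)
  refine (hab k).2.2.not_ge ?_
  have hfun : (fun x => P (czIncl 𝕜 (b k) x) - P (czTrunc 𝕜 (a k) (czIncl 𝕜 (b k) x))) = fun x =>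
      Q ((U.comp (czTrunc 𝕜 (a k))).comp (czIncl 𝕜 (b k)) x +
        (U.comp (czBlock 𝕜 (a k) (b k))).comp (czIncl 𝕜 (b k)) x) -
      Q ((U.comp (czTrunc 𝕜 (a k))).comp (czIncl 𝕜 (b k)) x) := by
    funext x
    have h1 : czIncl 𝕜 (b k) x = czTrunc 𝕜 (a k) (czIncl 𝕜 (b k) x) +
        czBlock 𝕜 (a k) (b k) (czIncl 𝕜 (b k) x) := by
      rw [czBlock, _root_.sub_apply, add_sub_cancel, czTrunc_czIncl_of_le le_rfl]
    rw [hPU _ (czTrunc_czIncl_of_le hbM x),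
      hPU _ (czTrunc_czTrunc_of_le ((hab k).1.trans hbM) _)]
    conv_lhs => rw [h1, map_add]
    simp only [ContinuousLinearMap.comp_apply]
    rw [← h1]
  rw [hfun]
  refine (hK.norm_diff_le hr hQ (by positivity) hQb hδ hδ1 _ _ ?_ ?_).trans ?_
  · refine (ContinuousLinearMap.opNorm_comp_le _ _).trans (mul_le_one₀ ?_ (norm_nonneg _) hι)
    exact (ContinuousLinearMap.opNorm_comp_le _ _).trans
      (mul_le_one₀ hU (norm_nonneg _) (norm_czTrunc_le _))
  · exact (ContinuousLinearMap.opNorm_comp_le _ _).trans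
      ((mul_le_mul hsmall hι (norm_nonneg _) hδ.le).trans_eq (mul_one δ))
  · calc 2 ^ n * polConst n * (C + 1) * δ * 2 ^ n = D * δ := by rw [hD]; ring
      _ ≤ D * (ε / (D + 1)) := by gcongr; exact min_le_right _ _
      _ = ε * (D / (D + 1)) := by ring
      _ ≤ ε := mul_le_of_le_one_right hε.le ((div_le_one (by positivity)).2 (by linarith))

end Blocks

end SymRN

end

noncomputable section

namespace SymRN

open MeasureTheory Filter Topology

/-! ### Multilinear forms on `c_0` and the Cauchy property for `r = ∞` -/

section CZeroForms

variable {𝕜 : Type} [RCLike 𝕜] {n : ℕ}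

/-- A sequence in `c_0` that tends to `0` in every coordinate. -/
def CoordNull (u : ℕ → CZero 𝕜) : Prop := ∀ i, Tendsto (fun k => u k i) atTop (𝓝 0)

/-- A sequence in `c_0` that is a Cauchy sequence in every coordinate. -/
def CoordCauchy (u : ℕ → CZero 𝕜) : Prop := ∀ i, CauchySeq fun k => u k i

/-- The vector `X` is small on a tail and `u k` is eventually small on the remaining finite head, so
the norms do not add up. The strict bound `B + 1` is preserved, which lets the construction be
iterated. -/
theorem CoordNull.eventually_norm_add_lt {u : ℕ → CZero 𝕜} (hu : CoordNull u) {B : ℝ}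
    (hB : ∀ k, ‖u k‖ ≤ B) (X : CZero 𝕜) (hX : ‖X‖ < B + 1) :
    ∀ᶠ k in atTop, ‖u k + X‖ < B + 1 := by
  have hB0 : 0 ≤ B := (norm_nonneg _).trans (hB 0)
  obtain ⟨N, hN⟩ := Metric.tendsto_atTop.1 (czero_tendsto_zero X) (1 / 2) (by norm_num)
  have h1 : ∀ᶠ k in atTop, ∀ i ∈ Finset.range N, ‖u k i‖ < (B + 1 - ‖X‖) / 2 := by
    rw [Finset.eventually_all]
    intro i _
    have := (hu i).norm
    rw [norm_zero] at this
    exact this.eventually_lt_const (by linarith)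
  filter_upwards [h1] with k hk
  have h2 : ‖u k + X‖ ≤ max (B + 1 / 2) ((B + 1 + ‖X‖) / 2) := by
    refine (norm_czero_le (by positivity)).2 fun i => ?_
    change ‖u k i + X i‖ ≤ _
    by_cases hi : i < N
    · refine le_max_of_le_right ((norm_add_le _ _).trans ?_)
      have := hk i (Finset.mem_range.2 hi)
      have := norm_apply_le X i
      linarith
    · refine le_max_of_le_left ((norm_add_le _ _).trans ?_)
      have h3 := hN i (not_lt.1 hi)
      rw [dist_zero_right] at h3
      have h4 := (norm_apply_le (u k) i).trans (hB k)
      linarith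
  exact h2.trans_lt (max_lt (by linarith) (by linarith))

theorem exists_rotation (z : 𝕜) : ∃ c : 𝕜, ‖c‖ = 1 ∧ c * z = (‖z‖ : 𝕜) := by
  by_cases hz : z = 0
  · exact ⟨1, by simp, by simp [hz]⟩
  · have hz' : (‖z‖ : 𝕜) ≠ 0 := by simpa using hz
    exact ⟨(‖z‖ : 𝕜) * z⁻¹, by simp [hz], by rw [mul_assoc, inv_mul_cancel₀ hz, mul_one]⟩

/-- A gliding hump argument, by induction on the set of null slots. If the values stay at least `ε`
infinitely often, suitable terms are added up one after the other. The mixed terms vanish in the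
limit by induction, so the form grows by `ε/2` at each step while the arguments stay bounded. -/
theorem tendsto_form_of_coordNull (Φ : ContinuousMultilinearMap 𝕜 (fun _ : Fin n => CZero 𝕜) 𝕜)
    (T : Finset (Fin n)) : T.Nonempty → ∀ (x : ℕ → Fin n → CZero 𝕜) (B : ℝ),
      (∀ k i, ‖x k i‖ ≤ B) → (∀ i ∈ T, CoordNull fun k => x k i) →
      (∀ i ∉ T, ∀ k, x k i = x 0 i) → Tendsto (fun k => Φ (x k)) atTop (𝓝 0) := by
  induction T using Finset.strongInduction with
  | H T ih =>
    intro hT x B hB hnull hconst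
    obtain ⟨i₀, hi₀⟩ := hT
    have hB0 : 0 ≤ B := (norm_nonneg _).trans (hB 0 i₀)
    by_contra hcon
    rw [Metric.tendsto_nhds] at hcon
    push Not at hcon
    obtain ⟨ε, hε, hfreq⟩ := hcon
    choose c hc1 hc using fun k => exists_rotation (Φ (x k))
    -- A phase inserted in one slot makes all values nonnegative reals, so that the contributions
    -- accumulate.
    set x' : ℕ → Fin n → CZero 𝕜 := fun k => Function.update (x k) i₀ (c k • x k i₀) with hx'
    have hval : ∀ k, Φ (x' k) = (‖Φ (x k)‖ : 𝕜) := fun k => by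
      rw [hx']
      dsimp only
      rw [Φ.map_update_smul, Function.update_eq_self, smul_eq_mul, hc]
    have hB' : ∀ k i, ‖x' k i‖ ≤ B := fun k i => by
      by_cases hi : i = i₀
      · subst hi
        simp only [hx', Function.update_self, norm_smul, hc1, one_mul, hB]
      · simp only [hx', Function.update_of_ne hi, hB]
    have hnull' : ∀ i ∈ T, CoordNull fun k => x' k i := fun i hi => by
      by_cases hi' : i = i₀
      · subst hi'
        intro j
        rw [tendsto_zero_iff_norm_tendsto_zero]
        have h1 : ∀ k, ‖x' k i j‖ = ‖x k i j‖ := fun k => by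
          simp only [hx', Function.update_self]
          change ‖c k * x k i j‖ = _
          rw [norm_mul, hc1, one_mul]
        simp only [h1]
        simpa using (hnull i hi j).norm
      · simpa only [hx', Function.update_of_ne hi'] using hnull i hi
    have hconst' : ∀ i ∉ T, ∀ k, x' k i = x 0 i := fun i hi k => by
      have hi' : i ≠ i₀ := fun h => hi (h ▸ hi₀)
      simp only [hx', Function.update_of_ne hi']
      exact hconst i hi k
    have hstep : ∀ J : ℕ, ∃ X : Fin n → CZero 𝕜, (∀ i ∉ T, X i = x 0 i) ∧
        (∀ i ∈ T, ‖X i‖ < B + 1) ∧ J * (ε / 2) ≤ RCLike.re (Φ X) := by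
      intro J
      induction J with
      | zero =>
        refine ⟨T.piecewise 0 (x 0), fun i hi => by simp [hi], fun i hi => ?_, ?_⟩
        · simp only [Finset.piecewise_eq_of_mem _ _ _ hi, Pi.zero_apply, norm_zero]
          positivity
        · rw [Φ.map_coord_zero i₀ (by simp [hi₀])]
          simp
      | succ J hJ =>
        obtain ⟨X, hX1, hX2, hX3⟩ := hJ
        have h1 : ∀ᶠ k in atTop, ∀ i ∈ T, ‖x' k i + X i‖ < B + 1 := by
          rw [Finset.eventually_all]
          intro i hi
          exact (hnull' i hi).eventually_norm_add_lt (fun k => hB' k i) (X i) (hX2 i hi)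
        -- These are the mixed terms, with the new vector in some but not all slots of `T`. The
        -- accumulated `X` is fixed while `k` varies, so the induction hypothesis applies.
        have h2 : Tendsto (fun k => ∑ s ∈ (T.powerset.erase ∅).erase T, Φ (s.piecewise (x' k) X))
            atTop (𝓝 0) := by
          rw [← Finset.sum_const_zero (s := (T.powerset.erase ∅).erase T)]
          refine tendsto_finsetSum _ fun s hs => ?_
          obtain ⟨hs1, hs2, hs3⟩ : s ≠ T ∧ s ≠ ∅ ∧ s ⊆ T := by simpa using hs
          refine ih s (hs3.ssubset_of_ne hs1) (Finset.nonempty_of_ne_empty hs2) _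
            (max (B + 1) (∑ i, ‖X i‖)) (fun k i => ?_) (fun i hi => ?_) fun i hi k => ?_
          · by_cases hi : i ∈ s
            · simp only [Finset.piecewise_eq_of_mem _ _ _ hi]
              exact le_max_of_le_left ((hB' k i).trans (by linarith))
            · simp only [Finset.piecewise_eq_of_notMem _ _ _ hi]
              exact le_max_of_le_right
                (Finset.single_le_sum (fun i _ => norm_nonneg (X i)) (Finset.mem_univ i))
          · simpa only [Finset.piecewise_eq_of_mem _ _ _ hi] using hnull' i (hs3 hi)
          · simp only [Finset.piecewise_eq_of_notMem _ _ _ hi]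
        have h3 := h2.norm
        rw [norm_zero] at h3
        obtain ⟨k, hk1, hk2, hk3⟩ := (hfreq.and_eventually
          (h1.and (h3.eventually_lt_const (half_pos hε)))).exists
        rw [dist_zero_right] at hk1
        refine ⟨T.piecewise (x' k + X) X, fun i hi => ?_, fun i hi => ?_, ?_⟩
        · rw [Finset.piecewise_eq_of_notMem _ _ _ hi, hX1 i hi]
        · rw [Finset.piecewise_eq_of_mem _ _ _ hi]
          exact hk2 i hi
        · have hTne : T ≠ ∅ := Finset.nonempty_iff_ne_empty.1 ⟨i₀, hi₀⟩
          rw [Φ.map_piecewise_add, ← Finset.add_sum_erase _ _ (Finset.empty_mem_powerset T),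
            ← Finset.add_sum_erase _ _
              (Finset.mem_erase.2 ⟨hTne, Finset.mem_powerset_self T⟩), Finset.piecewise_empty]
          have h4 : T.piecewise (x' k) X = x' k := by
            funext i
            by_cases hi : i ∈ T
            · rw [Finset.piecewise_eq_of_mem _ _ _ hi]
            · rw [Finset.piecewise_eq_of_notMem _ _ _ hi, hX1 i hi, hconst' i hi]
          rw [h4, hval, map_add, map_add, RCLike.ofReal_re]
          have h5 := (abs_le.1 ((RCLike.abs_re_le_norm _).trans hk3.le)).1
          push_cast
          linarith
    obtain ⟨J, hJ⟩ := exists_nat_gt (‖Φ‖ * (max (B + 1) (∑ i, ‖x 0 i‖)) ^ n / (ε / 2))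
    rw [div_lt_iff₀ (by positivity)] at hJ
    obtain ⟨X, hX1, hX2, hX3⟩ := hstep J
    have h1 : ‖Φ X‖ ≤ ‖Φ‖ * (max (B + 1) (∑ i, ‖x 0 i‖)) ^ n := by
      refine Φ.le_opNorm_mul_pow_of_le ((pi_norm_le_iff_of_nonneg (by positivity)).2 fun i => ?_)
      by_cases hi : i ∈ T
      · exact le_max_of_le_left (hX2 i hi).le
      · rw [hX1 i hi]
        exact le_max_of_le_right
          (Finset.single_le_sum (fun i _ => norm_nonneg (x 0 i)) (Finset.mem_univ i))
    exact absurd (hX3.trans ((RCLike.re_le_norm _).trans h1)) hJ.not_ge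

/-- Induction on the Cauchy slots. Freezing slot `s` at time `j` gives a form value that tends to
zero, so a later time `φ j` exists at which the frozen value is below `ε/2` and the true value at
least `ε`. The difference of the two arguments in slot `s` is coordinatewise null, which moves `s`
among the null slots and contradicts the induction hypothesis. -/
theorem tendsto_form_of_coordCauchy (Φ : ContinuousMultilinearMap 𝕜 (fun _ : Fin n => CZero 𝕜) 𝕜)
    (S : Finset (Fin n)) : ∀ (T : Finset (Fin n)), T.Nonempty →
      ∀ (x : ℕ → Fin n → CZero 𝕜) (B : ℝ),
      (∀ k i, ‖x k i‖ ≤ B) → (∀ i ∈ T, CoordNull fun k => x k i) →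
      (∀ i ∈ S, CoordCauchy fun k => x k i) →
      (∀ i ∉ S, i ∉ T → ∀ k, x k i = x 0 i) → Tendsto (fun k => Φ (x k)) atTop (𝓝 0) := by
  induction S using Finset.induction_on with
  | empty =>
    intro T hT x B hB hnull _ hconst
    exact tendsto_form_of_coordNull Φ T hT x B hB hnull fun i => hconst i (Finset.notMem_empty i)
  | insert s S hs ih =>
    intro T hT x B hB hnull hcauchy hconst
    by_cases hsT : s ∈ T
    · refine ih T hT x B hB hnull (fun i hi => hcauchy i (Finset.mem_insert_of_mem hi))
        fun i hi hi' => hconst i ?_ hi'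
      rw [Finset.mem_insert, not_or]
      exact ⟨fun h => hi' (h ▸ hsT), hi⟩
    · by_contra hcon
      rw [Metric.tendsto_nhds] at hcon
      push Not at hcon
      obtain ⟨ε, hε, hfreq⟩ := hcon
      have hfix : ∀ j, Tendsto (fun k => Φ (Function.update (x k) s (x j s))) atTop (𝓝 0) := by
        intro j
        refine ih T hT _ B (fun k i => ?_) (fun i hi => ?_) (fun i hi => ?_) fun i hi hi' k => ?_
        · by_cases h : i = s
          · subst h
            simpa using hB j i
          · simpa [h] using hB k i
        · have h : i ≠ s := fun h => hsT (h ▸ hi)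
          simpa [h] using hnull i hi
        · have h : i ≠ s := fun h => hs (h ▸ hi)
          simpa [h] using hcauchy i (Finset.mem_insert_of_mem hi)
        · by_cases h : i = s
          · subst h
            simp
          · simpa [h] using hconst i (by simp [h, hi]) hi' k
      have hchoose : ∀ j, ∃ k ≥ j, ε ≤ ‖Φ (x k)‖ ∧
          ‖Φ (Function.update (x k) s (x j s))‖ < ε / 2 := by
        intro j
        have h1 := (hfix j).norm
        rw [norm_zero] at h1
        obtain ⟨k, hk1, hk2, hk3⟩ := (hfreq.and_eventually
          ((eventually_ge_atTop j).and (h1.eventually_lt_const (half_pos hε)))).exists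
        rw [dist_zero_right] at hk1
        exact ⟨k, hk2, hk1, hk3⟩
      choose φ hφ h1 h2 using hchoose
      have hφt : Tendsto φ atTop atTop := tendsto_atTop_mono hφ tendsto_id
      have hz : Tendsto (fun j => Φ (Function.update (x (φ j)) s (x (φ j) s - x j s))) atTop
          (𝓝 0) := by
        refine ih (insert s T) ⟨s, Finset.mem_insert_self s T⟩ _ (B + B) (fun k i => ?_)
          (fun i hi => ?_) (fun i hi => ?_) fun i hi hi' k => ?_
        · by_cases h : i = s
          · subst h
            simpa using (norm_sub_le _ _).trans (add_le_add (hB (φ k) i) (hB k i))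
          · have h3 := hB (φ k) i
            have h4 := (norm_nonneg _).trans h3
            simpa [h] using h3.trans (by linarith)
        · by_cases h : i = s
          · subst h
            intro c
            simp only [Function.update_self]
            have h3 := hcauchy i (Finset.mem_insert_self i S) c
            obtain ⟨a, ha⟩ := cauchySeq_tendsto_of_complete h3
            have h4 := (ha.comp hφt).sub ha
            rw [sub_self] at h4
            exact h4
          · have h3 := hnull i (Finset.mem_of_mem_insert_of_ne hi h)
            simp only [Function.update_of_ne h]
            exact fun c => (h3 c).comp hφt
        · have h : i ≠ s := fun h => hs (h ▸ hi)
          simp only [Function.update_of_ne h]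
          exact fun c => (hcauchy i (Finset.mem_insert_of_mem hi) c).comp_tendsto hφt
        · rw [Finset.mem_insert, not_or] at hi'
          simp only [Function.update_of_ne hi'.1]
          have h3 := hconst i (by simp [hi'.1, hi]) hi'.2
          rw [h3 (φ k), h3 (φ 0)]
      have h3 := hz.norm
      rw [norm_zero] at h3
      obtain ⟨j, hj⟩ := (h3.eventually_lt_const (half_pos hε)).exists
      rw [Φ.map_update_sub, Function.update_eq_self] at hj
      have h4 := norm_sub_norm_le (Φ (x (φ j))) (Φ (Function.update (x (φ j)) s (x j s)))
      have h5 := h1 j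
      have h6 := h2 j
      linarith

/-- Compactness of a countable product of balls. The coordinatewise limit need not lie in `c_0`,
which is why Cauchy sequences are used. -/
theorem exists_subseq_coordCauchy (x : ℕ → CZero 𝕜) {B : ℝ} (hB : ∀ k, ‖x k‖ ≤ B) :
    ∃ φ : ℕ → ℕ, StrictMono φ ∧ CoordCauchy fun k => x (φ k) := by
  have hcomp : IsCompact (Set.univ.pi fun _ : ℕ => Metric.closedBall (0 : 𝕜) B) :=
    isCompact_univ_pi fun _ => isCompact_closedBall 0 B
  obtain ⟨a, -, φ, hφ, ha⟩ := hcomp.tendsto_subseq (x := fun k i => x k i) fun k i _ =>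
    mem_closedBall_zero_iff.2 ((norm_apply_le (x k) i).trans (hB k))
  exact ⟨φ, hφ, fun i => (((tendsto_pi_nhds.1 ha) i)).cauchySeq⟩

/-- Take counterexamples for ever larger truncations and pass to a coordinatewise Cauchy
subsequence. Then `x - y` is coordinatewise null, where `y` is the truncation, and every term in the
expansion of `P(x) - P(y)` contains `x - y` in some slot. -/
theorem IsHomPoly.exists_norm_sub_czTrunc_le {P : CZero 𝕜 → 𝕜} (hP : IsHomPoly n P) {ε : ℝ}
    (hε : 0 < ε) : ∃ N₀, ∀ N ≥ N₀, ∀ x : CZero 𝕜, ‖x‖ ≤ 1 → ‖P x - P (czTrunc 𝕜 N x)‖ ≤ ε := by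
  obtain ⟨Φ, hΦ⟩ := hP
  by_contra! hcon
  choose N hN x hx hlt using hcon
  obtain ⟨φ, hφ, hxφ⟩ := exists_subseq_coordCauchy x hx
  set y : ℕ → CZero 𝕜 := fun k => czTrunc 𝕜 (N (φ k)) (x (φ k)) with hy
  have hev : ∀ i, ∀ᶠ k in atTop, x (φ k) i = y k i := fun i => by
    filter_upwards [eventually_gt_atTop i] with k hk
    rw [hy]
    dsimp only
    rw [czTrunc_apply, if_pos]
    exact hk.trans_le ((hφ.id_le k).trans (hN _))
  have hyc : CoordCauchy y := fun i => by
    obtain ⟨a, ha⟩ := cauchySeq_tendsto_of_complete (hxφ i)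
    exact (ha.congr' (hev i)).cauchySeq
  have hd : CoordNull fun k => x (φ k) - y k := fun i => by
    refine tendsto_const_nhds.congr' ?_
    filter_upwards [hev i] with k hk
    change 0 = x (φ k) i - y k i
    rw [hk, sub_self]
  have hyn : ∀ k, ‖y k‖ ≤ 1 := fun k =>
    ((czTrunc 𝕜 (N (φ k))).le_opNorm _).trans (mul_le_one₀ (norm_czTrunc_le _) (norm_nonneg _)
      (hx _))
  have hlim : Tendsto (fun k => ∑ s ∈ Finset.univ.erase Finset.univ,
      Φ (s.piecewise (fun _ => y k) fun _ => x (φ k) - y k)) atTop (𝓝 0) := by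
    rw [← Finset.sum_const_zero (s := (Finset.univ : Finset (Finset (Fin n))).erase Finset.univ)]
    refine tendsto_finsetSum _ fun s hs => ?_
    refine tendsto_form_of_coordCauchy Φ s sᶜ ?_ _ (1 + 1) (fun k i => ?_) (fun i hi => ?_)
      (fun i hi => ?_) fun i hi hi' => absurd (Finset.mem_compl.2 hi) hi'
    · rw [Finset.nonempty_iff_ne_empty, Ne, Finset.compl_eq_empty_iff]
      exact Finset.ne_of_mem_erase hs
    · by_cases hi : i ∈ s
      · rw [Finset.piecewise_eq_of_mem _ _ _ hi]
        exact (hyn k).trans (by norm_num)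
      · rw [Finset.piecewise_eq_of_notMem _ _ _ hi]
        exact (norm_sub_le _ _).trans (add_le_add (hx _) (hyn k))
    · simpa only [Finset.piecewise_eq_of_notMem _ _ _ (Finset.mem_compl.1 hi)] using hd
    · simpa only [Finset.piecewise_eq_of_mem _ _ _ hi] using hyc
  have h1 := hlim.norm
  rw [norm_zero] at h1
  obtain ⟨k, hk⟩ := (h1.eventually_lt_const hε).exists
  refine (hlt (φ k)).not_gt (lt_of_eq_of_lt ?_ hk)
  congr 1
  rw [hΦ, hΦ]
  have h2 : (fun _ : Fin n => x (φ k)) = (fun _ => y k) + fun _ => x (φ k) - y k := by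
    funext i
    simp
  conv_lhs => rw [h2]
  rw [Φ.map_add_univ, ← Finset.add_sum_erase _ _ (Finset.mem_univ Finset.univ),
    Finset.piecewise_univ, add_sub_cancel_left]

/-! ### `ℓ_∞^N` as an `L_∞` space, and the Cauchy property for `r = ∞` -/

theorem memLp_top_fin {N : ℕ} (x : Fin N → 𝕜) : MemLp x ∞ (Measure.count : Measure (Fin N)) :=
  memLp_top_of_bound (measurable_of_finite x).aestronglyMeasurable ‖x‖
    (Eventually.of_forall fun i => norm_le_pi_norm x i)

/-- The identity from `ℓ_∞^N` to `L_∞` of the counting measure. -/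
def finToLp (𝕜 : Type) [RCLike 𝕜] (N : ℕ) :
    (Fin N → 𝕜) →L[𝕜] Lp 𝕜 ∞ (Measure.count : Measure (Fin N)) :=
  LinearMap.mkContinuous
    { toFun := fun x => (memLp_top_fin x).toLp x
      map_add' := fun _ _ => rfl
      map_smul' := fun _ _ => rfl } 1 fun x => by
    rw [one_mul, lp_top_norm_le_iff _ (norm_nonneg x)]
    filter_upwards [(memLp_top_fin x).coeFn_toLp] with i hi
    change ‖(memLp_top_fin x).toLp x i‖ ≤ _
    rw [hi]
    exact norm_le_pi_norm x i

/-- The identity from `L_∞` of the counting measure to `ℓ_∞^N`. -/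
def lpToFin (𝕜 : Type) [RCLike 𝕜] (N : ℕ) :
    Lp 𝕜 ∞ (Measure.count : Measure (Fin N)) →L[𝕜] (Fin N → 𝕜) :=
  LinearMap.mkContinuous
    { toFun := fun f i => f i
      map_add' := fun f g => funext fun i => by
        have := Measure.ae_count_iff.1 (Lp.coeFn_add f g) i
        exact this
      map_smul' := fun c f => funext fun i => by
        have := Measure.ae_count_iff.1 (Lp.coeFn_smul c f) i
        exact this } 1 fun f => by
    rw [one_mul, pi_norm_le_iff_of_nonneg (norm_nonneg f)]
    exact fun i => Measure.ae_count_iff.1 ((lp_top_norm_le_iff f (norm_nonneg f)).1 le_rfl) i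

theorem lpToFin_finToLp (N : ℕ) (x : Fin N → 𝕜) : lpToFin 𝕜 N (finToLp 𝕜 N x) = x := by
  funext i
  exact Measure.ae_count_iff.1 ((memLp_top_fin x).coeFn_toLp) i

/-- The space `ℓ_∞^N` is `L_∞` of the counting measure, so `P` factors through the identity. -/
theorem factorClass_top_norm_le {N : ℕ} {P : (Fin N → 𝕜) → 𝕜} (hP : IsHomPoly n P) {t : ℝ}
    (ht : 0 ≤ t) (h : ∀ x, ‖P x‖ ≤ t * ‖x‖ ^ n) :
    (factorClass n (homPred 𝕜 n ∞)).norm (Fin N → 𝕜) P ≤ t := by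
  refine (factorClass.of_factorsWith ht ⟨Fin N, _, Measure.count, finToLp 𝕜 N, P ∘ lpToFin 𝕜 N,
    hP.comp _, ?_, LinearMap.mkContinuous_norm_le _ zero_le_one _, fun f => (h _).trans ?_⟩).2
  · funext x
    simp [lpToFin_finToLp]
  · gcongr
    exact ((lpToFin 𝕜 N).le_opNorm f).trans (mul_le_of_le_one_left (norm_nonneg _)
      (LinearMap.mkContinuous_norm_le _ zero_le_one _))

theorem factorClass_top_cauchyProperty :
    (factorClass n (homPred 𝕜 n ∞)).CauchyProperty n := by
  intro P hP C _ ε hε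
  obtain ⟨N₀, hN₀⟩ := hP.exists_norm_sub_czTrunc_le hε
  refine ⟨N₀, fun N hN N' _ => ?_⟩
  have hR : IsHomPoly n fun x : Fin N' → 𝕜 =>
      P (czIncl 𝕜 N' x) - P (czTrunc 𝕜 N (czIncl 𝕜 N' x)) := by
    have h := (hP.comp (czIncl 𝕜 N')).add
      ((hP.comp ((czTrunc 𝕜 N).comp (czIncl 𝕜 N'))).smul (-1))
    have h1 : (P ∘ ⇑(czIncl 𝕜 N') + (-1 : 𝕜) • P ∘ ⇑((czTrunc 𝕜 N).comp (czIncl 𝕜 N'))) =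
        fun x => P (czIncl 𝕜 N' x) - P (czTrunc 𝕜 N (czIncl 𝕜 N' x)) := by
      funext x
      simp only [Pi.add_apply, Pi.smul_apply, Function.comp_apply,
        ContinuousLinearMap.comp_apply, smul_eq_mul]
      ring
    rwa [h1] at h
  refine factorClass_top_norm_le hR hε.le fun x => (hR.norm_le_polyNorm x).trans ?_
  gcongr
  refine Real.iSup_le (fun x => hN₀ N hN _ ?_) hε.le
  exact ((czIncl 𝕜 N').le_opNorm _).trans (mul_le_one₀ (norm_czIncl_le N') (norm_nonneg _)
    (mem_closedBall_zero_iff.1 x.2))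

end CZeroForms

end SymRN

end

noncomputable section

namespace SymRN

/-! ### The norms in the definition of `α_{r'}^n` -/

section ConjNorm

variable {𝕜 : Type} [RCLike 𝕜] {m k : ℕ}

/-- The norm of a finite sequence in `ℓ_s`, where `s` is the conjugate exponent of `q`. -/
def conjNorm (q : ℝ) (c : Fin m → 𝕜) : ℝ :=
  ‖(WithLp.toLp (ENNReal.conjExponent (ENNReal.ofReal q)) c : PiLp _ fun _ => 𝕜)‖

theorem conjNorm_one (c : Fin m → 𝕜) : conjNorm 1 c = ⨆ i, ‖c i‖ := by
  have h : ∀ p : ℝ≥0∞, p = ∞ → ‖(WithLp.toLp p c : PiLp p fun _ => 𝕜)‖ = ⨆ i, ‖c i‖ := by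
    rintro _ rfl
    rfl
  refine h _ ?_
  simp [ENNReal.conjExponent]

theorem conjNorm_of_one_lt {q : ℝ} (hq : 1 < q) (c : Fin m → 𝕜) :
    conjNorm q c = (∑ i, ‖c i‖ ^ (q / (q - 1))) ^ (1 / (q / (q - 1))) := by
  have hq0 : 0 < q - 1 := by linarith
  have h : (ENNReal.conjExponent (ENNReal.ofReal q)).toReal = q / (q - 1) := by
    rw [ENNReal.conjExponent, ← ENNReal.ofReal_one, ← ENNReal.ofReal_sub _ zero_le_one,
      ← ENNReal.ofReal_inv_of_pos hq0, ← ENNReal.ofReal_add zero_le_one (by positivity),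
      ENNReal.toReal_ofReal (by positivity)]
    field_simp
    ring
  rw [conjNorm, PiLp.norm_eq_sum (by rw [h]; positivity), h]

theorem conjNorm_nonneg {q : ℝ} (hq : 1 ≤ q) (c : Fin m → 𝕜) : 0 ≤ conjNorm q c := by
  rcases hq.eq_or_lt with rfl | hq
  · rw [conjNorm_one]
    exact Real.iSup_nonneg fun _ => norm_nonneg _
  · rw [conjNorm_of_one_lt hq]
    exact Real.rpow_nonneg (Finset.sum_nonneg fun _ _ => Real.rpow_nonneg (norm_nonneg _) _) _

theorem sum_rpow_norm_nonneg {ι : Type*} (s : Finset ι) (b : ι → 𝕜) (q : ℝ) :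
    0 ≤ ∑ i ∈ s, ‖b i‖ ^ q :=
  Finset.sum_nonneg fun _ _ => Real.rpow_nonneg (norm_nonneg _) _

theorem norm_sum_mul_le_conjNorm {q : ℝ} (hq : 1 ≤ q) (c b : Fin m → 𝕜) :
    ‖∑ i, c i * b i‖ ≤ conjNorm q c * (∑ i, ‖b i‖ ^ q) ^ (1 / q) := by
  refine (norm_sum_le _ _).trans ?_
  simp only [norm_mul]
  rcases hq.eq_or_lt with rfl | hq
  · rw [conjNorm_one, div_one, Real.rpow_one, Finset.mul_sum]
    refine Finset.sum_le_sum fun i _ => ?_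
    rw [Real.rpow_one]
    exact mul_le_mul_of_nonneg_right
      (le_ciSup (f := fun i => ‖c i‖) (Set.finite_range _).bddAbove i) (norm_nonneg _)
  · rw [conjNorm_of_one_lt hq]
    exact Real.inner_le_Lp_mul_Lq_of_nonneg Finset.univ
      (Real.HolderConjugate.conjExponent hq).symm (fun _ _ => norm_nonneg _)
      fun _ _ => norm_nonneg _

/-- The converse of Hölder's inequality, tested on `b_i` of modulus `|c_i|^{s-1}` with matching
phase, or on unit vectors when `s = ∞`. Later estimates use this dual description and need not
separate the case `q = 1`. -/
theorem conjNorm_le {q : ℝ} (hq : 1 ≤ q) (c : Fin m → 𝕜) {t : ℝ} (ht : 0 ≤ t)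
    (h : ∀ b : Fin m → 𝕜, ‖∑ i, c i * b i‖ ≤ t * (∑ i, ‖b i‖ ^ q) ^ (1 / q)) :
    conjNorm q c ≤ t := by
  rcases hq.eq_or_lt with rfl | hq
  · rw [conjNorm_one]
    refine Real.iSup_le (fun i => ?_) ht
    have h1 := h (Pi.single i 1)
    have h2 : ∑ j, ‖(Pi.single i 1 : Fin m → 𝕜) j‖ ^ (1 : ℝ) = 1 := by
      simp [Pi.single_apply, apply_ite]
    rw [h2] at h1
    simpa [Pi.single_apply] using h1
  · have hq1 : 0 < q - 1 := by linarith
    have hq0 : 0 < q := by linarith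
    rw [conjNorm_of_one_lt hq]
    set s := q / (q - 1) with hs
    have hs0 : 0 < s := by positivity
    have hsq : (s - 1) * q = s := by rw [hs]; field_simp; ring
    have hs1 : 1 / s = 1 - 1 / q := by rw [hs]; field_simp
    set X := ∑ i, ‖c i‖ ^ s with hX
    have hX0 : 0 ≤ X := sum_rpow_norm_nonneg _ _ _
    rcases hX0.eq_or_lt with hX1 | hX1
    · rw [← hX1, Real.zero_rpow (by positivity)]
      exact ht
    · choose u hu1 hu using fun i => exists_rotation (c i)
      have h1 := h fun i => u i * ((‖c i‖ ^ (s - 1) : ℝ) : 𝕜)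
      have h2 : ∑ i, c i * (u i * ((‖c i‖ ^ (s - 1) : ℝ) : 𝕜)) = (X : 𝕜) := by
        rw [hX]
        push_cast
        refine Finset.sum_congr rfl fun i _ => ?_
        rw [← mul_assoc, mul_comm (c i), hu, ← RCLike.ofReal_mul]
        congr 1
        by_cases hc : ‖c i‖ = 0
        · rw [hc, zero_mul, Real.zero_rpow hs0.ne']
        · rw [Real.rpow_sub_one hc, mul_div_cancel₀ _ hc]
      have h3 : ∑ i, ‖u i * ((‖c i‖ ^ (s - 1) : ℝ) : 𝕜)‖ ^ q = X := by
        rw [hX]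
        refine Finset.sum_congr rfl fun i _ => ?_
        rw [norm_mul, hu1, one_mul, RCLike.norm_ofReal,
          abs_of_nonneg (Real.rpow_nonneg (norm_nonneg _) _), ← Real.rpow_mul (norm_nonneg _), hsq]
      rw [h2, h3, RCLike.norm_ofReal, abs_of_pos hX1] at h1
      rw [hs1, Real.rpow_sub hX1, Real.rpow_one, div_le_iff₀ (by positivity)]
      exact h1

/-- The coefficients are the coordinates of a functional norming `b` in `ℓ_q`. -/
theorem exists_conjNorm_le_one {q : ℝ} (hq : 1 ≤ q) (b : Fin m → 𝕜) :
    ∃ c : Fin m → 𝕜, conjNorm q c ≤ 1 ∧ ‖∑ i, c i * b i‖ = (∑ i, ‖b i‖ ^ q) ^ (1 / q) := by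
  have hq0 : 0 < q := by linarith
  let : Fact (1 ≤ ENNReal.ofReal q) := ⟨by rwa [ENNReal.one_le_ofReal]⟩
  have hnorm : ∀ b : Fin m → 𝕜, ‖(WithLp.toLp (ENNReal.ofReal q) b : PiLp _ fun _ => 𝕜)‖ =
      (∑ i, ‖b i‖ ^ q) ^ (1 / q) := fun b => by
    rw [PiLp.norm_eq_sum (by rw [ENNReal.toReal_ofReal hq0.le]; exact hq0),
      ENNReal.toReal_ofReal hq0.le]
  obtain ⟨g, hg1, hg⟩ := exists_dual_vector'' 𝕜
    (WithLp.toLp (ENNReal.ofReal q) b : PiLp (ENNReal.ofReal q) fun _ : Fin m => 𝕜)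
  have hsum : ∀ b : Fin m → 𝕜, ∑ i, g (WithLp.toLp _ (Pi.single i 1)) * b i =
      g (WithLp.toLp _ b) := fun b => by
    have h1 : (WithLp.toLp (ENNReal.ofReal q) b : PiLp _ fun _ => 𝕜) =
        ∑ i, b i • WithLp.toLp (ENNReal.ofReal q) (Pi.single i 1 : Fin m → 𝕜) := by
      ext j
      simp [Pi.single_apply]
    rw [h1, map_sum]
    refine Finset.sum_congr rfl fun i _ => ?_
    rw [map_smul, smul_eq_mul, mul_comm]
  refine ⟨fun i => g (WithLp.toLp _ (Pi.single i 1)), conjNorm_le hq _ zero_le_one fun b => ?_, ?_⟩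
  · rw [hsum, ← hnorm]
    exact g.le_of_opNorm_le hg1 _
  · rw [hsum, hg, hnorm, RCLike.norm_ofReal,
      abs_of_nonneg (Real.rpow_nonneg (sum_rpow_norm_nonneg _ _ _) _)]

/-- Jensen's inequality with weights proportional to `a` and `b`. -/
theorem two_term_holder {q : ℝ} (hq : 1 ≤ q) {a b A B : ℝ} (ha : 0 < a) (hb : 0 < b) (hA : 0 ≤ A)
    (hB : 0 ≤ B) : a ^ (1 - 1 / q) * A ^ (1 / q) + b ^ (1 - 1 / q) * B ^ (1 / q) ≤
      (a + b) ^ (1 - 1 / q) * (A + B) ^ (1 / q) := by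
  have hq0 : 0 < q := by linarith
  have hab : 0 < a + b := by positivity
  have h1 := (convexOn_rpow hq).2 (Set.mem_Ici.2 (by positivity : 0 ≤ (A / a) ^ (1 / q)))
    (Set.mem_Ici.2 (by positivity : 0 ≤ (B / b) ^ (1 / q))) (by positivity : 0 ≤ a / (a + b))
    (by positivity : 0 ≤ b / (a + b)) (by rw [← add_div, div_self hab.ne'])
  simp only [smul_eq_mul] at h1
  rw [← Real.rpow_mul (by positivity), ← Real.rpow_mul (by positivity),
    one_div_mul_cancel hq0.ne', Real.rpow_one, Real.rpow_one] at h1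
  have h2 : a / (a + b) * (A / a) + b / (a + b) * (B / b) = (A + B) / (a + b) := by
    field_simp
  rw [h2] at h1
  have h3 := Real.rpow_le_rpow (by positivity) h1 (by positivity : 0 ≤ 1 / q)
  rw [← Real.rpow_mul (by positivity), mul_one_div_cancel hq0.ne', Real.rpow_one] at h3
  have h4 : ∀ a A : ℝ, 0 < a → 0 ≤ A → a ^ (1 - 1 / q) * A ^ (1 / q) = a * (A / a) ^ (1 / q) := by
    intro a A ha hA
    rw [Real.rpow_sub ha, Real.rpow_one, Real.div_rpow hA ha.le]
    ring
  rw [h4 a A ha hA, h4 b B hb hB, h4 _ _ hab (by positivity)]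
  calc a * (A / a) ^ (1 / q) + b * (B / b) ^ (1 / q) = (a + b) *
        (a / (a + b) * (A / a) ^ (1 / q) + b / (a + b) * (B / b) ^ (1 / q)) := by field_simp
    _ ≤ _ := mul_le_mul_of_nonneg_left h3 hab.le

/-- The exponent `1 - 1/q` is `1/s`, so the bounds `a` and `b` play the role of `s`-th powers of
norms; in this form the statement also makes sense for `s = ∞`. -/
theorem conjNorm_append_le {q : ℝ} (hq : 1 ≤ q) (c : Fin m → 𝕜) (d : Fin k → 𝕜) {a b : ℝ}
    (ha : 0 < a) (hb : 0 < b) (hc : conjNorm q c ≤ a ^ (1 - 1 / q))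
    (hd : conjNorm q d ≤ b ^ (1 - 1 / q)) :
    conjNorm q (Fin.append c d) ≤ (a + b) ^ (1 - 1 / q) := by
  refine conjNorm_le hq _ (by positivity) fun e => ?_
  rw [Fin.sum_univ_add, Fin.sum_univ_add]
  simp only [Fin.append_left, Fin.append_right]
  refine (norm_add_le _ _).trans (le_trans (add_le_add ?_ ?_) (two_term_holder hq ha hb
    (sum_rpow_norm_nonneg _ _ _) (sum_rpow_norm_nonneg _ _ _)))
  · refine (norm_sum_mul_le_conjNorm hq _ _).trans (mul_le_mul_of_nonneg_right hc ?_)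
    exact Real.rpow_nonneg (sum_rpow_norm_nonneg _ _ _) _
  · refine (norm_sum_mul_le_conjNorm hq _ _).trans (mul_le_mul_of_nonneg_right hd ?_)
    exact Real.rpow_nonneg (sum_rpow_norm_nonneg _ _ _) _

theorem conjNorm_mul_le {q : ℝ} (hq : 1 ≤ q) (u : 𝕜) (c : Fin m → 𝕜) :
    conjNorm q (fun i => u * c i) ≤ ‖u‖ * conjNorm q c := by
  refine conjNorm_le hq _ (mul_nonneg (norm_nonneg _) (conjNorm_nonneg hq c)) fun b => ?_
  simp only [mul_assoc]
  rw [← Finset.mul_sum, norm_mul]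
  exact mul_le_mul_of_nonneg_left (norm_sum_mul_le_conjNorm hq c b) (norm_nonneg _)

theorem conjNorm_singleton_le {q : ℝ} (hq : 1 ≤ q) : conjNorm q (fun _ : Fin 1 => (1 : 𝕜)) ≤ 1 := by
  have hq0 : 0 < q := by linarith
  refine conjNorm_le hq _ zero_le_one fun b => ?_
  simp only [Fin.sum_univ_one, one_mul, ← Real.rpow_mul (norm_nonneg _),
    mul_one_div_cancel hq0.ne', Real.rpow_one, le_refl]

end ConjNorm

/-! ### Weak `ℓ_r`-norms -/

section WeakNorm

variable {𝕜 : Type} [RCLike 𝕜] {m k : ℕ} {r : ℝ}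
variable {E : Type} [NormedAddCommGroup E] [NormedSpace 𝕜 E]
variable {F : Type} [NormedAddCommGroup F] [NormedSpace 𝕜 F]

theorem weakNorm_nonneg (x : Fin m → E) : 0 ≤ weakNorm 𝕜 r x :=
  Real.iSup_nonneg fun _ => Real.rpow_nonneg (sum_rpow_norm_nonneg _ _ _) _

theorem sum_rpow_le_weakNorm (hr : 0 < r) (x : Fin m → E) (φ : StrongDual 𝕜 E) (hφ : ‖φ‖ ≤ 1) :
    ∑ i, ‖φ (x i)‖ ^ r ≤ weakNorm 𝕜 r x ^ r := by
  have hbdd : BddAbove (Set.range fun φ : Metric.closedBall (0 : StrongDual 𝕜 E) 1 =>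
      (∑ i, ‖(φ : StrongDual 𝕜 E) (x i)‖ ^ r) ^ (1 / r)) := by
    refine ⟨(∑ i, ‖x i‖ ^ r) ^ (1 / r), ?_⟩
    rintro _ ⟨φ, rfl⟩
    have hφ : ‖(φ : StrongDual 𝕜 E)‖ ≤ 1 := mem_closedBall_zero_iff.1 φ.2
    refine Real.rpow_le_rpow (sum_rpow_norm_nonneg _ _ _) (Finset.sum_le_sum fun i _ => ?_)
      (by positivity)
    exact Real.rpow_le_rpow (norm_nonneg _) (((φ : StrongDual 𝕜 E).le_of_opNorm_le hφ _).trans_eq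
      (one_mul _)) hr.le
  have h := le_ciSup hbdd ⟨φ, mem_closedBall_zero_iff.2 hφ⟩
  have h1 := Real.rpow_le_rpow (Real.rpow_nonneg (sum_rpow_norm_nonneg _ _ _) _) h hr.le
  rwa [← Real.rpow_mul (sum_rpow_norm_nonneg _ _ _), one_div_mul_cancel hr.ne', Real.rpow_one] at h1

theorem weakNorm_le (hr : 0 < r) (x : Fin m → E) {C : ℝ} (hC : 0 ≤ C)
    (h : ∀ φ : StrongDual 𝕜 E, ‖φ‖ ≤ 1 → ∑ i, ‖φ (x i)‖ ^ r ≤ C ^ r) : weakNorm 𝕜 r x ≤ C := by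
  refine Real.iSup_le (fun φ => ?_) hC
  have h1 := Real.rpow_le_rpow (sum_rpow_norm_nonneg _ _ _)
    (h φ (mem_closedBall_zero_iff.1 φ.2)) (by positivity : 0 ≤ 1 / r)
  rwa [← Real.rpow_mul hC, mul_one_div_cancel hr.ne', Real.rpow_one] at h1

theorem weakNorm_rpow_le (hr : 0 < r) (x : Fin m → E) {C : ℝ} (hC : 0 ≤ C)
    (h : ∀ φ : StrongDual 𝕜 E, ‖φ‖ ≤ 1 → ∑ i, ‖φ (x i)‖ ^ r ≤ C) : weakNorm 𝕜 r x ^ r ≤ C := by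
  have h1 : (C ^ (1 / r)) ^ r = C := by
    rw [← Real.rpow_mul hC, one_div_mul_cancel hr.ne', Real.rpow_one]
  refine (Real.rpow_le_rpow (weakNorm_nonneg x) (weakNorm_le hr x (C := C ^ (1 / r))
    (by positivity) fun φ hφ => ?_) hr.le).trans_eq h1
  rw [h1]
  exact h φ hφ

theorem weakNorm_append_le (hr : 0 < r) (x : Fin m → E) (y : Fin k → E) :
    weakNorm 𝕜 r (Fin.append x y) ^ r ≤ weakNorm 𝕜 r x ^ r + weakNorm 𝕜 r y ^ r := by
  have h1 := weakNorm_nonneg (𝕜 := 𝕜) (r := r) x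
  have h2 := weakNorm_nonneg (𝕜 := 𝕜) (r := r) y
  refine weakNorm_rpow_le hr _ (by positivity) fun φ hφ => ?_
  rw [Fin.sum_univ_add]
  simp only [Fin.append_left, Fin.append_right]
  exact add_le_add (sum_rpow_le_weakNorm hr x φ hφ) (sum_rpow_le_weakNorm hr y φ hφ)

theorem weakNorm_map_le (hr : 0 < r) (T : E →L[𝕜] F) (x : Fin m → E) :
    weakNorm 𝕜 r (fun i => T (x i)) ≤ ‖T‖ * weakNorm 𝕜 r x := by
  have hw := weakNorm_nonneg (𝕜 := 𝕜) (r := r) x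
  refine weakNorm_le hr _ (by positivity) fun φ hφ => ?_
  rcases (norm_nonneg T).eq_or_lt with hT | hT
  · have hT0 : T = 0 := norm_eq_zero.1 hT.symm
    simp [hT0, Real.zero_rpow hr.ne']
  · have h1 : ‖((‖T‖⁻¹ : ℝ) : 𝕜) • φ.comp T‖ ≤ 1 := by
      rw [norm_smul, RCLike.norm_ofReal, abs_of_pos (inv_pos.2 hT), inv_mul_le_iff₀ hT, mul_one]
      exact (φ.opNorm_comp_le T).trans (mul_le_of_le_one_left hT.le hφ)
    have h2 := sum_rpow_le_weakNorm hr x _ h1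
    have h3 : ∀ i, ‖(((‖T‖⁻¹ : ℝ) : 𝕜) • φ.comp T) (x i)‖ ^ r =
        (‖T‖ ^ r)⁻¹ * ‖φ (T (x i))‖ ^ r := fun i => by
      rw [_root_.smul_apply, norm_smul, RCLike.norm_ofReal, abs_of_pos (inv_pos.2 hT),
        Real.mul_rpow (by positivity) (norm_nonneg _), Real.inv_rpow hT.le]
      rfl
    simp only [h3] at h2
    rw [← Finset.mul_sum, inv_mul_le_iff₀ (by positivity)] at h2
    rwa [Real.mul_rpow hT.le hw]

theorem weakNorm_smul_le (hr : 0 < r) (c : 𝕜) (x : Fin m → E) :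
    weakNorm 𝕜 r (fun i => c • x i) ≤ ‖c‖ * weakNorm 𝕜 r x := by
  refine (weakNorm_map_le hr (c • ContinuousLinearMap.id 𝕜 E) x).trans
    (mul_le_mul_of_nonneg_right ?_ (weakNorm_nonneg x))
  rw [norm_smul]
  exact mul_le_of_le_one_right (norm_nonneg _) ContinuousLinearMap.norm_id_le

theorem weakNorm_singleton_le (hr : 0 < r) (x : E) :
    weakNorm 𝕜 r (fun _ : Fin 1 => x) ≤ ‖x‖ := by
  refine weakNorm_le hr _ (norm_nonneg x) fun φ hφ => ?_
  rw [Fin.sum_univ_one]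
  exact Real.rpow_le_rpow (norm_nonneg _) ((φ.le_of_opNorm_le hφ x).trans_eq (one_mul _)) hr.le

/-- Hahn–Banach: functionals on the subspace extend with the same norm. This makes `α` finitely
generated. -/
theorem weakNorm_subspace_le (hr : 0 < r) (M : Submodule 𝕜 E) (x : Fin m → M) :
    weakNorm 𝕜 r x ≤ weakNorm 𝕜 r fun i => (x i : E) := by
  refine weakNorm_le hr _ (weakNorm_nonneg _) fun φ hφ => ?_
  obtain ⟨ψ, hψ, hψn⟩ := exists_extension_norm_eq M φ
  refine le_trans (le_of_eq (Finset.sum_congr rfl fun i _ => ?_))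
    (sum_rpow_le_weakNorm hr (fun i => (x i : E)) ψ (hψn.trans_le hφ))
  rw [hψ]

end WeakNorm

end SymRN

end

noncomputable section

namespace SymRN

/-! ### The s-tensor norm `α_{r'}^n` and the class of dominated polynomials -/

section Alpha

variable {𝕜 : Type} [RCLike 𝕜] {n m : ℕ} {r : ℝ}
variable {E : Type} [NormedAddCommGroup E] [NormedSpace 𝕜 E]
variable {F : Type} [NormedAddCommGroup F] [NormedSpace 𝕜 F]

theorem alphaNorm_nonneg (hn : 1 ≤ n) (hr : (n : ℝ) ≤ r) (z : SymTensor 𝕜 n E) :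
    0 ≤ alphaNorm r z := by
  have hn0 : 0 < (n : ℝ) := Nat.cast_pos.2 hn
  apply Real.sInf_nonneg
  rintro _ ⟨m, c, x, -, rfl⟩
  exact mul_nonneg (conjNorm_nonneg ((one_le_div hn0).2 hr) c) (pow_nonneg (weakNorm_nonneg x) n)

theorem alphaNorm_le (hn : 1 ≤ n) (hr : (n : ℝ) ≤ r) (c : Fin m → 𝕜) (x : Fin m → E) :
    alphaNorm r (∑ i, c i • tpow 𝕜 n (x i)) ≤ conjNorm (r / n) c * weakNorm 𝕜 r x ^ n := by
  have hn0 : 0 < (n : ℝ) := Nat.cast_pos.2 hn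
  refine csInf_le ⟨0, ?_⟩ ⟨m, c, x, rfl, rfl⟩
  rintro _ ⟨m, c, x, -, rfl⟩
  exact mul_nonneg (conjNorm_nonneg ((one_le_div hn0).2 hr) c) (pow_nonneg (weakNorm_nonneg x) n)

theorem le_alphaNorm (z : SymTensor 𝕜 n E) {t : ℝ}
    (h : ∀ (m : ℕ) (c : Fin m → 𝕜) (x : Fin m → E), z = ∑ i, c i • tpow 𝕜 n (x i) →
      t ≤ conjNorm (r / n) c * weakNorm 𝕜 r x ^ n) : t ≤ alphaNorm r z := by
  obtain ⟨m, c, x, hz⟩ := exists_rep z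
  refine le_csInf ⟨_, m, c, x, hz, rfl⟩ ?_
  rintro _ ⟨m, c, x, hz, rfl⟩
  exact h m c x hz

/-- Balancing: replacing `x` by `σ x` and `c` by `σ^{-n} c` keeps the tensor and distributes `t` as
`t^{1/s}` on the coefficients and `t^{1/r}` on the weak norm. Balanced representations can be
concatenated. -/
theorem exists_rep_of_alphaNorm_lt (hn : 1 ≤ n) (hr : (n : ℝ) ≤ r) {z : SymTensor 𝕜 n E} {t : ℝ}
    (ht : alphaNorm r z < t) : ∃ (m : ℕ) (c : Fin m → 𝕜) (x : Fin m → E),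
      z = ∑ i, c i • tpow 𝕜 n (x i) ∧ conjNorm (r / n) c ≤ t ^ (1 - 1 / (r / n)) ∧
        weakNorm 𝕜 r x ^ r ≤ t := by
  have hn0 : 0 < (n : ℝ) := Nat.cast_pos.2 hn
  have hr0 : 0 < r := hn0.trans_le hr
  have hq : 1 ≤ r / n := (one_le_div hn0).2 hr
  have ht0 : 0 < t := (alphaNorm_nonneg hn hr z).trans_lt ht
  obtain ⟨m₀, c₀, x₀, hz₀⟩ := exists_rep z
  obtain ⟨_, ⟨m, c, x, hz, rfl⟩, hlt⟩ := exists_lt_of_csInf_lt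
    (by exact ⟨_, m₀, c₀, x₀, hz₀, rfl⟩) ht
  change conjNorm (r / n) c * _ < t at hlt
  have hw0 := weakNorm_nonneg (𝕜 := 𝕜) (r := r) x
  have hcont : Filter.Tendsto (fun η : ℝ => conjNorm (r / n) c * (weakNorm 𝕜 r x + η) ^ n)
      (nhdsWithin 0 (Set.Ioi 0)) (nhds (conjNorm (r / n) c * (weakNorm 𝕜 r x + 0) ^ n)) :=
    ((by fun_prop : Continuous fun η : ℝ =>
      conjNorm (r / n) c * (weakNorm 𝕜 r x + η) ^ n).tendsto 0).mono_left nhdsWithin_le_nhds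
  rw [add_zero] at hcont
  obtain ⟨η, hη, hη0⟩ := ((hcont.eventually_lt_const hlt).and self_mem_nhdsWithin).exists
  have hη0' : 0 < η := hη0
  set W := weakNorm 𝕜 r x + η with hW
  have hW0 : 0 < W := by positivity
  -- The denominator is the weak norm enlarged by `η`, since the weak norm itself may vanish.
  set σ := t ^ (1 / r) / W with hσ
  have hσ0 : 0 < σ := by positivity
  refine ⟨m, fun i => (((σ ^ n)⁻¹ : ℝ) : 𝕜) * c i, fun i => (σ : 𝕜) • x i, ?_, ?_, ?_⟩
  · rw [hz]
    refine Finset.sum_congr rfl fun i _ => ?_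
    rw [tpow_smul, smul_smul, mul_right_comm, ← RCLike.ofReal_pow, ← RCLike.ofReal_mul,
      inv_mul_cancel₀ (by positivity), RCLike.ofReal_one, one_mul]
  · refine (conjNorm_mul_le hq _ c).trans ?_
    rw [RCLike.norm_ofReal, abs_of_pos (by positivity), inv_mul_le_iff₀ (by positivity)]
    have h1 : σ ^ n * t ^ (1 - 1 / (r / n)) = t / W ^ n := by
      rw [hσ, div_pow, ← Real.rpow_natCast (t ^ (1 / r)), ← Real.rpow_mul ht0.le, div_mul_eq_mul_div,
        ← Real.rpow_add ht0]
      congr 1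
      rw [one_div_div, one_div_mul_eq_div, add_sub_cancel, Real.rpow_one]
    rw [h1, le_div_iff₀ (by positivity)]
    exact hη.le
  · have h1 : weakNorm 𝕜 r (fun i => (σ : 𝕜) • x i) ≤ t ^ (1 / r) := by
      refine (weakNorm_smul_le hr0 _ x).trans ?_
      rw [RCLike.norm_ofReal, abs_of_pos hσ0, hσ, div_mul_eq_mul_div, div_le_iff₀ hW0]
      exact mul_le_mul_of_nonneg_left (by rw [hW]; linarith) (by positivity)
    refine (Real.rpow_le_rpow (weakNorm_nonneg _) h1 hr0.le).trans_eq ?_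
    rw [← Real.rpow_mul ht0.le, one_div_mul_cancel hr0.ne', Real.rpow_one]

/-- Concatenate balanced representations. The coefficients contribute `(a+b)^{1-n/r}` and the weak
norm `(a+b)^{n/r}`, and the exponents add up to one. -/
theorem alphaNorm_add_le (hn : 1 ≤ n) (hr : (n : ℝ) ≤ r) (y z : SymTensor 𝕜 n E) :
    alphaNorm r (y + z) ≤ alphaNorm r y + alphaNorm r z := by
  have hn0 : 0 < (n : ℝ) := Nat.cast_pos.2 hn
  have hr0 : 0 < r := hn0.trans_le hr
  have hq : 1 ≤ r / n := (one_le_div hn0).2 hr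
  refine le_of_forall_pos_le_add fun ε hε => ?_
  have hy0 := alphaNorm_nonneg hn hr y
  have hz0 := alphaNorm_nonneg hn hr z
  set a := alphaNorm r y + ε / 2 with ha
  set b := alphaNorm r z + ε / 2 with hb
  have ha0 : 0 < a := by positivity
  have hb0 : 0 < b := by positivity
  obtain ⟨m, c, x, hx, hc, hw⟩ := exists_rep_of_alphaNorm_lt hn hr
    (lt_add_of_pos_right (alphaNorm r y) (half_pos hε))
  obtain ⟨m', c', x', hx', hc', hw'⟩ := exists_rep_of_alphaNorm_lt hn hr
    (lt_add_of_pos_right (alphaNorm r z) (half_pos hε))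
  have h1 : y + z = ∑ i, Fin.append c c' i • tpow 𝕜 n (Fin.append x x' i) := by
    rw [hx, hx', Fin.sum_univ_add]
    simp
  have h2 : weakNorm 𝕜 r (Fin.append x x') ^ n ≤ (a + b) ^ (1 / (r / n)) := by
    have h3 := (weakNorm_append_le hr0 x x').trans (add_le_add hw hw')
    have h4 := Real.rpow_le_rpow (Real.rpow_nonneg (weakNorm_nonneg _) _) h3
      (by positivity : 0 ≤ 1 / (r / n))
    rw [← Real.rpow_mul (weakNorm_nonneg _), one_div_div, mul_div_cancel₀ _ hr0.ne',
      Real.rpow_natCast] at h4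
    rwa [one_div_div]
  calc alphaNorm r (y + z) ≤ conjNorm (r / n) (Fin.append c c') *
        weakNorm 𝕜 r (Fin.append x x') ^ n := by
        rw [h1]
        exact alphaNorm_le hn hr _ _
    _ ≤ (a + b) ^ (1 - 1 / (r / n)) * (a + b) ^ (1 / (r / n)) :=
        mul_le_mul (conjNorm_append_le hq c c' ha0 hb0 hc hc') h2
          (pow_nonneg (weakNorm_nonneg _) _) (by positivity)
    _ = a + b := by rw [← Real.rpow_add (by positivity), sub_add_cancel, Real.rpow_one]
    _ = alphaNorm r y + alphaNorm r z + ε := by rw [ha, hb]; ring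

theorem alphaNorm_tpow_le (hn : 1 ≤ n) (hr : (n : ℝ) ≤ r) (x : E) :
    alphaNorm r (tpow 𝕜 n x) ≤ ‖x‖ ^ n := by
  have hn0 : 0 < (n : ℝ) := Nat.cast_pos.2 hn
  have h := alphaNorm_le hn hr (fun _ : Fin 1 => (1 : 𝕜)) fun _ => x
  rw [Fin.sum_univ_one, one_smul] at h
  refine h.trans ((mul_le_mul (conjNorm_singleton_le ((one_le_div hn0).2 hr))
    (pow_le_pow_left₀ (weakNorm_nonneg _) (weakNorm_singleton_le (hn0.trans_le hr) x) n)
    (pow_nonneg (weakNorm_nonneg _) _) zero_le_one).trans_eq (one_mul _))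

theorem alphaNorm_zero (hn : 1 ≤ n) (hr : (n : ℝ) ≤ r) : alphaNorm r (0 : SymTensor 𝕜 n E) = 0 := by
  refine le_antisymm ?_ (alphaNorm_nonneg hn hr _)
  have h := alphaNorm_tpow_le (𝕜 := 𝕜) hn hr (0 : E)
  have h0 : tpow 𝕜 n (0 : E) = 0 := by
    have := tpow_smul (n := n) (0 : 𝕜) (0 : E)
    rwa [zero_pow (by omega), zero_smul, zero_smul] at this
  rwa [h0, norm_zero, zero_pow (by omega)] at h

theorem alphaNorm_smul_le (hn : 1 ≤ n) (hr : (n : ℝ) ≤ r) (u : 𝕜) (z : SymTensor 𝕜 n E) :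
    alphaNorm r (u • z) ≤ ‖u‖ * alphaNorm r z := by
  have hn0 : 0 < (n : ℝ) := Nat.cast_pos.2 hn
  by_cases hu : u = 0
  · rw [hu, zero_smul, alphaNorm_zero hn hr, norm_zero, zero_mul]
  · have hu' : 0 < ‖u‖ := norm_pos_iff.2 hu
    rw [← div_le_iff₀' hu']
    refine le_alphaNorm z fun m c x hz => ?_
    rw [div_le_iff₀' hu', hz, Finset.smul_sum]
    simp only [smul_smul]
    refine (alphaNorm_le hn hr (fun i => u * c i) x).trans ?_
    rw [← mul_assoc]
    exact mul_le_mul_of_nonneg_right (conjNorm_mul_le ((one_le_div hn0).2 hr) u c)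
      (pow_nonneg (weakNorm_nonneg _) _)

theorem sum_norm_pow_rpow (hn : 1 ≤ n) (x : Fin m → 𝕜) :
    ∑ i, ‖x i ^ n‖ ^ (r / n) = ∑ i, ‖x i‖ ^ r := by
  have hn0 : 0 < (n : ℝ) := Nat.cast_pos.2 hn
  refine Finset.sum_congr rfl fun i _ => ?_
  rw [norm_pow, ← Real.rpow_natCast, ← Real.rpow_mul (norm_nonneg _), mul_div_cancel₀ _ hn0.ne']

theorem rpow_le_pow_of_le_rpow (hr : 0 < r) {a w : ℝ} (ha : 0 ≤ a) (hw : 0 ≤ w) (h : a ≤ w ^ r) :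
    a ^ (n / r) ≤ w ^ n := by
  have h1 := Real.rpow_le_rpow ha h (by positivity : 0 ≤ n / r)
  rwa [← Real.rpow_mul hw, mul_div_cancel₀ _ hr.ne', Real.rpow_natCast] at h1

theorem epsS_le_alphaNorm (hn : 1 ≤ n) (hr : (n : ℝ) ≤ r) (z : SymTensor 𝕜 n E) :
    epsS z ≤ alphaNorm r z := by
  have hn0 : 0 < (n : ℝ) := Nat.cast_pos.2 hn
  have hq : 1 ≤ r / n := (one_le_div hn0).2 hr
  refine Real.iSup_le (fun φ => le_alphaNorm z fun m c x hz => ?_) (alphaNorm_nonneg hn hr z)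
  have hφ : ‖(φ : StrongDual 𝕜 E)‖ ≤ 1 := mem_closedBall_zero_iff.1 φ.2
  rw [hz, map_sum]
  simp only [map_smul, symPair_tpow, smul_eq_mul]
  refine (norm_sum_mul_le_conjNorm hq c _).trans
    (mul_le_mul_of_nonneg_left ?_ (conjNorm_nonneg hq c))
  rw [sum_norm_pow_rpow hn, one_div_div]
  exact rpow_le_pow_of_le_rpow (hn0.trans_le hr) (sum_rpow_norm_nonneg _ _ _) (weakNorm_nonneg _)
    (sum_rpow_le_weakNorm (hn0.trans_le hr) x _ hφ)

theorem alphaNorm_map_le (hn : 1 ≤ n) (hr : (n : ℝ) ≤ r) (T : E →L[𝕜] F) (z : SymTensor 𝕜 n E) :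
    alphaNorm r (symMap T z) ≤ ‖T‖ ^ n * alphaNorm r z := by
  have hn0 : 0 < (n : ℝ) := Nat.cast_pos.2 hn
  have hq : 1 ≤ r / n := (one_le_div hn0).2 hr
  have hrep : ∀ (m : ℕ) (c : Fin m → 𝕜) (x : Fin m → E), z = ∑ i, c i • tpow 𝕜 n (x i) →
      alphaNorm r (symMap T z) ≤ ‖T‖ ^ n * (conjNorm (r / n) c * weakNorm 𝕜 r x ^ n) := by
    intro m c x hz
    rw [hz, map_sum]
    simp only [map_smul, symMap_tpow]
    refine (alphaNorm_le hn hr c fun i => T (x i)).trans ?_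
    rw [mul_left_comm, ← mul_pow]
    exact mul_le_mul_of_nonneg_left (pow_le_pow_left₀ (weakNorm_nonneg _)
      (weakNorm_map_le (hn0.trans_le hr) T x) n) (conjNorm_nonneg hq c)
  rcases (pow_nonneg (norm_nonneg T) n).eq_or_lt with hT | hT
  · obtain ⟨m, c, x, hz⟩ := exists_rep z
    have := hrep m c x hz
    rwa [← hT, zero_mul] at this ⊢
  · rw [← div_le_iff₀' hT]
    refine le_alphaNorm z fun m c x hz => ?_
    rw [div_le_iff₀' hT]
    exact hrep m c x hz

/-- The s-tensor norm `α_{r'}^n`. -/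
def alphaTensorNorm (𝕜 : Type) [RCLike 𝕜] {n : ℕ} {r : ℝ} (hn : 1 ≤ n) (hr : (n : ℝ) ≤ r) :
    STensorNorm 𝕜 n where
  toSeminorm _ _ _ _ := Seminorm.ofSMulLE (alphaNorm r) (alphaNorm_zero hn hr)
    (alphaNorm_add_le hn hr) (alphaNorm_smul_le hn hr)
  epsS_le _ _ _ _ z := epsS_le_alphaNorm hn hr z
  le_piS E _ _ _ z := by
    change alphaNorm r z ≤ piS z
    refine le_csInf ?_ ?_
    · obtain ⟨m, c, x, h⟩ := exists_rep z
      exact ⟨_, m, c, x, h, rfl⟩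
    · rintro _ ⟨m, c, x, rfl, rfl⟩
      refine (Finset.le_sum_of_subadditive (alphaNorm r) (alphaNorm_zero hn hr).le
        (alphaNorm_add_le hn hr) _ _).trans (Finset.sum_le_sum fun i _ => ?_)
      exact (alphaNorm_smul_le hn hr _ _).trans
        (mul_le_mul_of_nonneg_left (alphaNorm_tpow_le hn hr _) (norm_nonneg _))
  map_le _ _ _ _ _ _ _ _ T z := alphaNorm_map_le hn hr T z

theorem alphaTensorNorm_isAlpha (hn : 1 ≤ n) (hr : (n : ℝ) ≤ r) :
    (alphaTensorNorm 𝕜 hn hr).IsAlpha r := fun _ _ _ _ _ => rfl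

theorem STensorNorm.IsAlpha.finitelyGenerated {α : STensorNorm 𝕜 n} (hα : α.IsAlpha r)
    (hn : 1 ≤ n) (hr : (n : ℝ) ≤ r) : α.FinitelyGenerated := by
  have hn0 : 0 < (n : ℝ) := Nat.cast_pos.2 hn
  have hq : 1 ≤ r / n := (one_le_div hn0).2 hr
  intro E _ _ _ z
  constructor
  · rintro _ ⟨M, _, w, rfl, rfl⟩
    exact α.map_le_of_norm_le_one _ (norm_subtypeL_le_one M) w
  · intro t ht
    rw [hα]
    refine le_alphaNorm z fun m c x hz => ?_
    let M : Submodule 𝕜 E := Submodule.span 𝕜 (Set.range x)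
    have : FiniteDimensional 𝕜 M := FiniteDimensional.span_of_finite 𝕜 (Set.finite_range x)
    let y : Fin m → M := fun i => ⟨x i, Submodule.subset_span ⟨i, rfl⟩⟩
    have h1 := ht ⟨M, this, ∑ i, c i • tpow 𝕜 n (y i), by
      rw [hz, map_sum]
      simp only [map_smul, symMap_tpow]
      rfl, rfl⟩
    rw [hα] at h1
    refine h1.trans ((alphaNorm_le hn hr c y).trans
      (mul_le_mul_of_nonneg_left ?_ (conjNorm_nonneg hq c)))
    exact pow_le_pow_left₀ (weakNorm_nonneg _) (weakNorm_subspace_le (hn0.trans_le hr) M y) n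

/-- The duality of `ℓ_{r/n}` and `ℓ_s`: Hölder's inequality in one direction, and in the other a
choice of coefficients that norms the sequence of values of the polynomial. -/
theorem dominatedWith_iff (hn : 1 ≤ n) (hr : (n : ℝ) ≤ r) (l : SymTensor 𝕜 n E →ₗ[𝕜] 𝕜) {C : ℝ}
    (hC : 0 < C) : DominatedWith n r (fun x => l (tpow 𝕜 n x)) C ↔
      ∀ u : SymTensor 𝕜 n E, ‖l u‖ ≤ C * alphaNorm r u := by
  have hn0 : 0 < (n : ℝ) := Nat.cast_pos.2 hn
  have hq : 1 ≤ r / n := (one_le_div hn0).2 hr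
  constructor
  · rintro ⟨_, h⟩ u
    rw [← div_le_iff₀' hC]
    refine le_alphaNorm u fun m c x hu => ?_
    rw [div_le_iff₀' hC, hu, map_sum]
    simp only [map_smul, smul_eq_mul]
    refine (norm_sum_mul_le_conjNorm hq c _).trans ?_
    rw [mul_left_comm, one_div_div]
    exact mul_le_mul_of_nonneg_left (h m x) (conjNorm_nonneg hq c)
  · intro h
    refine ⟨hC, fun m x => ?_⟩
    obtain ⟨c, hc, hcb⟩ := exists_conjNorm_le_one hq fun i => l (tpow 𝕜 n (x i))
    rw [one_div_div] at hcb
    rw [← hcb]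
    have h1 : ∑ i, c i * l (tpow 𝕜 n (x i)) = l (∑ i, c i • tpow 𝕜 n (x i)) := by simp
    rw [h1]
    refine (h _).trans (mul_le_mul_of_nonneg_left ((alphaNorm_le hn hr c x).trans ?_) hC.le)
    exact mul_le_of_le_one_left (pow_nonneg (weakNorm_nonneg _) _) hc

theorem STensorNorm.IsAlpha.dual_isAssociated {α : STensorNorm 𝕜 n} (hα : α.IsAlpha r)
    (hn : 1 ≤ n) (hr : (n : ℝ) ≤ r) : α.dual.IsAssociated (dominated 𝕜 n r) := by
  refine ⟨α.dual_finitelyGenerated, fun M _ _ _ => ⟨fun z => ?_, fun P hP => ?_⟩⟩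
  · have : CompleteSpace M := FiniteDimensional.complete 𝕜 M
    set d := α.dual.toSeminorm (StrongDual 𝕜 M) z with hd
    have hd0 : 0 ≤ d := apply_nonneg _ _
    -- Domination constants are positive by definition, so the infimum is compared with `d` only
    -- through positive `C`; this leaves room for `d = 0`.
    have key : ∀ C : ℝ, 0 < C → (DominatedWith n r (polyOf z) C ↔ d ≤ C) := by
      intro C hC
      change DominatedWith n r (fun x => symPair 𝕜 n M z (tpow 𝕜 n x)) C ↔ _
      rw [dominatedWith_iff hn hr _ hC, hd, α.dual_eq_dualFin]
      constructor
      · intro h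
        refine α.dualFin_strongDual_le z hC.le fun u hu => (h u).trans ?_
        rw [hα] at hu
        exact mul_le_of_le_one_right hC.le hu
      · intro h u
        refine (α.norm_symPair_le_dualFin_strongDual z u).trans ?_
        rw [hα, mul_comm]
        exact mul_le_mul_of_nonneg_right h (alphaNorm_nonneg hn hr u)
    refine ⟨⟨?_, d + 1, (key _ (by positivity)).2 (by linarith)⟩, ?_⟩
    · refine isHomPoly_of_linear (symPair 𝕜 n M z) (C := epsS z)
        (Real.iSup_nonneg fun _ => norm_nonneg _) fun x => ?_
      rw [mul_comm]
      exact norm_symPair_tpow_le z x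
    · change sInf {C : ℝ | DominatedWith n r (polyOf z) C} = d
      refine le_antisymm (le_of_forall_pos_le_add fun ε hε => ?_) (le_csInf ⟨d + 1, ?_⟩ ?_)
      · exact csInf_le ⟨0, fun C hC => hC.1.le⟩ ((key _ (by positivity)).2 (by linarith))
      · exact (key _ (by positivity)).2 (by linarith)
      · exact fun C hC => (key C hC.1).1 hC
  · exact hP.1.exists_polyOf

end Alpha

end SymRN

end

noncomputable section

namespace SymRN

/-! ### The Cauchy property of dominated polynomials -/

section Dominated

variable {𝕜 : Type} [RCLike 𝕜] {n m M : ℕ} {r : ℝ}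

/-- A functional of norm at most one on `ℓ_∞^M` has coefficients with absolute sum at most one. By
Jensen's inequality its `r`-sum is at most an average of the coordinate `r`-sums, hence at most the
largest of them. -/
theorem exists_max_weakNorm_fin [NeZero M] (hr : 1 ≤ r) (x : Fin m → Fin M → 𝕜) :
    ∃ i₀ : Fin M, weakNorm 𝕜 r x ^ r ≤ ∑ j, ‖x j i₀‖ ^ r := by
  have hr0 : 0 < r := by linarith
  obtain ⟨i₀, hi₀⟩ := Finite.exists_max fun i : Fin M => ∑ j, ‖x j i‖ ^ r
  refine ⟨i₀, weakNorm_rpow_le hr0 x (sum_rpow_norm_nonneg _ _ _) fun φ hφ => ?_⟩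
  have hφx : ∀ y : Fin M → 𝕜, φ y = ∑ i, y i * φ (Pi.single i 1) := fun y => by
    have h1 : y = ∑ i, y i • (Pi.single i 1 : Fin M → 𝕜) := by
      funext i
      simp [Pi.single_apply]
    conv_lhs => rw [h1]
    rw [map_sum]
    exact Finset.sum_congr rfl fun i _ => by rw [map_smul, smul_eq_mul]
  set a : Fin M → ℝ := fun i => ‖φ (Pi.single i 1)‖ with ha
  have ha0 : ∀ i, 0 ≤ a i := fun i => norm_nonneg _
  have hsum : ∑ i, a i ≤ 1 := by
    choose u hu1 hu using fun i => exists_rotation (φ (Pi.single i 1))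
    have h1 : φ u = ((∑ i, a i : ℝ) : 𝕜) := by
      rw [hφx]
      push_cast
      exact Finset.sum_congr rfl fun i _ => hu i
    have h2 : ‖φ u‖ ≤ 1 * ‖u‖ := φ.le_of_opNorm_le hφ u
    have h3 : ‖u‖ ≤ 1 := (pi_norm_le_iff_of_nonneg zero_le_one).2 fun i => (hu1 i).le
    rw [h1, RCLike.norm_ofReal, abs_of_nonneg (Finset.sum_nonneg fun i _ => ha0 i)] at h2
    linarith
  have hj : ∀ j, ‖φ (x j)‖ ^ r ≤ ∑ i, a i * ‖x j i‖ ^ r := by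
    intro j
    have h1 : ‖φ (x j)‖ ≤ ∑ i, a i * ‖x j i‖ := by
      rw [hφx]
      refine (norm_sum_le _ _).trans (le_of_eq (Finset.sum_congr rfl fun i _ => ?_))
      rw [norm_mul, mul_comm]
    have h2 := Real.inner_le_weight_mul_Lp_of_nonneg Finset.univ hr a (fun i => ‖x j i‖) ha0
      fun i => norm_nonneg _
    have h0 : 0 ≤ ∑ i, a i * ‖x j i‖ ^ r :=
      Finset.sum_nonneg fun i _ => mul_nonneg (ha0 i) (Real.rpow_nonneg (norm_nonneg _) _)
    have h3 : ‖φ (x j)‖ ≤ (∑ i, a i * ‖x j i‖ ^ r) ^ r⁻¹ := by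
      refine h1.trans (h2.trans (mul_le_of_le_one_left (Real.rpow_nonneg h0 _) ?_))
      exact Real.rpow_le_one (Finset.sum_nonneg fun i _ => ha0 i) hsum
        (sub_nonneg.2 (inv_le_one_of_one_le₀ hr))
    have h4 := Real.rpow_le_rpow (norm_nonneg _) h3 hr0.le
    rwa [Real.rpow_inv_rpow h0 hr0.ne'] at h4
  calc ∑ j, ‖φ (x j)‖ ^ r ≤ ∑ j, ∑ i, a i * ‖x j i‖ ^ r := Finset.sum_le_sum fun j _ => hj j
    _ = ∑ i, a i * ∑ j, ‖x j i‖ ^ r := by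
        rw [Finset.sum_comm]
        exact Finset.sum_congr rfl fun i _ => by rw [Finset.mul_sum]
    _ ≤ ∑ i, a i * ∑ j, ‖x j i₀‖ ^ r :=
        Finset.sum_le_sum fun i _ => mul_le_mul_of_nonneg_left (hi₀ i) (ha0 i)
    _ = (∑ i, a i) * ∑ j, ‖x j i₀‖ ^ r := by rw [Finset.sum_mul]
    _ ≤ ∑ j, ‖x j i₀‖ ^ r := mul_le_of_le_one_left (sum_rpow_norm_nonneg _ _ _) hsum

theorem norm_rpow_le_of_dominatedWith (hn : 1 ≤ n) (hr : (n : ℝ) ≤ r)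
    {E : Type} [NormedAddCommGroup E] [NormedSpace 𝕜 E] {P : E → 𝕜} {C : ℝ}
    (h : DominatedWith n r P C) (x : Fin m → E) :
    ∑ j, ‖P (x j)‖ ^ (r / n) ≤ C ^ (r / n) * weakNorm 𝕜 r x ^ r := by
  have hn0 : 0 < (n : ℝ) := Nat.cast_pos.2 hn
  have hr0 : 0 < r := hn0.trans_le hr
  have h1 := Real.rpow_le_rpow (Real.rpow_nonneg (sum_rpow_norm_nonneg _ _ _) _) (h.2 m x)
    (by positivity : 0 ≤ r / n)
  rwa [← Real.rpow_mul (sum_rpow_norm_nonneg _ _ _), div_mul_div_cancel₀ hr0.ne',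
    div_self hn0.ne', Real.rpow_one, Real.mul_rpow h.1.le (pow_nonneg (weakNorm_nonneg _) _),
    ← Real.rpow_natCast, ← Real.rpow_mul (weakNorm_nonneg _), mul_div_cancel₀ _ hn0.ne'] at h1

/-- The Pietsch domination theorem for polynomials on `ℓ_∞^M`. -/
theorem exists_pietsch_measure [NeZero M] (hn : 1 ≤ n) (hr : (n : ℝ) ≤ r) {P : (Fin M → 𝕜) → 𝕜}
    (hP : IsHomPoly n P) {C : ℝ} (h : DominatedWith n r P C) :
    ∃ μ : Fin M → ℝ, (∀ i, 0 ≤ μ i) ∧ ∑ i, μ i = 1 ∧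
      ∀ x, ‖P x‖ ^ (r / n) ≤ C ^ (r / n) * ∑ i, μ i * ‖x i‖ ^ r := by
  have hn0 : 0 < (n : ℝ) := Nat.cast_pos.2 hn
  have hr0 : 0 < r := hn0.trans_le hr
  have hn1 : (1 : ℝ) ≤ n := by exact_mod_cast hn
  -- A weight `μ` with nonnegative average against every `V x` is what is sought; it is found by
  -- separating the sums of such vectors from the negative orthant.
  let V : (Fin M → 𝕜) → Fin M → ℝ := fun x i => C ^ (r / n) * ‖x i‖ ^ r - ‖P x‖ ^ (r / n)
  let t : Set (Fin M → ℝ) := {v | ∃ (m : ℕ) (x : Fin m → Fin M → 𝕜), v = ∑ j, V (x j)}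
  let s : Set (Fin M → ℝ) := Set.univ.pi fun _ => Set.Iio 0
  -- Homogeneity of degree `r` in `x`, so the set of finite sums is already convex.
  have hVsmul : ∀ (a : ℝ), 0 ≤ a → ∀ x, V (((a ^ (1 / r) : ℝ) : 𝕜) • x) = a • V x := by
    intro a ha x
    have h1 : (a ^ (1 / r)) ^ r = a := by
      rw [← Real.rpow_mul ha, one_div_mul_cancel hr0.ne', Real.rpow_one]
    have h2 : ‖(((a ^ (1 / r) : ℝ) : 𝕜))‖ = a ^ (1 / r) := by
      rw [RCLike.norm_ofReal, abs_of_nonneg (by positivity)]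
    funext i
    simp only [V, Pi.smul_apply, smul_eq_mul, hP.map_smul, norm_mul, norm_pow, h2]
    rw [Real.mul_rpow (by positivity) (norm_nonneg _), Real.mul_rpow (by positivity) (norm_nonneg _),
      h1, ← Real.rpow_natCast (a ^ (1 / r)), ← Real.rpow_mul (by positivity),
      mul_div_cancel₀ _ hn0.ne', h1]
    ring
  have ht : Convex ℝ t := by
    rintro _ ⟨m, x, rfl⟩ _ ⟨m', x', rfl⟩ a b ha hb _
    refine ⟨m + m', Fin.append (fun j => ((a ^ (1 / r) : ℝ) : 𝕜) • x j)
      fun j => ((b ^ (1 / r) : ℝ) : 𝕜) • x' j, ?_⟩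
    rw [Fin.sum_univ_add]
    simp only [Fin.append_left, Fin.append_right, hVsmul a ha, hVsmul b hb, Finset.smul_sum]
  have hs : Convex ℝ s := convex_pi fun _ _ => convex_Iio 0
  have hso : IsOpen s := isOpen_set_pi Set.finite_univ fun _ _ => isOpen_Iio
  -- At the coordinate that attains the weak norm, domination makes the sum nonnegative.
  have hdisj : Disjoint s t := by
    rw [Set.disjoint_left]
    rintro _ hv ⟨m, x, rfl⟩
    obtain ⟨i₀, hi₀⟩ := exists_max_weakNorm_fin (hn1.trans hr) x
    have h1 : (∑ j, V (x j)) i₀ < 0 := hv i₀ (Set.mem_univ _)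
    rw [Finset.sum_apply] at h1
    simp only [V] at h1
    rw [Finset.sum_sub_distrib, ← Finset.mul_sum] at h1
    have h2 := norm_rpow_le_of_dominatedWith hn hr h x
    have h3 := mul_le_mul_of_nonneg_left hi₀ (Real.rpow_nonneg h.1.le (r / n))
    linarith
  obtain ⟨f, u, hfs, hft⟩ := geometric_hahn_banach_open hs hso ht hdisj
  have hu : u ≤ 0 := by
    have := hft 0 ⟨0, Fin.elim0, by simp⟩
    rwa [map_zero] at this
  have hneg : ∀ v ∈ s, f v < 0 := fun v hv => (hfs v hv).trans_le hu
  -- Repeating `x` arbitrarily often would push `f` below the separating value.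
  have hV : ∀ x, 0 ≤ f (V x) := by
    intro x
    by_contra! hx
    obtain ⟨k, hk⟩ := exists_nat_gt (u / f (V x))
    rw [div_lt_iff_of_neg hx] at hk
    have h1 := hft (k • V x) ⟨k, fun _ => x, by simp⟩
    rw [map_nsmul, nsmul_eq_mul] at h1
    linarith
  have hfv : ∀ v : Fin M → ℝ, f v = ∑ i, v i * f (Pi.single i 1) := fun v => by
    have h1 : v = ∑ i, v i • (Pi.single i 1 : Fin M → ℝ) := by
      funext i
      simp [Pi.single_apply]
    conv_lhs => rw [h1]
    rw [map_sum]
    exact Finset.sum_congr rfl fun i _ => by rw [map_smul, smul_eq_mul]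
  have hone : 0 < ∑ i, f (Pi.single i 1) := by
    have h1 := hneg (fun _ => -1) fun i _ => by norm_num
    rw [hfv] at h1
    simp only [neg_one_mul, Finset.sum_neg_distrib] at h1
    linarith
  set Z := ∑ i, f (Pi.single i 1) with hZ
  have hpos : ∀ i, 0 ≤ f (Pi.single i 1) := by
    intro i
    refine le_of_forall_pos_le_add fun ε hε => ?_
    -- The small constant vector moves `-e_i` into the open orthant at cost `ε`.
    have h1 := hneg (-(Pi.single i 1) - fun _ => ε / Z) fun j _ => by
      have h2 : 0 ≤ (Pi.single i 1 : Fin M → ℝ) j := by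
        by_cases hij : j = i
        · subst hij; simp
        · simp [hij]
      have h3 : 0 < ε / Z := by positivity
      simp only [Pi.sub_apply, Pi.neg_apply, Set.mem_Iio]
      linarith
    have h4 : f (fun _ => ε / Z) = ε := by
      rw [hfv, ← Finset.mul_sum, ← hZ, div_mul_cancel₀ _ hone.ne']
    rw [map_sub, map_neg, h4] at h1
    linarith
  refine ⟨fun i => f (Pi.single i 1) / Z, fun i => div_nonneg (hpos i) hone.le, ?_, fun x => ?_⟩
  · rw [← Finset.sum_div, ← hZ, div_self hone.ne']
  · have h1 := hV x
    rw [hfv] at h1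
    simp only [V, sub_mul, Finset.sum_sub_distrib] at h1
    rw [← Finset.mul_sum, ← hZ, sub_nonneg] at h1
    have h2 : C ^ (r / n) * ∑ i, f (Pi.single i 1) / Z * ‖x i‖ ^ r =
        (∑ i, C ^ (r / n) * ‖x i‖ ^ r * f (Pi.single i 1)) / Z := by
      rw [Finset.mul_sum, Finset.sum_div]
      exact Finset.sum_congr rfl fun i _ => by ring
    rw [h2, le_div_iff₀ hone]
    exact h1

/-- The easy half of Pietsch's theorem: coordinate functionals are admissible in the weak norm. A
total mass `S` enters as `S^{n/r}`, which is at most `S` since `S ≥ 1` and `n ≤ r`. -/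
theorem dominatedWith_of_measure (hn : 1 ≤ n) (hr : (n : ℝ) ≤ r) {P : (Fin M → 𝕜) → 𝕜} {C S : ℝ}
    (hC : 0 ≤ C) (ν : Fin M → ℝ) (hν : ∀ i, 0 ≤ ν i) (hS1 : 1 ≤ S) (hS : ∑ i, ν i ≤ S)
    (h : ∀ x, ‖P x‖ ≤ C * ((∑ i, ν i * ‖x i‖ ^ r) ^ (1 / r)) ^ n) {D : ℝ} (hD : 0 < D)
    (hCD : C * S ≤ D) : DominatedWith n r P D := by
  have hn0 : 0 < (n : ℝ) := Nat.cast_pos.2 hn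
  have hr0 : 0 < r := hn0.trans_le hr
  refine ⟨hD, fun m x => ?_⟩
  have hw := weakNorm_nonneg (𝕜 := 𝕜) (r := r) x
  have hcoord : ∀ i, ∑ j, ‖x j i‖ ^ r ≤ weakNorm 𝕜 r x ^ r := fun i =>
    sum_rpow_le_weakNorm hr0 x (ContinuousLinearMap.proj i)
      (ContinuousLinearMap.opNorm_le_bound _ zero_le_one fun y => by
        rw [one_mul]; exact norm_le_pi_norm y i)
  have hν0 : ∀ y : Fin M → 𝕜, 0 ≤ ∑ i, ν i * ‖y i‖ ^ r := fun y =>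
    Finset.sum_nonneg fun i _ => mul_nonneg (hν i) (Real.rpow_nonneg (norm_nonneg _) _)
  have h1 : ∀ j, ‖P (x j)‖ ^ (r / n) ≤ C ^ (r / n) * ∑ i, ν i * ‖x j i‖ ^ r := by
    intro j
    refine (Real.rpow_le_rpow (norm_nonneg _) (h (x j)) (by positivity)).trans_eq ?_
    rw [Real.mul_rpow hC (pow_nonneg (Real.rpow_nonneg (hν0 _) _) _), ← Real.rpow_natCast,
      ← Real.rpow_mul (hν0 _), ← Real.rpow_mul (hν0 _)]
    congr 1
    have h2 : 1 / r * n * (r / n) = 1 := by field_simp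
    rw [h2, Real.rpow_one]
  have h2 : ∑ j, ‖P (x j)‖ ^ (r / n) ≤ C ^ (r / n) * (S * weakNorm 𝕜 r x ^ r) := by
    refine (Finset.sum_le_sum fun j _ => h1 j).trans ?_
    rw [← Finset.mul_sum, Finset.sum_comm]
    refine mul_le_mul_of_nonneg_left ?_ (Real.rpow_nonneg hC _)
    calc ∑ i, ∑ j, ν i * ‖x j i‖ ^ r = ∑ i, ν i * ∑ j, ‖x j i‖ ^ r :=
          Finset.sum_congr rfl fun i _ => by rw [Finset.mul_sum]
      _ ≤ ∑ i, ν i * weakNorm 𝕜 r x ^ r :=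
          Finset.sum_le_sum fun i _ => mul_le_mul_of_nonneg_left (hcoord i) (hν i)
      _ = (∑ i, ν i) * weakNorm 𝕜 r x ^ r := by rw [Finset.sum_mul]
      _ ≤ S * weakNorm 𝕜 r x ^ r := by gcongr
  have h3 := Real.rpow_le_rpow (sum_rpow_norm_nonneg _ _ _) h2 (by positivity : 0 ≤ n / r)
  refine h3.trans ?_
  rw [Real.mul_rpow (by positivity) (by positivity), Real.mul_rpow (by positivity) (by positivity),
    ← Real.rpow_mul hC, ← Real.rpow_mul hw, div_mul_div_cancel₀ hn0.ne', div_self hr0.ne',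
    mul_div_cancel₀ _ hr0.ne', Real.rpow_natCast, Real.rpow_one, ← mul_assoc]
  refine mul_le_mul_of_nonneg_right ?_ (pow_nonneg hw _)
  refine le_trans (mul_le_mul_of_nonneg_left ?_ hC) hCD
  exact (Real.rpow_le_rpow_of_exponent_le hS1 ((div_le_one hr0).2 hr)).trans_eq (Real.rpow_one S)

/-- The seminorm `x ↦ (∑ μ_i |x_i|^r)^{1/r}` on `c_0` given by finitely many weights. -/
def weightSeminorm (𝕜 : Type) [RCLike 𝕜] {r : ℝ} (hr : 1 ≤ r) (μ : ℕ → ℝ) (hμ : ∀ i, 0 ≤ μ i)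
    (M : ℕ) : Seminorm 𝕜 (CZero 𝕜) :=
  Seminorm.ofSMulLE (fun x => (∑ i ∈ Finset.range M, μ i * ‖x i‖ ^ r) ^ (1 / r))
    (by
      have hr0 : 0 < r := by linarith
      have : ∀ i, (0 : CZero 𝕜) i = 0 := fun _ => rfl
      simp [this, Real.zero_rpow hr0.ne', Real.zero_rpow (inv_ne_zero hr0.ne')])
    (fun x y => by
      have hr0 : 0 < r := by linarith
      have h1 : ∀ z : CZero 𝕜, ∀ i, μ i * ‖z i‖ ^ r = (μ i ^ (1 / r) * ‖z i‖) ^ r := fun z i => by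
        rw [Real.mul_rpow (Real.rpow_nonneg (hμ i) _) (norm_nonneg _), ← Real.rpow_mul (hμ i),
          one_div_mul_cancel hr0.ne', Real.rpow_one]
      have h2 := Real.Lp_add_le_of_nonneg (Finset.range M) (f := fun i => μ i ^ (1 / r) * ‖x i‖)
        (g := fun i => μ i ^ (1 / r) * ‖y i‖) hr
        (fun i _ => mul_nonneg (Real.rpow_nonneg (hμ i) _) (norm_nonneg _))
        fun i _ => mul_nonneg (Real.rpow_nonneg (hμ i) _) (norm_nonneg _)
      simp only [h1]
      refine le_trans (Real.rpow_le_rpow ?_ (Finset.sum_le_sum fun i _ => ?_) (by positivity)) h2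
      · exact Finset.sum_nonneg fun i _ => Real.rpow_nonneg
          (mul_nonneg (Real.rpow_nonneg (hμ i) _) (norm_nonneg _)) _
      · refine Real.rpow_le_rpow (mul_nonneg (Real.rpow_nonneg (hμ i) _) (norm_nonneg _)) ?_ hr0.le
        rw [← mul_add]
        exact mul_le_mul_of_nonneg_left (norm_add_le (x i) (y i)) (Real.rpow_nonneg (hμ i) _))
    (fun c x => by
      have hr0 : 0 < r := by linarith
      have h1 : ∀ i, μ i * ‖(c • x) i‖ ^ r = ‖c‖ ^ r * (μ i * ‖x i‖ ^ r) := fun i => by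
        change μ i * ‖c * x i‖ ^ r = _
        rw [norm_mul, Real.mul_rpow (norm_nonneg _) (norm_nonneg _)]
        ring
      simp only [h1]
      rw [← Finset.mul_sum, Real.mul_rpow (by positivity) (Finset.sum_nonneg fun i _ =>
        mul_nonneg (hμ i) (Real.rpow_nonneg (norm_nonneg _) _)), ← Real.rpow_mul (norm_nonneg _),
        mul_one_div_cancel hr0.ne', Real.rpow_one])

theorem weightSeminorm_apply (hr : 1 ≤ r) (μ : ℕ → ℝ) (hμ : ∀ i, 0 ≤ μ i) (x : CZero 𝕜) :
    weightSeminorm 𝕜 hr μ hμ M x = (∑ i ∈ Finset.range M, μ i * ‖x i‖ ^ r) ^ (1 / r) := rfl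

end Dominated

end SymRN

end

/-! ### Small blocks of a Pietsch measure and the Cauchy property -/

noncomputable section

namespace SymRN

section DominatedCauchy

variable {𝕜 : Type} [RCLike 𝕜] {n : ℕ} {r : ℝ}

theorem DominatedWith.mono {E : Type} [NormedAddCommGroup E] [NormedSpace 𝕜 E] {P : E → 𝕜}
    {C D : ℝ} (h : DominatedWith n r P C) (hCD : C ≤ D) : DominatedWith n r P D :=
  ⟨h.1.trans_le hCD, fun m x => (h.2 m x).trans
    (mul_le_mul_of_nonneg_right hCD (pow_nonneg (weakNorm_nonneg x) n))⟩

theorem dominatedWith_of_norm_lt {E : Type} [NormedAddCommGroup E] [NormedSpace 𝕜 E] {P : E → 𝕜}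
    (hP : (dominated 𝕜 n r).Mem E P) {C : ℝ} (hC : (dominated 𝕜 n r).norm E P < C) :
    DominatedWith n r P C := by
  obtain ⟨D, hD, hDC⟩ := exists_lt_of_csInf_lt hP.2 hC
  exact DominatedWith.mono hD hDC.le

theorem exists_weights_of_dominatedWith (hn : 1 ≤ n) (hr : (n : ℝ) ≤ r) {P : CZero 𝕜 → 𝕜}
    (hP : IsHomPoly n P) {C : ℝ} {M : ℕ} (hM : M ≠ 0)
    (h : DominatedWith n r (P ∘ czIncl 𝕜 M) C) :
    ∃ μ : ℕ → ℝ, (∀ i, 0 ≤ μ i) ∧ ∑ i ∈ Finset.range M, μ i = 1 ∧ ∀ x,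
      ‖P (czTrunc 𝕜 M x)‖ ≤ C * ((∑ i ∈ Finset.range M, μ i * ‖x i‖ ^ r) ^ (1 / r)) ^ n := by
  have hn0 : 0 < (n : ℝ) := Nat.cast_pos.2 hn
  have hr0 : 0 < r := hn0.trans_le hr
  have : NeZero M := ⟨hM⟩
  obtain ⟨μ, hμ0, hμ1, hμ⟩ := exists_pietsch_measure hn hr (hP.comp (czIncl 𝕜 M)) h
  refine ⟨fun i => if hi : i < M then μ ⟨i, hi⟩ else 0, fun i => ?_, ?_, fun x => ?_⟩
  · dsimp only
    split_ifs
    exacts [hμ0 _, le_rfl]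
  · rw [Finset.sum_range]
    simpa using hμ1
  · have h1 := hμ (czProj 𝕜 M x)
    rw [Finset.sum_range]
    simp only [Fin.is_lt, dite_true, Fin.eta]
    set X := ∑ i : Fin M, μ i * ‖czProj 𝕜 M x i‖ ^ r with hX
    have hX0 : 0 ≤ X :=
      Finset.sum_nonneg fun i _ => mul_nonneg (hμ0 i) (Real.rpow_nonneg (norm_nonneg _) _)
    have h2 := Real.rpow_le_rpow (Real.rpow_nonneg (norm_nonneg _) _) h1
      (by positivity : 0 ≤ n / r)
    rw [← Real.rpow_mul (norm_nonneg _), div_mul_div_cancel₀ hn0.ne', div_self hr0.ne',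
      Real.rpow_one, Real.mul_rpow (Real.rpow_nonneg h.1.le _) hX0, ← Real.rpow_mul h.1.le,
      div_mul_div_cancel₀ hn0.ne', div_self hr0.ne', Real.rpow_one] at h2
    have h3 : (X ^ (1 / r)) ^ n = X ^ (n / r) := by
      rw [← Real.rpow_natCast, ← Real.rpow_mul hX0, one_div_mul_eq_div]
    refine h2.trans_eq ?_
    rw [← h3]
    rfl

/-- Pigeonhole: `m` disjoint blocks share total mass one. -/
theorem exists_block_sum_le {a b : ℕ → ℕ} (h : ∀ k, a k ≤ b k ∧ b k ≤ a (k + 1)) (μ : ℕ → ℝ)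
    (hμ : ∀ i, 0 ≤ μ i) {M m : ℕ} (hsum : ∑ i ∈ Finset.range M, μ i = 1) {η : ℝ}
    (hm : 1 ≤ m * η) : ∃ k < m,
      ∑ i ∈ Finset.range M, (if a k ≤ i ∧ i < b k then (1 : ℝ) else 0) * μ i ≤ η := by
  by_contra! hcon
  have hne : (Finset.range m).Nonempty := by
    rw [Finset.nonempty_range_iff]
    rintro rfl
    norm_num at hm
  have h1 : ∑ k ∈ Finset.range m, η < ∑ k ∈ Finset.range m, ∑ i ∈ Finset.range M,
      (if a k ≤ i ∧ i < b k then (1 : ℝ) else 0) * μ i :=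
    Finset.sum_lt_sum_of_nonempty hne fun k hk => hcon k (Finset.mem_range.1 hk)
  rw [Finset.sum_const, Finset.card_range, nsmul_eq_mul, Finset.sum_comm] at h1
  have h2 : ∑ i ∈ Finset.range M, ∑ k ∈ Finset.range m,
      (if a k ≤ i ∧ i < b k then (1 : ℝ) else 0) * μ i ≤ ∑ i ∈ Finset.range M, μ i := by
    refine Finset.sum_le_sum fun i _ => ?_
    rw [← Finset.sum_mul]
    refine mul_le_of_le_one_left (hμ i) ((sum_indicator_blocks_le h m i).trans ?_)
    split_ifs <;> norm_num
  linarith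

/-- The measure is multiplied by `δ^{-r}` on the light block, which leaves its total mass at most
two. If `A` is the resulting weighted norm of a vector, its truncation has `p`-norm at most `A` and
its block part at most `δ A`, so the perturbation estimate gives an increment of order `δ A^n`. -/
theorem dominatedWith_block (hn : 1 ≤ n) (hr : (n : ℝ) ≤ r) {P : CZero 𝕜 → 𝕜}
    (hP : IsHomPoly n P) {C : ℝ} (hC : 0 ≤ C) {M : ℕ} (μ : ℕ → ℝ) (hμ : ∀ i, 0 ≤ μ i)
    (hsum : ∑ i ∈ Finset.range M, μ i = 1)
    (hPμ : ∀ x, ‖P (czTrunc 𝕜 M x)‖ ≤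
      C * ((∑ i ∈ Finset.range M, μ i * ‖x i‖ ^ r) ^ (1 / r)) ^ n)
    {N N' : ℕ} (hN : N ≤ N') (hN' : N' ≤ M) {δ : ℝ} (hδ : 0 < δ) (hδ1 : δ ≤ 1)
    (hblock : ∑ i ∈ Finset.range M, (if N ≤ i ∧ i < N' then (1 : ℝ) else 0) * μ i ≤ δ ^ r)
    {ε : ℝ} (hε : 0 < ε) (hδε : 2 ^ n * polConst n * C * δ * 2 ≤ ε) :
    DominatedWith n r (fun x => P (czIncl 𝕜 N' x) - P (czTrunc 𝕜 N (czIncl 𝕜 N' x))) ε := by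
  have hn0 : 0 < (n : ℝ) := Nat.cast_pos.2 hn
  have hr0 : 0 < r := hn0.trans_le hr
  have hr1 : 1 ≤ r := (by exact_mod_cast hn : (1 : ℝ) ≤ n).trans hr
  have hc0 := polConst_nonneg n
  have hδr : 0 < δ ^ r := by positivity
  let ν : ℕ → ℝ := fun i => if i < N then μ i else μ i / δ ^ r
  have hν : ∀ i, 0 ≤ ν i := fun i => by
    simp only [ν]
    split_ifs
    exacts [hμ i, div_nonneg (hμ i) hδr.le]
  refine dominatedWith_of_measure hn hr (C := 2 ^ n * polConst n * C * δ) (by positivity)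
    (fun i : Fin N' => ν i) (fun i => hν i) one_le_two ?_ (fun x => ?_) hε hδε
  · rw [← Finset.sum_range fun i => ν i]
    have h1 : ∑ i ∈ Finset.range N', ν i ≤ ∑ i ∈ Finset.range N',
        (μ i + (if N ≤ i ∧ i < N' then (1 : ℝ) else 0) * μ i / δ ^ r) := by
      refine Finset.sum_le_sum fun i hi => ?_
      have hi' := Finset.mem_range.1 hi
      simp only [ν]
      by_cases hiN : i < N
      · rw [if_pos hiN, if_neg (by omega), zero_mul, zero_div, add_zero]
      · rw [if_neg hiN, if_pos ⟨by omega, hi'⟩, one_mul]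
        linarith [hμ i]
    refine h1.trans ((Finset.sum_le_sum_of_subset_of_nonneg (Finset.range_mono hN')
      fun i _ _ => ?_).trans ?_)
    · have : 0 ≤ (if N ≤ i ∧ i < N' then (1 : ℝ) else 0) := by split_ifs <;> norm_num
      have := hμ i
      positivity
    · rw [Finset.sum_add_distrib, hsum, ← Finset.sum_div]
      have := (div_le_one hδr).2 hblock
      linarith
  · set y := czIncl 𝕜 N' x with hy
    have hyM : czTrunc 𝕜 M y = y := czTrunc_czIncl_of_le hN' x
    have hsumν : ∑ i : Fin N', ν i * ‖x i‖ ^ r = ∑ i ∈ Finset.range M, ν i * ‖y i‖ ^ r := by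
      rw [← Finset.sum_subset (Finset.range_mono hN'), Finset.sum_range]
      · refine Finset.sum_congr rfl fun i _ => ?_
        rw [hy, czIncl_apply, dif_pos i.2]
      · intro i _ hi
        rw [hy, czIncl_apply, dif_neg (by simpa using hi), norm_zero, Real.zero_rpow hr0.ne',
          mul_zero]
    rw [hsumν]
    set X := ∑ i ∈ Finset.range M, ν i * ‖y i‖ ^ r with hX
    have hX0 : 0 ≤ X :=
      Finset.sum_nonneg fun i _ => mul_nonneg (hν i) (Real.rpow_nonneg (norm_nonneg _) _)
    let p := weightSeminorm 𝕜 hr1 μ hμ M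
    have hp1 : p (czTrunc 𝕜 N y) ≤ X ^ (1 / r) := by
      simp only [p, weightSeminorm_apply]
      refine Real.rpow_le_rpow (Finset.sum_nonneg fun i _ =>
        mul_nonneg (hμ i) (Real.rpow_nonneg (norm_nonneg _) _))
        (Finset.sum_le_sum fun i _ => ?_) (by positivity)
      rw [czTrunc_apply]
      by_cases hiN : i < N
      · simp only [ν, if_pos hiN, le_refl]
      · rw [if_neg hiN, norm_zero, Real.zero_rpow hr0.ne', mul_zero]
        exact mul_nonneg (hν i) (Real.rpow_nonneg (norm_nonneg _) _)
    have hp2 : p (czBlock 𝕜 N N' y) ≤ δ * X ^ (1 / r) := by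
      simp only [p, weightSeminorm_apply]
      have h1 : δ * X ^ (1 / r) = (δ ^ r * X) ^ (1 / r) := by
        rw [Real.mul_rpow hδr.le hX0, ← Real.rpow_mul hδ.le, mul_one_div_cancel hr0.ne',
          Real.rpow_one]
      rw [h1]
      refine Real.rpow_le_rpow (Finset.sum_nonneg fun i _ =>
        mul_nonneg (hμ i) (Real.rpow_nonneg (norm_nonneg _) _)) ?_ (by positivity)
      rw [hX, Finset.mul_sum]
      refine Finset.sum_le_sum fun i _ => ?_
      rw [czBlock_apply hN]
      by_cases hi : N ≤ i ∧ i < N'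
      · simp only [ν, if_pos hi, if_neg (not_lt.2 hi.1)]
        rw [← mul_assoc, mul_div_cancel₀ _ hδr.ne']
      · rw [if_neg hi, norm_zero, Real.zero_rpow hr0.ne', mul_zero]
        exact mul_nonneg hδr.le (mul_nonneg (hν i) (Real.rpow_nonneg (norm_nonneg _) _))
    have hdecomp : czTrunc 𝕜 N y + czBlock 𝕜 N N' y = y := by
      rw [czBlock, _root_.sub_apply, add_sub_cancel, hy, czTrunc_czIncl_of_le le_rfl]
    have hPp : ∀ x, ‖(P ∘ czTrunc 𝕜 M) x‖ ≤ C * p x ^ n := hPμ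
    have hval : P y - P (czTrunc 𝕜 N y) =
        (P ∘ czTrunc 𝕜 M) (czTrunc 𝕜 N y + czBlock 𝕜 N N' y) -
          (P ∘ czTrunc 𝕜 M) (czTrunc 𝕜 N y) := by
      rw [hdecomp, Function.comp_apply, Function.comp_apply, hyM,
        czTrunc_czTrunc_of_le (hN.trans hN')]
    rw [hval]
    -- The perturbation estimate needs `A > 0`; when `A = 0` both values of the polynomial vanish
    -- because `n ≥ 1`.
    rcases (Real.rpow_nonneg hX0 (1 / r)).eq_or_lt with hA | hA
    · rw [← hA] at hp1 hp2 ⊢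
      rw [mul_zero] at hp2
      have h1 : p (czTrunc 𝕜 N y + czBlock 𝕜 N N' y) = 0 :=
        le_antisymm ((map_add_le_add p _ _).trans (by linarith)) (apply_nonneg _ _)
      have h2 : p (czTrunc 𝕜 N y) = 0 := le_antisymm hp1 (apply_nonneg _ _)
      have h3 := hPp (czTrunc 𝕜 N y + czBlock 𝕜 N N' y)
      have h4 := hPp (czTrunc 𝕜 N y)
      rw [h1, zero_pow (by omega), mul_zero] at h3
      rw [h2, zero_pow (by omega), mul_zero] at h4
      rw [zero_pow (by omega), mul_zero]
      exact (norm_sub_le _ _).trans (by linarith)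
    · exact (hP.comp (czTrunc 𝕜 M)).norm_add_sub_le p hC hPp hA hδ hδ1 _ _ hp1 hp2

theorem dominated_cauchyProperty (hn : 1 ≤ n) (hr : (n : ℝ) ≤ r) :
    (dominated 𝕜 n r).CauchyProperty n := by
  intro P hP C hPC ε hε
  by_contra! hcon
  obtain ⟨a, b, hab⟩ := exists_blocks hcon
  have hab' : ∀ k, a k ≤ b k ∧ b k ≤ a (k + 1) := fun k => ⟨(hab k).1, (hab k).2.1⟩
  have hC : 0 ≤ C := (Real.sInf_nonneg fun C hC => hC.1.le).trans (hPC 0).2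
  have hc0 := polConst_nonneg n
  set D : ℝ := 2 ^ n * polConst n * (C + 1) * 2 with hD
  have hD0 : 0 ≤ D := by positivity
  set δ : ℝ := min 1 (ε / (D + 1)) with hδdef
  have hδ : 0 < δ := lt_min one_pos (by positivity)
  obtain ⟨m, hm⟩ := exists_nat_ge (1 / δ ^ r)
  rw [div_le_iff₀ (by positivity)] at hm
  -- The level `a m + 1` rather than `a m` keeps the index set nonempty, without which there is no
  -- probability measure.
  obtain ⟨μ, hμ0, hμ1, hμ⟩ := exists_weights_of_dominatedWith hn hr hP (Nat.succ_ne_zero (a m))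
    (dominatedWith_of_norm_lt (hPC _).1 ((hPC _).2.trans_lt (lt_add_one C)))
  obtain ⟨k, hk, hsmall⟩ := exists_block_sum_le hab' μ hμ0 hμ1 hm
  refine (hab k).2.2.not_ge (csInf_le ⟨0, fun C hC => hC.1.le⟩ ?_)
  refine dominatedWith_block hn hr hP (by positivity) μ hμ0 hμ1 hμ (hab k).1
    ((block_le hab' hk).trans (Nat.le_succ _)) hδ (min_le_left _ _) hsmall hε ?_
  calc 2 ^ n * polConst n * (C + 1) * δ * 2 = D * δ := by rw [hD]; ring
    _ ≤ D * (ε / (D + 1)) := by gcongr; exact min_le_right _ _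
    _ = ε * (D / (D + 1)) := by ring
    _ ≤ ε := mul_le_of_le_one_right hε.le ((div_le_one (by positivity)).2 (by linarith))

end DominatedCauchy

end SymRN

end

/-! ### Assembly of the three cases -/

namespace SymRN

theorem two_le_toReal {n : ℕ} {r : ℝ≥0∞} (hn : 2 ≤ n) (hr : r ≠ ∞) (hnr : (n : ℝ≥0∞) ≤ r) :
    2 ≤ r.toReal := by
  have h := ENNReal.toReal_mono hr hnr
  rw [ENNReal.toReal_natCast] at h
  exact (by exact_mod_cast hn : (2 : ℝ) ≤ n).trans h

theorem factorable_cauchyProperty (𝕜 : Type) [RCLike 𝕜] {n : ℕ} {r : ℝ≥0∞} [Fact (1 ≤ r)]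
    (hn : 2 ≤ n) (hnr : (n : ℝ≥0∞) ≤ r) : (factorable 𝕜 n r).CauchyProperty n := by
  rw [factorable_eq]
  by_cases hr : r = ∞
  · subst hr
    exact factorClass_top_cauchyProperty
  · exact (homPred_stable n 𝕜 r).cauchyProperty hr (two_le_toReal hn hr hnr)

end SymRN

open SymRN in
theorem mainTheorem11 (𝕜 : Type) [RCLike 𝕜] (n : ℕ) :
    (∀ (r : ℝ≥0∞) [Fact (1 ≤ r)], 2 ≤ n → (n : ℝ≥0∞) ≤ r →
      (∃ ρ : STensorNorm 𝕜 n, ρ.IsAssociated (factorable 𝕜 n r)) ∧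
      ∀ ρ : STensorNorm 𝕜 n, ρ.IsAssociated (factorable 𝕜 n r) → ρ.HasSRN) ∧
    (∀ (r : ℝ≥0∞) [Fact (1 ≤ r)], 2 ≤ n → (n : ℝ≥0∞) ≤ r → r < ∞ →
      (∃ δ : STensorNorm 𝕜 n, δ.IsAssociated (posFactorable 𝕜 n r)) ∧
      ∀ δ : STensorNorm 𝕜 n, δ.IsAssociated (posFactorable 𝕜 n r) → δ.HasSRN) ∧
    (∀ r : ℝ, 1 ≤ n → (n : ℝ) ≤ r →
      (∃ α : STensorNorm 𝕜 n, α.FinitelyGenerated ∧ α.IsAlpha r) ∧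
      ∀ α : STensorNorm 𝕜 n, α.IsAlpha r →
        α.dual.IsAssociated (dominated 𝕜 n r) ∧ α.dual.HasSRN) := by
  refine ⟨fun r _ hn hnr => ⟨?_, fun ρ hρ => ?_⟩, fun r _ hn hnr hr => ⟨?_, fun δ hδ => ?_⟩,
    fun r hn hr => ⟨?_, fun α hα => ?_⟩⟩
  · exact ((homPred_stable n 𝕜 r).isIdeal (by omega) hnr).exists_isAssociated
  · exact hρ.hasSRN (factorable_cauchyProperty 𝕜 hn hnr)
  · exact ((posPred_stable hn hr.ne hnr).isIdeal (by omega) hnr).exists_isAssociated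
  · exact hδ.hasSRN ((posPred_stable hn hr.ne hnr).cauchyProperty hr.ne
      (two_le_toReal hn hr.ne hnr))
  · exact ⟨alphaTensorNorm 𝕜 hn hr, (alphaTensorNorm_isAlpha hn hr).finitelyGenerated hn hr,
      alphaTensorNorm_isAlpha hn hr⟩
  · have h := hα.dual_isAssociated hn hr
    exact ⟨h, h.hasSRN (dominated_cauchyProperty hn hr)⟩
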